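/- **Conventions.** $X$ is a complex projective variety (reduced, irreducible, possibly singular), $D\subset X$ is a Zariski closed subset (the boundary divisor of a log variety $(X,D)$), $\partial$ is a $\mathbb Q$-Cartier divisor on $X$, and $|\partial|$ is its support. $H$ is an ample divisor on $X$ with a smooth hermitian metric on $\mathcal O_X(H)$, with Chern form $c_1(\overline H)$; some multiple $kH$, $k\ge 1$, is very ample and gives the embedding $X\subset\mathbb P^N$. Smooth functions and smooth $(1,1)$-forms on $X$ are restrictions of smooth functions and forms on $\mathbb P^N$, two forms being identified if they have the same pullback to every holomorphic disc in $X$; a form is positive if its pullback to every holomorphic disc in $X$ is. $\mathbb D$ is the unit disc, and $dd^c=\frac{i}{\pi}\partial\bar\partial$. For $f:\mathbb D\to X$ holomorphic and $0<r<1$ let $$T_f(r):A^{1,1}(X)\to\mathbb C,\qquad \omega\mapsto\int_0^r\frac{dt}{t}\int_{\mathbb D(t)}f^*\omega ,\qquad \deg_H(f,r)=T_f(r)(c_1(\overline H)).$$ $\overline{\mathrm{Hom}}(\mathbb D,X)$ is the space of holomorphic maps to $X$ from discs with bubbles (the unit disc with finite nodal trees of smooth rational curves attached at the points of a closed discrete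 subset), where convergence is Hausdorff convergence of the graphs in $\mathbb D\times X$ over compact subsets of $\mathbb D$. A sequence of maps $f_n$ is *arbitrarily close* to $Z\subset X$ if for every compact $K\subset\mathbb D$ and every $\varepsilon>0$ the set $f_n(K)$ lies in the $\varepsilon$-neighbourhood of $Z$ for all large $n$. **Statement.** Let $f_n\in\mathrm{Hom}(\mathbb D,X\setminus D)$ be a sequence that has no subsequence converging in $\overline{\mathrm{Hom}}(\mathbb D,X)$ and that is not arbitrarily close to $|\partial|\cup D$. 1. There are a subsequence $(f_{n_j})$ and a convergent sequence $\alpha_j\to\alpha$ in $\mathrm{Aut}(\mathbb D)$ such that, with $g_j=f_{n_j}\circ\alpha_j$, the points $g_j(0)$ are bounded away from $|\partial|\cup D$. Let $(g_j)$ be any sequence as in 1. 2. There are an infinite set $\mathcal N\subset\mathbb N$ and $0<s<1$ such that $\deg_H(g_j,s)\to\infty$ as $j\to\infty$ in $\mathcal N$. 3. Let $\mathcal N$ be any infinite set and $s>0$ any number such that $\deg_H(g_j,s)\to\infty$ along $\mathcal N$, and let $s\le r<1$. Then the normalised currents $T^H_{g_j}(r)=T_{g_j}(r)/\deg_H(g_j,r)$,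 $j\in\mathcal N$, have a weakly convergent subsequence. If they converge weakly along $\mathcal N$ to $T=T^H_{\mathcal N}(r)$, then $T$ is a current (continuous on $A^{1,1}(X)$ for the $C^\infty$ topology) that is positive ($T(\omega)\ge 0$ for every positive $\omega$) and harmonic ($T(dd^c\varphi)=0$ for every smooth function $\varphi$ on $X$), and $$T\cdot F\ \ge\ 0$$ for every effective $\mathbb Q$-Cartier divisor $F$ supported in $|\partial|\cup D$. Here $T\cdot F=\frac1m\,T\big(c_1(\mathcal O_X(mF),\|\cdot\|)\big)$ for any $m\ge1$ with $mF$ Cartier and any smooth metric $\|\cdot\|$ on $\mathcal O_X(mF)$. -/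

import Mathlib

open Filter Topology MeasureTheory Metric Set
open scoped ContDiff

namespace JensenCurrents

noncomputable section

/-! ### Projective space and projective varieties -/

/-- Homogeneous coordinate space `ℂ^(N+1)`. -/
abbrev Cn (N : ℕ) : Type := EuclideanSpace ℂ (Fin (N + 1))

/-- Complex projective space `ℙ^N`. -/
abbrev PN (N : ℕ) : Type := Projectivization ℂ (Cn N)

abbrev Poly (N : ℕ) : Type := MvPolynomial (Fin (N + 1)) ℂ

variable {N : ℕ}

/-- Value of a form at a homogeneous coordinate vector of `p`. It is used only for the vanishing
of homogeneous polynomials, for equations between polynomials of equal degree and for quotients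
of polynomials of equal degree, where the choice of the vector does not matter. -/
def pval (P : Poly N) (p : PN N) : ℂ := MvPolynomial.eval (fun i => p.rep i) P

/-- The chordal distance on `ℙ^N` (the sine of the angle between two lines). -/
def pdist (p q : PN N) : ℝ :=
  Real.sqrt (1 - (‖inner ℂ p.rep q.rep‖ / (‖p.rep‖ * ‖q.rep‖)) ^ 2)

/-- Zariski closed subsets of `ℙ^N`. -/
def IsZariskiClosed (Z : Set (PN N)) : Prop :=
  ∃ S : Set (Poly N), (∀ P ∈ S, ∃ d, P.IsHomogeneous d) ∧ Z = {p | ∀ P ∈ S, pval P p = 0}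

/-- A (reduced, irreducible, possibly singular) projective variety embedded in `ℙ^N`. -/
structure IsProjectiveVariety (X : Set (PN N)) : Prop where
  closed : IsZariskiClosed X
  nonempty : X.Nonempty
  irreducible : ∀ (P Q : Poly N) (d e : ℕ), P.IsHomogeneous d → Q.IsHomogeneous e →
    (∀ p ∈ X, pval P p * pval Q p = 0) → (∀ p ∈ X, pval P p = 0) ∨ (∀ p ∈ X, pval Q p = 0)

/-! ### Holomorphic maps -/

/-- `F` is, near `z`, a holomorphic lift of `f` to homogeneous coordinates. -/
def IsLift (f : ℂ → PN N) (z : ℂ) (F : ℂ → Cn N) : Prop :=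
  AnalyticAt ℂ F z ∧ ∀ᶠ w in 𝓝 z, ∃ h : F w ≠ 0, f w = Projectivization.mk ℂ (F w) h

/-- `f` is holomorphic at `z`, as a map to `ℙ^N`. -/
def HolAt (f : ℂ → PN N) (z : ℂ) : Prop := ∃ F, IsLift f z F

/-- The restriction of `f` to the unit disc is a holomorphic map to `Y`, that is, an element of
`Hom(𝔻, Y)`. Values outside the unit disc play no role. -/
def IsHolDisc (Y : Set (PN N)) (f : ℂ → PN N) : Prop :=
  ∀ z ∈ ball (0 : ℂ) 1, HolAt f z ∧ f z ∈ Y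

/-- The inverse of the coordinate at infinity of the Riemann sphere. -/
def atInfty (w : ℂ) : OnePoint ℂ := if w = 0 then OnePoint.infty else ((w⁻¹ : ℂ) : OnePoint ℂ)

/-- `g` is a holomorphic map from the Riemann sphere to `X`. -/
def IsRationalCurve (X : Set (PN N)) (g : OnePoint ℂ → PN N) : Prop :=
  (∀ z : ℂ, HolAt (fun w : ℂ => g (w : OnePoint ℂ)) z) ∧
    HolAt (fun w : ℂ => g (atInfty w)) 0 ∧ ∀ p, g p ∈ X

/-! ### Discs with bubbles and convergence of graphs -/

/-- `IsBubbleTree X x R` says that `R` is the image of a holomorphic map to `X` from a finite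
nodal tree of smooth rational curves with a marked smooth point that is sent to `x`. The root
component is parametrised with its marked point at infinity, and the subtrees are attached to
it at finitely many distinct other points `b ∈ B`. -/
inductive IsBubbleTree (X : Set (PN N)) : PN N → Set (PN N) → Prop
  | node (g : OnePoint ℂ → PN N) (hg : IsRationalCurve X g) (B : Finset ℂ)
      (R : ℂ → Set (PN N))
      (hR : ∀ b ∈ B, IsBubbleTree X (g (b : OnePoint ℂ)) (R b)) :
      IsBubbleTree X (g OnePoint.infty) (Set.range g ∪ ⋃ b ∈ B, R b)

/-- A holomorphic map to `X` from a disc with bubbles: a map `main` on the disc, a closed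
discrete set of nodes on the disc, and a tree of rational curves attached at each of them. -/
structure BubbledDisc (X : Set (PN N)) where
  main : ℂ → PN N
  hol : IsHolDisc X main
  nodes : Set ℂ
  nodes_sub : nodes ⊆ ball 0 1
  nodes_finite : ∀ r < (1 : ℝ), (nodes ∩ closedBall 0 r).Finite
  bubble : ℂ → Set (PN N)
  bubble_tree : ∀ z ∈ nodes, IsBubbleTree X (main z) (bubble z)

/-- The graph of a map on the unit disc. -/
def discGraph (f : ℂ → PN N) : Set (ℂ × PN N) := {p | p.1 ∈ ball (0 : ℂ) 1 ∧ p.2 = f p.1}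

/-- The graph of a disc with bubbles. -/
def BubbledDisc.graph {X : Set (PN N)} (b : BubbledDisc X) : Set (ℂ × PN N) :=
  discGraph b.main ∪ {p | p.1 ∈ b.nodes ∧ p.2 ∈ b.bubble p.1}

/-- The part of `Γ` over the closed disc of radius `r` lies in the `ε`-neighbourhood of `Γ'`. -/
def NearOver (r ε : ℝ) (Γ Γ' : Set (ℂ × PN N)) : Prop :=
  ∀ p ∈ Γ, ‖p.1‖ ≤ r → ∃ q ∈ Γ', ‖p.1 - q.1‖ < ε ∧ pdist p.2 q.2 < ε

/-- Convergence of graphs for the Hausdorff distance, over compact subsets of the disc. -/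
def GraphTendsto (Γn : ℕ → Set (ℂ × PN N)) (Γ : Set (ℂ × PN N)) : Prop :=
  ∀ r < (1 : ℝ), ∀ ε > (0 : ℝ), ∀ᶠ n in atTop, NearOver r ε (Γn n) Γ ∧ NearOver r ε Γ (Γn n)

/-- The sequence has a subsequence that converges in the space of maps to `X` from discs with
bubbles. -/
def HasConvergentSubseq (X : Set (PN N)) (f : ℕ → ℂ → PN N) : Prop :=
  ∃ φ : ℕ → ℕ, StrictMono φ ∧ ∃ b : BubbledDisc X,
    GraphTendsto (fun n => discGraph (f (φ n))) b.graph

/-- The sequence is arbitrarily close to `Z` in the compact-open sense. -/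
def ArbitrarilyClose (f : ℕ → ℂ → PN N) (Z : Set (PN N)) : Prop :=
  ∀ r < (1 : ℝ), ∀ ε > (0 : ℝ), ∀ᶠ n in atTop, ∀ z : ℂ, ‖z‖ ≤ r → ∃ q ∈ Z, pdist (f n z) q < ε

/-- `α` and `β` are mutually inverse automorphisms of the unit disc. -/
structure IsDiscAut (α β : ℂ → ℂ) : Prop where
  hol : DifferentiableOn ℂ α (ball 0 1)
  hol_inv : DifferentiableOn ℂ β (ball 0 1)
  maps : MapsTo α (ball 0 1) (ball 0 1)
  maps_inv : MapsTo β (ball 0 1) (ball 0 1)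
  left_inv : ∀ z ∈ ball (0 : ℂ) 1, β (α z) = z
  right_inv : ∀ z ∈ ball (0 : ℂ) 1, α (β z) = z

/-- `g` is obtained from a subsequence of `f` by composition with a convergent sequence of
automorphisms of the disc, and `g n 0` stays away from `Z`. -/
def IsNormalization (f : ℕ → ℂ → PN N) (Z : Set (PN N)) (g : ℕ → ℂ → PN N) : Prop :=
  ∃ φ : ℕ → ℕ, StrictMono φ ∧
    (∃ (α β : ℕ → ℂ → ℂ) (α' β' : ℂ → ℂ), (∀ n, IsDiscAut (α n) (β n)) ∧ IsDiscAut α' β' ∧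
      TendstoLocallyUniformlyOn α α' atTop (ball 0 1) ∧
      TendstoLocallyUniformlyOn β β' atTop (ball 0 1) ∧
      ∀ n, ∀ z ∈ ball (0 : ℂ) 1, g n z = f (φ n) (α n z)) ∧
    ∃ ε > (0 : ℝ), ∀ n, ∀ q ∈ Z, ε ≤ pdist (g n 0) q

/-! ### Smooth forms of type (1,1) -/

/-- Coefficient matrices of sesquilinear forms on `ℂ^(N+1)`. -/
abbrev Coeff (N : ℕ) : Type := Fin (N + 1) → Fin (N + 1) → ℂ

/-- Smooth complex `(1,1)`-forms on `ℙ^N`, given by their pullbacks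
`(i/2) ∑ h_{jk} dz_j ∧ dz̄_k` to `ℂ^(N+1) ∖ {0}`; the pullbacks are the smooth `(1,1)`-forms that
are horizontal and invariant under scaling. The value of `h` at `0` plays no role. -/
def Form11 (N : ℕ) : Submodule ℂ (Cn N → Coeff N) where
  carrier := {h | ContDiffOn ℝ ∞ h {0}ᶜ ∧
    (∀ v : Cn N, v ≠ 0 → (∀ k, ∑ j, h v j k * v j = 0) ∧
      ∀ j, ∑ k, h v j k * starRingEnd ℂ (v k) = 0) ∧
    (∀ c : ℂ, c ≠ 0 → ∀ v : Cn N, v ≠ 0 → ∀ j k,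
      h (c • v) j k * (c * starRingEnd ℂ c) = h v j k)}
  zero_mem' := ⟨contDiffOn_const, by simp, by simp⟩
  add_mem' := by
    rintro h l ⟨h1, h2, h3⟩ ⟨l1, l2, l3⟩
    refine ⟨h1.add l1, fun v hv => ⟨fun k => ?_, fun j => ?_⟩, fun c hc v hv j k => ?_⟩
    · simp [add_mul, Finset.sum_add_distrib, (h2 v hv).1 k, (l2 v hv).1 k]
    · simp [add_mul, Finset.sum_add_distrib, (h2 v hv).2 j, (l2 v hv).2 j]
    · simp only [Pi.add_apply]
      rw [add_mul, h3 c hc v hv, l3 c hc v hv]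
  smul_mem' := by
    rintro c h ⟨h1, h2, h3⟩
    refine ⟨h1.const_smul c, fun v hv => ⟨fun k => ?_, fun j => ?_⟩, fun c' hc v hv j k => ?_⟩
    · simp [mul_assoc, ← Finset.mul_sum, (h2 v hv).1 k]
    · simp [mul_assoc, ← Finset.mul_sum, (h2 v hv).2 j]
    · simp only [Pi.smul_apply, smul_eq_mul]
      rw [mul_assoc, h3 c' hc v hv]

/-- The density, with respect to Lebesgue measure, of the pullback of a `(1,1)`-form by the
map to `ℙ^N` with homogeneous coordinates `F`. -/
def dens (η : Form11 N) (F : ℂ → Cn N) (z : ℂ) : ℂ :=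
  ∑ j, ∑ k, η.1 (F z) j k * (deriv F z j * starRingEnd ℂ (deriv F z k))

/-- `F` gives homogeneous coordinates of a germ at `z` of a holomorphic disc in `X`. -/
def IsGermIn (X : Set (PN N)) (F : ℂ → Cn N) (z : ℂ) : Prop :=
  AnalyticAt ℂ F z ∧ ∀ᶠ w in 𝓝 z, ∃ h : F w ≠ 0, Projectivization.mk ℂ (F w) h ∈ X

/-- The forms on `ℙ^N` whose restriction to `X` is zero. A `(1,1)`-form restricts to zero if
and only if its pullback to every holomorphic disc in `X` is zero. -/
def vanishingOn (X : Set (PN N)) : Submodule ℂ (Form11 N) where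
  carrier := {η | ∀ F z, IsGermIn X F z → dens η F z = 0}
  zero_mem' := by intro F z _; simp [dens]
  add_mem' := by
    intro η θ h1 h2 F z hF
    have e1 := h1 F z hF
    have e2 := h2 F z hF
    simp only [dens] at e1 e2 ⊢
    simp [add_mul, Finset.sum_add_distrib, e1, e2]
  smul_mem' := by
    intro c η h1 F z hF
    have e1 := h1 F z hF
    simp only [dens] at e1 ⊢
    simp only [Submodule.coe_smul, Pi.smul_apply, smul_eq_mul, mul_assoc c, ← Finset.mul_sum, e1,
      mul_zero]

/-- The space `A^{1,1}(X)` of smooth `(1,1)`-forms on `X`: restrictions of forms on `ℙ^N`. -/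
abbrev A11 (X : Set (PN N)) : Type := Form11 N ⧸ vanishingOn X

/-- The restriction of a form to `X`. -/
def res (X : Set (PN N)) (η : Form11 N) : A11 X := Submodule.Quotient.mk η

/-- A form is positive on `X` if its pullback to every holomorphic disc in `X` is. -/
def PositiveOn (X : Set (PN N)) (η : Form11 N) : Prop :=
  ∀ F z, IsGermIn X F z → (dens η F z).im = 0 ∧ 0 ≤ (dens η F z).re

/-- `η = dd^c u` on `X`, over the open cone `U`, where `u` is a function on the cone over `X`.
The operator `dd^c = (i/π) ∂∂̄` is `(1/2π)` times the Laplacian on discs, so that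
`∫₀^r dt/t ∫_{𝔻(t)} dd^c u = mean of u over ∂𝔻(r) - u(0)`. -/
def IsDdc (X : Set (PN N)) (U : Set (Cn N)) (u : Cn N → ℂ) (η : Form11 N) : Prop :=
  ∀ F z, IsGermIn X F z → F z ∈ U →
    dens η F z = (1 / (2 * Real.pi) : ℝ) * Laplacian.laplacian (fun w => u (F w)) z

/-- The function on the cone that corresponds to a function on projective space. -/
def coneFun {A : Type*} [Zero A] (φ : PN N → A) (v : Cn N) : A :=
  open Classical in if h : v = 0 then 0 else φ (Projectivization.mk ℂ v h)

/-- A function on the cone over `X` is smooth if it extends, locally, to a smooth function on an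
open subset of `ℂ^(N+1)`. -/
def SmoothOnCone {A : Type*} [NormedAddCommGroup A] [NormedSpace ℝ A]
    (X : Set (PN N)) (u : Cn N → A) : Prop :=
  ∀ (v : Cn N) (h : v ≠ 0), Projectivization.mk ℂ v h ∈ X →
    ∃ (U : Set (Cn N)) (w : Cn N → A), IsOpen U ∧ v ∈ U ∧ ContDiffOn ℝ ∞ w U ∧
      ∀ v' ∈ U, ∀ h' : v' ≠ 0, Projectivization.mk ℂ v' h' ∈ X → u v' = w v'

/-- Smooth complex functions on `X`. -/
def SmoothOn (X : Set (PN N)) (φ : PN N → ℂ) : Prop := SmoothOnCone X (coneFun φ)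

/-! ### Ample metrics -/

/-- A smooth hermitian metric on the line bundle `O_X(1)`, given by the norm `m` of the dual
metric on the tautological bundle `O_X(-1)`, whose nonzero vectors form the cone over `X`. -/
structure IsMetricO1 (X : Set (PN N)) (m : Cn N → ℝ) : Prop where
  pos : ∀ (v : Cn N) (h : v ≠ 0), Projectivization.mk ℂ v h ∈ X → 0 < m v
  homog : ∀ (v : Cn N) (h : v ≠ 0), Projectivization.mk ℂ v h ∈ X → ∀ c : ℂ, m (c • v) = ‖c‖ * m v
  smooth : SmoothOnCone X m

/-- Let `H` be an ample divisor on `X` such that `kH` defines the embedding of `X` in `ℙ^N`, so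
that `O_X(kH) = O_X(1)`, and let `O_X(H)` have the metric whose `k`-th power is dual to `m`.
This says that `η` is the Chern form of this metric, `k c₁(H) = dd^c log m`. -/
def IsAmpleChernForm (X : Set (PN N)) (k : ℕ) (m : Cn N → ℝ) (η : Form11 N) : Prop :=
  IsDdc X univ (fun v => ((Real.log (m v) / k : ℝ) : ℂ)) η

/-! ### Cartier divisors -/

/-- The rational functions `P/Q` and `P'/Q'` on `X` differ by a unit of the local ring of `X`
at `y`. -/
def UnitEquivAt (X : Set (PN N)) (y : PN N) (P Q P' Q' : Poly N) : Prop :=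
  ∃ (A B : Poly N) (d : ℕ), A.IsHomogeneous d ∧ B.IsHomogeneous d ∧
    pval A y ≠ 0 ∧ pval B y ≠ 0 ∧
    ∀ p ∈ X, pval P p * pval Q' p * pval B p = pval P' p * pval Q p * pval A p

/-- A Cartier divisor on the variety `X`: at each point `x` of `X` a nonzero rational function
`P x / Q x` on `X`, its local equation, such that the local equation at `x` is also a local
equation, up to units, at all points of a Zariski neighbourhood of `x`. -/
structure CartierDivisor (X : Set (PN N)) where
  P : PN N → Poly N
  Q : PN N → Poly N
  deg : PN N → ℕ
  homogP : ∀ x ∈ X, (P x).IsHomogeneous (deg x)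
  homogQ : ∀ x ∈ X, (Q x).IsHomogeneous (deg x)
  nonzeroP : ∀ x ∈ X, ∃ p ∈ X, pval (P x) p ≠ 0
  nonzeroQ : ∀ x ∈ X, ∃ p ∈ X, pval (Q x) p ≠ 0
  compat : ∀ x ∈ X, ∃ (S : Poly N) (d : ℕ), S.IsHomogeneous d ∧ pval S x ≠ 0 ∧
    ∀ y ∈ X, pval S y ≠ 0 → UnitEquivAt X y (P x) (Q x) (P y) (Q y)

/-- The support of a Cartier divisor: the points where the local equation is not a unit. -/
def CartierDivisor.support {X : Set (PN N)} (E : CartierDivisor X) : Set (PN N) :=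
  {x ∈ X | ¬ UnitEquivAt X x (E.P x) (E.Q x) 1 1}

/-- `A/B` is an expression of the local equation of `E` at `x` as a regular function. -/
def CartierDivisor.RegularEq {X : Set (PN N)} (E : CartierDivisor X) (x : PN N)
    (A B : Poly N) : Prop :=
  ∃ d : ℕ, A.IsHomogeneous d ∧ B.IsHomogeneous d ∧ pval B x ≠ 0 ∧
    ∀ p ∈ X, pval (E.P x) p * pval B p = pval (E.Q x) p * pval A p

/-- Effective Cartier divisors: all local equations are regular. -/
def CartierDivisor.Effective {X : Set (PN N)} (E : CartierDivisor X) : Prop :=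
  ∀ x ∈ X, ∃ A B, E.RegularEq x A B

/-- `η` is the Chern form of a smooth metric on `O_X(E)`, for `E` effective. The metric is given
by the norm `ρ` of the tautological section. Near each point `ρ = |A/B| e^{-u}`, where `A/B` is a
local equation and `u` is smooth, and the Chern form is `dd^c u`, that is, `- dd^c log ρ` outside
the support of `E`. -/
def CartierDivisor.IsChernForm {X : Set (PN N)} (E : CartierDivisor X) (η : Form11 N) : Prop :=
  ∃ ρ : PN N → ℝ, ∀ (v : Cn N) (h : v ≠ 0), Projectivization.mk ℂ v h ∈ X →
    ∃ (A B : Poly N) (U : Set (Cn N)) (u : Cn N → ℝ),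
      E.RegularEq (Projectivization.mk ℂ v h) A B ∧ IsOpen U ∧ v ∈ U ∧ ContDiffOn ℝ ∞ u U ∧
      (∀ v' ∈ U, ∀ h' : v' ≠ 0, Projectivization.mk ℂ v' h' ∈ X →
        pval B (Projectivization.mk ℂ v' h') ≠ 0 ∧
        ρ (Projectivization.mk ℂ v' h') =
          ‖pval A (Projectivization.mk ℂ v' h') / pval B (Projectivization.mk ℂ v' h')‖
            * Real.exp (-u v')) ∧
      IsDdc X U (fun v' => (u v' : ℂ)) η

/-- A `ℚ`-Cartier divisor, of which the positive multiple `num = mult • _` is Cartier. -/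
structure QCartierDivisor (X : Set (PN N)) where
  mult : ℕ
  mult_pos : 0 < mult
  num : CartierDivisor X

def QCartierDivisor.support {X : Set (PN N)} (E : QCartierDivisor X) : Set (PN N) :=
  E.num.support

def QCartierDivisor.Effective {X : Set (PN N)} (E : QCartierDivisor X) : Prop :=
  E.num.Effective

/-! ### Currents -/

/-- The density of `f^* η` at `z`, computed with a local holomorphic lift of `f` (it does not
depend on the lift). -/
def pullDens (f : ℂ → PN N) (η : Form11 N) (z : ℂ) : ℂ :=
  open Classical in if h : HolAt f z then dens η h.choose z else 0

/-- The current `T_f(r) : η ↦ ∫₀^r dt/t ∫_{𝔻(t)} f^* η`. -/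
def discCurrent (f : ℂ → PN N) (r : ℝ) (η : Form11 N) : ℂ :=
  ∫ t in (0 : ℝ)..r, ((1 / t : ℝ) : ℂ) * ∫ z in ball (0 : ℂ) t, pullDens f η z

/-- The degree of `f` at radius `r` with respect to a metrised divisor with Chern form `ηH`. -/
def discDegree (ηH : Form11 N) (f : ℂ → PN N) (r : ℝ) : ℝ := (discCurrent f r ηH).re

/-- `T` is the weak limit of the currents `T_{g_n}(r)` divided by the degrees of the `g_n`. -/
def IsWeakLimit (X : Set (PN N)) (ηH : Form11 N) (g : ℕ → ℂ → PN N) (r : ℝ)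
    (T : A11 X →ₗ[ℂ] ℂ) : Prop :=
  ∀ η : Form11 N, Tendsto (fun n => discCurrent (g n) r η / (discDegree ηH (g n) r : ℂ)) atTop
    (𝓝 (T (res X η)))

/-- Continuity of a linear functional on `A^{1,1}(X)` for the `C^∞` topology. -/
def IsCurrent {X : Set (PN N)} (T : A11 X →ₗ[ℂ] ℂ) : Prop :=
  ∃ (k : ℕ) (C : ℝ), ∀ (η : Form11 N) (M : ℝ),
    (∀ j ≤ k, ∀ v : Cn N, ‖v‖ = 1 → ‖iteratedFDeriv ℝ j η.1 v‖ ≤ M) → ‖T (res X η)‖ ≤ C * M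

/-- Positivity of a current. -/
def IsPositive {X : Set (PN N)} (T : A11 X →ₗ[ℂ] ℂ) : Prop :=
  ∀ η : Form11 N, PositiveOn X η → (T (res X η)).im = 0 ∧ 0 ≤ (T (res X η)).re

/-- Harmonicity of a current: it is zero on `dd^c φ` for all smooth functions `φ` on `X`. -/
def IsHarmonic {X : Set (PN N)} (T : A11 X →ₗ[ℂ] ℂ) : Prop :=
  ∀ (φ : PN N → ℂ) (η : Form11 N), SmoothOn X φ → IsDdc X univ (coneFun φ) η →
    T (res X η) = 0

/-- `c` is the intersection number of `T` with the effective `ℚ`-Cartier divisor `F`: the value of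
`T` on the Chern form of a smooth metric on the line bundle of a Cartier multiple of `F`, divided
by the multiplicity. -/
def IsIntersectionNumber {X : Set (PN N)} (T : A11 X →ₗ[ℂ] ℂ) (F : QCartierDivisor X)
    (c : ℂ) : Prop :=
  ∃ η : Form11 N, F.num.IsChernForm η ∧ c = T (res X η) / F.mult

end

end JensenCurrents

namespace JensenCurrents

variable {N : ℕ}

/-! ### The chordal distance -/

/-! The analytic engine is the Jensen formula: if the pullback of `η` to a disc is dd^c of a C²
function u, then T_f(r)(η) is the mean of u over the circle of radius r minus u(0)
(`radialInt_laplacian`, `discCurrent_of_potential`). For η = dd^c φ on X this value is at most 2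
sup|φ|, which is finite by compactness. For the Chern form of an effective divisor, u is minus the
logarithm of the norm ρ of the tautological section, up to singularities at the zeros of the section
along the disc. These contribute with a favourable sign, so T_f(r)(η) ≥ log ρ(f(0)) - log sup ρ
(`le_discCurrent_of_local`), which is bounded below as long as f(0) stays away from the support.
Division by degrees that tend to infinity turns the two bounds into harmonicity and T·F ≥ 0.
Positivity already holds before the limit.

Weak compactness comes from the Fubini–Study density, whose potential is log‖F‖ for any lift F and
which dominates every smooth form (`norm_dens_le`). Since log‖v‖ - log m(v) is bounded on the cone
over X, Fubini–Study energy and k times the degree differ by a bounded amount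
(`exists_energy_bound`). So the normalised currents are bounded for the C⁰ norm, and degrees
increase with the radius up to a constant.

That the degree diverges at some radius is proved by contradiction. Otherwise the degrees at every
radius s < 1 are eventually bounded. A disc of bounded degree has a lift that is bounded above and
bounded away from 0 at the centre (`exists_normalized_lift`), so by Montel the lifts converge along
an ultrafilter to a map G that does not vanish identically. Away from the zeros of G the discs
converge in projective space. At a zero of order m, rescaling at the scale on which the zeros of the
coordinate functions separate produces a rational curve whose lift has only zeros of order less than
m (`exists_rescaling`). Induction on m gives a finite tree (`exists_bubbleTree`), and a subsequence
converges to a disc with bubbles, contrary to the hypothesis. The ultrafilter postpones the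
extraction of a subsequence to one final diagonal step (`exists_graphTendsto`).

Normalisation itself is elementary: points of a fixed compact disc whose images stay away from the
boundary are moved to 0 by Möbius maps (`exists_isNormalization`). -/

theorem rep_mk (v : Cn N) (hv : v ≠ 0) :
    ∃ c : ℂ, c ≠ 0 ∧ (Projectivization.mk ℂ v hv).rep = c • v := by
  obtain ⟨a, ha⟩ := Projectivization.exists_smul_eq_mk_rep ℂ v hv
  exact ⟨a, a.ne_zero, ha.symm⟩

theorem mk_smul_eq {v : Cn N} (hv : v ≠ 0) {c : ℂ} (h : c • v ≠ 0) :
    Projectivization.mk ℂ (c • v) h = Projectivization.mk ℂ v hv :=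
  (Projectivization.mk_eq_mk_iff' ℂ _ _ _ _).2 ⟨c, rfl⟩

theorem pdist_mk {v w : Cn N} (hv : v ≠ 0) (hw : w ≠ 0) :
    pdist (Projectivization.mk ℂ v hv) (Projectivization.mk ℂ w hw) =
      Real.sqrt (1 - (‖inner ℂ v w‖ / (‖v‖ * ‖w‖)) ^ 2) := by
  obtain ⟨a, ha, ea⟩ := rep_mk v hv
  obtain ⟨b, hb, eb⟩ := rep_mk w hw
  have := norm_ne_zero_iff.2 ha
  have := norm_ne_zero_iff.2 hb
  have := norm_ne_zero_iff.2 hv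
  have := norm_ne_zero_iff.2 hw
  rw [pdist, ea, eb, inner_smul_left, inner_smul_right, norm_mul, norm_mul, norm_smul, norm_smul,
    RCLike.norm_conj]
  congr 3
  field_simp

/-- Pythagoras for the splitting of `v` along `w` and its orthogonal complement. The first summand
is the squared distance from `v` to the line of `w`; the second vanishes for the optimal `c`. It
serves both for the chordal distance and for the Fubini–Study density. -/
theorem norm_sub_inner_smul_sq {v w : Cn N} (hw : w ≠ 0) (c : ℂ) :
    ‖v - c • w‖ ^ 2 = (‖v‖ ^ 2 - (‖inner ℂ v w‖ / ‖w‖) ^ 2)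
      + ‖inner ℂ w v / (‖w‖ : ℂ) - c * ‖w‖‖ ^ 2 := by
  have hw' : (‖w‖ : ℂ) ≠ 0 := by exact_mod_cast norm_ne_zero_iff.2 hw
  have key : ((‖v - c • w‖ ^ 2 : ℝ) : ℂ) = (((‖v‖ ^ 2 - (‖inner ℂ v w‖ / ‖w‖) ^ 2)
      + ‖inner ℂ w v / (‖w‖ : ℂ) - c * ‖w‖‖ ^ 2 : ℝ) : ℂ) := by
    push_cast
    have hself : ∀ x : Cn N, inner ℂ x x = (‖x‖ : ℂ) ^ 2 := fun x => inner_self_eq_norm_sq_to_K x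
    rw [← hself (v - c • w), div_pow, ← Complex.mul_conj' (inner ℂ v w),
      ← Complex.mul_conj' (inner ℂ w v / (‖w‖ : ℂ) - c * ‖w‖), inner_sub_left, inner_sub_right,
      inner_sub_right]
    simp only [inner_smul_left, inner_smul_right, map_sub, map_mul, map_div₀, inner_conj_symm,
      Complex.conj_ofReal]
    simp only [hself]
    field_simp
    ring
  exact_mod_cast key

/-- With `exists_pdist_mk_eq` this describes the chordal distance as the minimum over `c` of the
relative error `‖v - c • w‖ / ‖v‖`, so estimates in projective space become estimates of vectors. -/
theorem pdist_mk_le {v w : Cn N} (hv : v ≠ 0) (hw : w ≠ 0) (c : ℂ) :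
    pdist (Projectivization.mk ℂ v hv) (Projectivization.mk ℂ w hw) ≤ ‖v - c • w‖ / ‖v‖ := by
  rw [pdist_mk]
  have h1 := norm_pos_iff.2 hv
  have h2 := norm_pos_iff.2 hw
  apply Real.sqrt_le_iff.2 ⟨by positivity, ?_⟩
  rw [div_pow ‖v - c • w‖, norm_sub_inner_smul_sq hw c, le_div_iff₀ (by positivity)]
  have : (1 - (‖inner ℂ v w‖ / (‖v‖ * ‖w‖)) ^ 2) * ‖v‖ ^ 2
    = ‖v‖ ^ 2 - (‖inner ℂ v w‖ / ‖w‖) ^ 2 := by field_simp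
  rw [this]
  linarith [sq_nonneg ‖inner ℂ w v / (‖w‖ : ℂ) - c * ‖w‖‖]

theorem exists_pdist_mk_eq {v w : Cn N} (hv : v ≠ 0) (hw : w ≠ 0) :
    ∃ c : ℂ, ‖c • w‖ ≤ ‖v‖ ∧
      pdist (Projectivization.mk ℂ v hv) (Projectivization.mk ℂ w hw) = ‖v - c • w‖ / ‖v‖ := by
  have h1 := norm_pos_iff.2 hv
  have h2 := norm_pos_iff.2 hw
  have hw' : (‖w‖ : ℂ) ≠ 0 := by exact_mod_cast norm_ne_zero_iff.2 hw
  refine ⟨inner ℂ w v / (‖w‖ : ℂ) ^ 2, ?_, ?_⟩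
  · have := norm_inner_le_norm (𝕜 := ℂ) w v
    rw [norm_smul, norm_div, norm_pow, Complex.norm_real, norm_norm]
    rw [div_mul_eq_mul_div, div_le_iff₀ (by positivity)]
    nlinarith
  · rw [pdist_mk]
    refine (Real.sqrt_eq_iff_mul_self_eq ?_ (by positivity)).2 ?_
    · have := norm_inner_le_norm (𝕜 := ℂ) v w
      rw [sub_nonneg]
      apply pow_le_one₀ (by positivity)
      exact div_le_one_of_le₀ this (by positivity)
    · rw [← sq, div_pow ‖v - _‖, norm_sub_inner_smul_sq hw]
      have : inner ℂ w v / (‖w‖ : ℂ) - inner ℂ w v / (‖w‖ : ℂ) ^ 2 * ‖w‖ = 0 := by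
        field_simp; ring
      rw [this]
      field_simp
      simp

theorem pdist_nonneg (p q : PN N) : 0 ≤ pdist p q := Real.sqrt_nonneg _

theorem pdist_comm (p q : PN N) : pdist p q = pdist q p := by
  simp only [pdist, norm_inner_symm p.rep q.rep, mul_comm ‖p.rep‖]

theorem pdist_triangle (p q r : PN N) : pdist p r ≤ pdist p q + pdist q r := by
  induction p using Projectivization.ind with | h u hu => ?_
  induction q using Projectivization.ind with | h v hv => ?_
  induction r using Projectivization.ind with | h w hw => ?_
  obtain ⟨a, ha, ea⟩ := exists_pdist_mk_eq hu hv
  obtain ⟨b, hb, eb⟩ := exists_pdist_mk_eq hv hw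
  -- If `a • v` is the best approximation of `u` and `b • w` that of `v`, then `(a * b) • w`
  -- approximates `u`. The bound `‖a • v‖ ≤ ‖u‖` turns the error of the second approximation into
  -- one relative to `‖v‖`.
  refine (pdist_mk_le hu hw (a * b)).trans ?_
  rw [ea, eb]
  have h1 := norm_pos_iff.2 hu
  have h2 := norm_pos_iff.2 hv
  have e : u - (a * b) • w = (u - a • v) + a • (v - b • w) := by
    rw [smul_sub, smul_smul]; abel
  rw [e, div_le_iff₀ h1]
  refine (norm_add_le _ _).trans ?_
  rw [add_mul, div_mul_cancel₀ _ h1.ne', norm_smul]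
  refine add_le_add_right ?_ _
  rw [norm_smul] at ha
  rw [div_mul_eq_mul_div, le_div_iff₀ h2]
  nlinarith [norm_nonneg (v - b • w)]

/-- Convergence of points of projective space for the chordal distance. -/
def PTendsto {ι : Type*} (p : ι → PN N) (l : Filter ι) (q : PN N) : Prop :=
  Tendsto (fun n => pdist (p n) q) l (𝓝 0)

theorem PTendsto.lt {ι : Type*} {p : ι → PN N} {l : Filter ι} {q : PN N} (h : PTendsto p l q)
    {ε : ℝ} (hε : 0 < ε) : ∀ᶠ n in l, pdist (p n) q < ε :=
  Tendsto.eventually_lt_const hε h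

theorem PTendsto.congr {ι : Type*} {p p' : ι → PN N} {l : Filter ι} {q : PN N}
    (h : PTendsto p l q) (h' : p =ᶠ[l] p') : PTendsto p' l q :=
  Tendsto.congr' (h'.mono fun n hn => by simp only [hn]) h

theorem eq_of_pdist_eq_zero {p q : PN N} (h : pdist p q = 0) : p = q := by
  induction p using Projectivization.ind with | h u hu => ?_
  induction q using Projectivization.ind with | h v hv => ?_
  obtain ⟨a, ha, ea⟩ := exists_pdist_mk_eq hu hv
  rw [h, eq_comm, div_eq_zero_iff, norm_eq_zero, norm_eq_zero, sub_eq_zero] at ea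
  have e : u = a • v := ea.resolve_right hu
  subst e
  exact mk_smul_eq hv hu

theorem PTendsto.unique {ι : Type*} {p : ι → PN N} {l : Filter ι} [l.NeBot] {q q' : PN N}
    (h : PTendsto p l q) (h' : PTendsto p l q') : q = q' := by
  apply eq_of_pdist_eq_zero
  refine le_antisymm (ge_of_tendsto (x := l) (f := fun n => pdist (p n) q + pdist (p n) q')
    (by simpa using Tendsto.add h h') (Eventually.of_forall fun n => ?_)) (pdist_nonneg _ _)
  rw [pdist_comm (p n) q]
  exact pdist_triangle _ _ _

theorem pTendsto_mk {ι : Type*} {p : ι → PN N} {l : Filter ι} {v : ι → Cn N} {w : Cn N}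
    (hw : w ≠ 0) (hp : ∀ᶠ n in l, ∃ h : v n ≠ 0, p n = Projectivization.mk ℂ (v n) h)
    (hv : Tendsto v l (𝓝 w)) : PTendsto p l (Projectivization.mk ℂ w hw) := by
  have h0 : Tendsto (fun n => ‖v n - (1 : ℂ) • w‖ / ‖v n‖) l (𝓝 0) := by
    have h1 : Tendsto (fun n => ‖v n - (1 : ℂ) • w‖) l (𝓝 0) := by
      simpa using (hv.sub_const w).norm
    have h2 := h1.div hv.norm (norm_ne_zero_iff.2 hw)
    rw [zero_div] at h2
    exact h2
  refine squeeze_zero' (Eventually.of_forall fun n => pdist_nonneg _ _) ?_ h0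
  filter_upwards [hp] with n ⟨h, e⟩
  rw [e]
  exact pdist_mk_le h hw 1

theorem exists_unit_rep (p : PN N) :
    ∃ (v : Cn N) (h : v ≠ 0), ‖v‖ = 1 ∧ p = Projectivization.mk ℂ v h := by
  have h0 := norm_ne_zero_iff.2 p.rep_nonzero
  have hc : ((‖p.rep‖⁻¹ : ℝ) : ℂ) ≠ 0 := by exact_mod_cast inv_ne_zero h0
  have h : ((‖p.rep‖⁻¹ : ℝ) : ℂ) • p.rep ≠ 0 := smul_ne_zero hc p.rep_nonzero
  refine ⟨_, h, ?_, ?_⟩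
  · rw [norm_smul, Complex.norm_real, norm_inv, norm_norm, inv_mul_cancel₀ h0]
  · rw [mk_smul_eq p.rep_nonzero h, p.mk_rep]

theorem exists_tendsto_of_eventually_mem {ι E : Type*} [TopologicalSpace E] {K : Set E}
    (hK : IsCompact K) (l : Ultrafilter ι) {v : ι → E} (hv : ∀ᶠ n in (l : Filter ι), v n ∈ K) :
    ∃ w ∈ K, Tendsto v l (𝓝 w) :=
  hK.ultrafilter_le_nhds (l.map v) (le_principal_iff.2 hv)

/-- Compactness of projective space, read off from the unit sphere of homogeneous coordinates. -/
theorem exists_pTendsto {ι : Type*} (l : Ultrafilter ι) (p : ι → PN N) :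
    ∃ q, PTendsto p l q := by
  choose v h hv e using fun n => exists_unit_rep (p n)
  obtain ⟨w, hw, hl⟩ := exists_tendsto_of_eventually_mem (isCompact_sphere (0 : Cn N) 1) l
    (v := v) (Eventually.of_forall fun n => mem_sphere_zero_iff_norm.2 (hv n))
  have hw0 : w ≠ 0 := by rintro rfl; simp at hw
  exact ⟨_, pTendsto_mk hw0 (Eventually.of_forall fun n => ⟨h n, e n⟩) hl⟩

/-! ### Homogeneous polynomials and closed sets -/

theorem eval_smul_of_isHomogeneous {P : Poly N} {d : ℕ} (hP : P.IsHomogeneous d) (c : ℂ)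
    (x : Fin (N + 1) → ℂ) :
    MvPolynomial.eval (fun i => c * x i) P = c ^ d * MvPolynomial.eval x P := by
  rw [MvPolynomial.eval_eq', MvPolynomial.eval_eq', Finset.mul_sum]
  refine Finset.sum_congr rfl fun e he => ?_
  have h := hP.degree_eq_sum_deg_support he
  simp_rw [mul_pow, Finset.prod_mul_distrib, Finset.prod_pow_eq_pow_sum]
  have h2 : ∑ i, e i = d := by
    rw [h]
    exact (Finset.sum_subset (Finset.subset_univ _) (by simp)).symm
  rw [h2]
  ring

theorem pval_mk {P : Poly N} {d : ℕ} (hP : P.IsHomogeneous d) {v : Cn N} (hv : v ≠ 0) {c : ℂ}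
    (hc : (Projectivization.mk ℂ v hv).rep = c • v) :
    pval P (Projectivization.mk ℂ v hv) = c ^ d * MvPolynomial.eval (fun i => v i) P := by
  rw [pval, hc]
  exact eval_smul_of_isHomogeneous hP c _

theorem pval_mk_eq_zero_iff {P : Poly N} {d : ℕ} (hP : P.IsHomogeneous d) {v : Cn N} (hv : v ≠ 0) :
    pval P (Projectivization.mk ℂ v hv) = 0 ↔ MvPolynomial.eval (fun i => v i) P = 0 := by
  obtain ⟨c, hc, e⟩ := rep_mk v hv
  rw [pval_mk hP hv e]
  simp [hc]

theorem continuous_eval_coord (P : Poly N) :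
    Continuous fun v : Cn N => MvPolynomial.eval (fun i => v i) P :=
  (MvPolynomial.continuous_eval P).comp (by fun_prop)

theorem IsZariskiClosed.mk_mem {X : Set (PN N)} (hX : IsZariskiClosed X) {ι : Type*}
    {l : Filter ι} {v : ι → Cn N} {w : Cn N} (hw : w ≠ 0) (hv : Tendsto v l (𝓝 w))
    (h : ∃ᶠ n in l, ∃ h : v n ≠ 0, Projectivization.mk ℂ (v n) h ∈ X) :
    Projectivization.mk ℂ w hw ∈ X := by
  obtain ⟨S, hS, rfl⟩ := hX
  intro P hP
  obtain ⟨d, hd⟩ := hS P hP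
  rw [pval_mk_eq_zero_iff hd]
  have hc : IsClosed {v : Cn N | MvPolynomial.eval (fun i => v i) P = 0} :=
    isClosed_eq (continuous_eval_coord P) continuous_const
  refine hc.mem_of_frequently_of_tendsto (h.mono ?_) hv
  rintro n ⟨h, hn⟩
  exact (pval_mk_eq_zero_iff hd h).1 (hn P hP)

theorem IsZariskiClosed.mem_of_pTendsto {X : Set (PN N)} (hX : IsZariskiClosed X) {ι : Type*}
    {l : Filter ι} {p : ι → PN N} {q : PN N} (hp : PTendsto p l q)
    (h : ∃ᶠ n in l, p n ∈ X) : q ∈ X := by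
  have : NeBot (l ⊓ 𝓟 {n | p n ∈ X}) := frequently_mem_iff_neBot.1 h
  -- An ultrafilter concentrated on the indices with `p n ∈ X` makes the unit representatives
  -- converge, so the vanishing of polynomials passes to the limit vector.
  set u := Ultrafilter.of (l ⊓ 𝓟 {n | p n ∈ X})
  have hu := Ultrafilter.of_le (l ⊓ 𝓟 {n | p n ∈ X})
  choose v h hv e using fun n => exists_unit_rep (p n)
  obtain ⟨w, hw, hl⟩ := exists_tendsto_of_eventually_mem (isCompact_sphere (0 : Cn N) 1) u
    (v := v) (Eventually.of_forall fun n => mem_sphere_zero_iff_norm.2 (hv n))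
  have hw0 : w ≠ 0 := by rintro rfl; simp at hw
  have h1 : PTendsto p u (Projectivization.mk ℂ w hw0) :=
    pTendsto_mk hw0 (Eventually.of_forall fun n => ⟨h n, e n⟩) hl
  have h2 : PTendsto p u q := hp.mono_left (hu.trans inf_le_left)
  rw [← h1.unique h2]
  refine hX.mk_mem hw0 (l := (u : Filter ι)) hl (Eventually.frequently ?_)
  have : {n | p n ∈ X} ∈ (u : Filter ι) := hu (mem_inf_of_right (mem_principal_self _))
  filter_upwards [this] with n hn
  exact ⟨h n, e n ▸ hn⟩

/-! ### The cone over a projective variety -/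

/-- The cone over `X`, without its vertex. -/
def cone (X : Set (PN N)) : Set (Cn N) := {v | ∃ h : v ≠ 0, Projectivization.mk ℂ v h ∈ X}

/-- The unit vectors of the cone stand in for the compact space X: functions constant on lines are
bounded through them. -/
theorem isCompact_cone_sphere {X : Set (PN N)} (hX : IsZariskiClosed X) :
    IsCompact (cone X ∩ sphere 0 1) := by
  refine (isCompact_sphere (0 : Cn N) 1).of_isClosed_subset ?_ inter_subset_right
  refine isClosed_of_closure_subset fun w hw => ?_
  have hw1 : w ∈ sphere (0 : Cn N) 1 :=
    closure_minimal inter_subset_right isClosed_sphere hw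
  have hw0 : w ≠ 0 := by rintro rfl; simp at hw1
  have := mem_closure_iff_frequently.1 hw
  exact ⟨⟨hw0, hX.mk_mem hw0 tendsto_id (this.mono fun v hv => hv.1)⟩, hw1⟩

theorem smul_mem_cone {X : Set (PN N)} {v : Cn N} (hv : v ∈ cone X) {c : ℂ} (hc : c ≠ 0) :
    c • v ∈ cone X :=
  ⟨smul_ne_zero hc hv.1, by rw [mk_smul_eq hv.1]; exact hv.2⟩

theorem normalize_mem {X : Set (PN N)} {v : Cn N} (hv : v ∈ cone X) :
    ((‖v‖⁻¹ : ℝ) : ℂ) • v ∈ cone X ∩ sphere 0 1 := by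
  have h0 := norm_ne_zero_iff.2 hv.1
  refine ⟨smul_mem_cone hv (by exact_mod_cast inv_ne_zero h0), ?_⟩
  rw [mem_sphere_zero_iff_norm, norm_smul, Complex.norm_real, norm_inv, norm_norm,
    inv_mul_cancel₀ h0]

theorem SmoothOnCone.continuousOn {A : Type*} [NormedAddCommGroup A] [NormedSpace ℝ A]
    {X : Set (PN N)} {u : Cn N → A} (hu : SmoothOnCone X u) : ContinuousOn u (cone X) := by
  rintro v ⟨hv, hX⟩
  obtain ⟨U, w, hU, hvU, hw, e⟩ := hu v hv hX
  have h1 : ContinuousWithinAt w (cone X) v := (hw.continuousOn.continuousAt (hU.mem_nhds hvU)).continuousWithinAt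
  refine h1.congr_of_eventuallyEq ?_ (e v hvU hv hX)
  filter_upwards [nhdsWithin_le_nhds (hU.mem_nhds hvU), self_mem_nhdsWithin] with v' h1 h2
  exact e v' h1 h2.1 h2.2

/-- A continuous function on the cone that is constant on lines is bounded. -/
theorem exists_bound_of_homog {X : Set (PN N)} (hX : IsZariskiClosed X)
    {A : Type*} [NormedAddCommGroup A] {u : Cn N → A} (hu : ContinuousOn u (cone X))
    (hh : ∀ v ∈ cone X, ∀ c : ℂ, c ≠ 0 → u (c • v) = u v) :
    ∃ C, ∀ v ∈ cone X, ‖u v‖ ≤ C := by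
  obtain ⟨C, hC⟩ := (isCompact_cone_sphere hX).exists_bound_of_continuousOn
    (hu.mono inter_subset_left)
  refine ⟨C, fun v hv => ?_⟩
  rw [← hh v hv ((‖v‖⁻¹ : ℝ) : ℂ) (by exact_mod_cast inv_ne_zero (norm_ne_zero_iff.2 hv.1))]
  exact hC _ (normalize_mem hv)

/-! ### Lifts to homogeneous coordinates -/

theorem IsLift.eventually {f : ℂ → PN N} {z : ℂ} {F : ℂ → Cn N} (h : IsLift f z F) :
    ∀ᶠ w in 𝓝 z, IsLift f w F := by
  filter_upwards [h.1.eventually_analyticAt, h.2.eventually_nhds] with w h1 h2 using ⟨h1, h2⟩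

theorem IsLift.ne_zero {f : ℂ → PN N} {z : ℂ} {F : ℂ → Cn N} (h : IsLift f z F) : F z ≠ 0 :=
  h.2.self_of_nhds.1

theorem IsLift.eq_mk {f : ℂ → PN N} {z : ℂ} {F : ℂ → Cn N} (h : IsLift f z F) :
    f z = Projectivization.mk ℂ (F z) h.ne_zero := h.2.self_of_nhds.2

theorem analyticAt_coord {F : ℂ → Cn N} {z : ℂ} (h : AnalyticAt ℂ F z) (j : Fin (N + 1)) :
    AnalyticAt ℂ (fun w => F w j) z :=
  ((EuclideanSpace.proj j : Cn N →L[ℂ] ℂ).analyticAt _).comp h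

theorem exists_coord_ne_zero {v : Cn N} (hv : v ≠ 0) : ∃ j, v j ≠ 0 := by
  by_contra! h
  exact hv (by ext j; simpa using h j)

/-- The unit is the quotient of the two lifts in a coordinate that does not vanish at `z`, hence it
is analytic. -/
theorem IsLift.exists_unit {f : ℂ → PN N} {z : ℂ} {F G : ℂ → Cn N} (hF : IsLift f z F)
    (hG : IsLift f z G) :
    ∃ c : ℂ → ℂ, AnalyticAt ℂ c z ∧ c z ≠ 0 ∧ G =ᶠ[𝓝 z] fun w => c w • F w := by
  obtain ⟨j, hj⟩ := exists_coord_ne_zero hF.ne_zero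
  have key : ∀ᶠ w in 𝓝 z, G w = (G w j / F w j) • F w := by
    filter_upwards [hF.2, hG.2, (analyticAt_coord hF.1 j).continuousAt.eventually_ne hj] with
      w ⟨h1, e1⟩ ⟨h2, e2⟩ h3
    obtain ⟨a, ha⟩ := (Projectivization.mk_eq_mk_iff' ℂ _ _ _ _).1 (e2.symm.trans e1)
    have h4 : G w j = a * F w j := by rw [← ha]; rfl
    rw [h4, mul_div_cancel_right₀ _ h3, ha]
  refine ⟨fun w => G w j / F w j, (analyticAt_coord hG.1 j).div (analyticAt_coord hF.1 j) hj, ?_, key⟩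
  intro h0
  have := key.self_of_nhds
  simp only at h0
  rw [h0, zero_smul] at this
  exact hG.ne_zero this

theorem IsLift.smul {f : ℂ → PN N} {z : ℂ} {F : ℂ → Cn N} (hF : IsLift f z F) {c : ℂ → ℂ}
    (hc : AnalyticAt ℂ c z) (hz : c z ≠ 0) : IsLift f z (fun w => c w • F w) := by
  refine ⟨hc.smul hF.1, ?_⟩
  filter_upwards [hF.2, hc.continuousAt.eventually_ne hz] with w ⟨h1, e1⟩ h2
  exact ⟨smul_ne_zero h2 h1, by rw [mk_smul_eq h1, e1]⟩

theorem IsLift.congr {f : ℂ → PN N} {z : ℂ} {F G : ℂ → Cn N} (hF : IsLift f z F)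
    (h : F =ᶠ[𝓝 z] G) : IsLift f z G := by
  refine ⟨hF.1.congr h, ?_⟩
  filter_upwards [hF.2, h] with w h1 h2
  rwa [← h2]

theorem IsLift.comp {f : ℂ → PN N} {z : ℂ} {F : ℂ → Cn N} {α : ℂ → ℂ}
    (hF : IsLift f (α z) F) (hα : AnalyticAt ℂ α z) :
    IsLift (fun w => f (α w)) z (fun w => F (α w)) :=
  ⟨hF.1.fun_comp hα, hα.continuousAt.eventually hF.2⟩

/-! ### Invariance of densities -/

/-- A horizontal form does not see the radial direction `v`. This gives independence of the lift
and, later, lets the derivative of a lift be replaced by its part orthogonal to the lift. -/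
theorem sum_horizontal {h : Coeff N} {v : Cn N} (h1 : ∀ k, ∑ j, h j k * v j = 0)
    (h2 : ∀ j, ∑ k, h j k * starRingEnd ℂ (v k) = 0) (a : Cn N) (t : ℂ) :
    ∑ j, ∑ k, h j k * ((a + t • v) j * starRingEnd ℂ ((a + t • v) k)) =
      ∑ j, ∑ k, h j k * (a j * starRingEnd ℂ (a k)) := by
  have e : ∀ j k, h j k * ((a + t • v) j * starRingEnd ℂ ((a + t • v) k)) =
      h j k * (a j * starRingEnd ℂ (a k)) + (a j * starRingEnd ℂ t) * (h j k * starRingEnd ℂ (v k))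
      + (t * starRingEnd ℂ (a k + t * v k)) * (h j k * v j) := by
    intro j k
    simp only [PiLp.add_apply, PiLp.smul_apply, smul_eq_mul, map_add, map_mul]
    ring
  simp_rw [e, Finset.sum_add_distrib]
  have e2 : ∑ j, ∑ k, (a j * starRingEnd ℂ t) * (h j k * starRingEnd ℂ (v k)) = 0 := by
    simp_rw [← Finset.mul_sum, h2]; simp
  have e3 : ∑ j, ∑ k, (t * starRingEnd ℂ (a k + t * v k)) * (h j k * v j) = 0 := by
    rw [Finset.sum_comm]
    simp_rw [← Finset.mul_sum, h1]; simp
  rw [e2, e3]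
  simp

theorem dens_congr (η : Form11 N) {F G : ℂ → Cn N} {z : ℂ} (h : F =ᶠ[𝓝 z] G) :
    dens η F z = dens η G z := by
  rw [dens, dens, h.deriv_eq, h.self_of_nhds]

theorem dens_smul (η : Form11 N) {F : ℂ → Cn N} {z : ℂ} (hF : AnalyticAt ℂ F z) (hz : F z ≠ 0)
    {c : ℂ → ℂ} (hc : AnalyticAt ℂ c z) (hcz : c z ≠ 0) :
    dens η (fun w => c w • F w) z = dens η F z := by
  have hd : deriv (fun w => c w • F w) z = c z • deriv F z + deriv c z • F z :=
    deriv_fun_smul hc.differentiableAt hF.differentiableAt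
  obtain ⟨-, h2, h3⟩ := η.2
  have hv := h2 (c z • F z) (smul_ne_zero hcz hz)
  have e : deriv (fun w => c w • F w) z = c z • deriv F z + (deriv c z / c z) • (c z • F z) := by
    rw [hd, smul_smul, div_mul_cancel₀ _ hcz]
  simp only [dens, e]
  rw [sum_horizontal hv.1 hv.2]
  refine Finset.sum_congr rfl fun j _ => Finset.sum_congr rfl fun k _ => ?_
  rw [← h3 (c z) hcz (F z) hz j k]
  simp only [PiLp.smul_apply, smul_eq_mul, map_mul]
  ring

theorem pullDens_eq (η : Form11 N) {f : ℂ → PN N} {F : ℂ → Cn N} {z : ℂ} (h : IsLift f z F) :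
    pullDens f η z = dens η F z := by
  have hh : HolAt f z := ⟨F, h⟩
  rw [pullDens, dif_pos hh]
  obtain ⟨c, hc, hcz, e⟩ := h.exists_unit hh.choose_spec
  rw [dens_congr η e, dens_smul η h.1 h.ne_zero hc hcz]

theorem IsLift.isGermIn {X : Set (PN N)} {f : ℂ → PN N} {F : ℂ → Cn N} {z : ℂ}
    (h : IsLift f z F) (hX : ∀ᶠ w in 𝓝 z, f w ∈ X) : IsGermIn X F z := by
  refine ⟨h.1, ?_⟩
  filter_upwards [h.2, hX] with w ⟨h1, e⟩ h2
  exact ⟨h1, e ▸ h2⟩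

theorem continuousAt_dens (η : Form11 N) {F : ℂ → Cn N} {z : ℂ} (hF : AnalyticAt ℂ F z)
    (hz : F z ≠ 0) : ContinuousAt (dens η F) z := by
  have h1 : ContinuousAt η.1 (F z) :=
    η.2.1.continuousOn.continuousAt (isOpen_compl_singleton.mem_nhds hz)
  have h2 : ContinuousAt (fun w => η.1 (F w)) z :=
    ContinuousAt.comp (f := F) (g := η.1) h1 hF.continuousAt
  have h3 := hF.deriv
  refine tendsto_finsetSum _ fun j _ => tendsto_finsetSum _ fun k _ => ?_
  refine Tendsto.mul ?_ (Tendsto.mul ?_ ?_)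
  · exact (continuousAt_pi.1 (continuousAt_pi.1 h2 j) k)
  · exact (analyticAt_coord h3 j).continuousAt
  · exact (Complex.continuous_conj.continuousAt.comp (analyticAt_coord h3 k).continuousAt)

theorem continuousAt_pullDens (η : Form11 N) {f : ℂ → PN N} {z : ℂ} (h : HolAt f z) :
    ContinuousAt (pullDens f η) z := by
  obtain ⟨F, hF⟩ := h
  refine (continuousAt_dens η hF.1 hF.ne_zero).congr ?_
  filter_upwards [hF.eventually] with w hw using (pullDens_eq η hw).symm

/-! ### Zeros of functions that are analytic up to units -/

/-- Let `a z` be analytic near `z`, with zero set `V` near `z`, for every `z` in the unit disc.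
Then over a smaller disc the `a z` are unit multiples of a polynomial. -/
theorem exists_common_divisor {a : ℂ → ℂ → ℂ} {V : Set ℂ}
    (ha : ∀ z ∈ ball (0 : ℂ) 1, AnalyticAt ℂ (a z) z)
    (hV : ∀ z ∈ ball (0 : ℂ) 1, ∀ᶠ w in 𝓝 z, (a z w = 0 ↔ w ∈ V)) (h0 : (0 : ℂ) ∉ V)
    {s : ℝ} (hs : s < 1) :
    ∃ (Z : Finset ℂ) (n : ℂ → ℕ), (0 : ℂ) ∉ Z ∧ ∀ z ∈ closedBall (0 : ℂ) s,
      (∀ᶠ w in 𝓝[≠] z, w ∉ V) ∧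
      ∃ h : ℂ → ℂ, AnalyticAt ℂ h z ∧ h z ≠ 0 ∧
        a z =ᶠ[𝓝 z] fun w => (∏ c ∈ Z, (w - c) ^ n c) * h w := by
  have hsub : closedBall (0 : ℂ) s ⊆ ball 0 1 := closedBall_subset_ball hs
  -- no `a z` vanishes identically
  have hiso : ∀ z ∈ ball (0 : ℂ) 1, ∀ᶠ w in 𝓝[≠] z, w ∉ V := by
    -- By isolated zeros, each point either has a neighbourhood inside `V` or a punctured
    -- neighbourhood outside `V`. Both conditions are open in the disc and exclude each other;
    -- connectedness and `0 ∉ V` rule out the first.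
    set S : Set ℂ := {z | ∀ᶠ w in 𝓝 z, w ∈ V}
    set S' : Set ℂ := {z | ∀ᶠ w in 𝓝[≠] z, w ∉ V}
    have hSo : IsOpen S := isOpen_iff_mem_nhds.2 fun z hz => Filter.Eventually.eventually_nhds hz
    have hdich : ∀ z ∈ ball (0 : ℂ) 1, z ∈ S ∨ z ∈ S' := by
      intro z hz
      rcases (ha z hz).eventually_eq_zero_or_eventually_ne_zero with h | h
      · left
        filter_upwards [h, hV z hz] with w h1 h2 using h2.1 h1
      · right
        filter_upwards [h, nhdsWithin_le_nhds (hV z hz)] with w h1 h2 using fun h3 => h1 (h2.2 h3)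
    have hSo' : IsOpen (interior S') := isOpen_interior
    have hdich' : ∀ z ∈ ball (0 : ℂ) 1, z ∈ S ∨ z ∈ interior S' := by
      intro z hz
      rcases hdich z hz with h | h
      · exact Or.inl h
      right
      rw [mem_interior_iff_mem_nhds]
      have h1 : ∀ᶠ w in 𝓝 z, w ≠ z → w ∉ V := eventually_nhdsWithin_iff.1 h
      filter_upwards [h1.eventually_nhds, isOpen_ball.mem_nhds hz] with w hw hwb
      by_cases e : w = z
      · subst e; exact h
      · have : ∀ᶠ w' in 𝓝 w, w' ∉ V := by
          filter_upwards [hw, isOpen_ne.mem_nhds e] with w' h2 h3 using h2 h3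
        exact nhdsWithin_le_nhds this
    have hdisj : ∀ z, z ∈ S → z ∈ interior S' → False := by
      intro z h1 h2
      have hz : z ∈ S' := interior_subset h2
      have h3 : ∀ᶠ w in 𝓝[≠] z, w ∉ V := hz
      have h4 : ∀ᶠ w in 𝓝[≠] z, w ∈ V := nhdsWithin_le_nhds h1
      obtain ⟨w, h5, h6⟩ := (h3.and h4).exists
      exact h5 h6
    have h00 : (0 : ℂ) ∈ ball (0 : ℂ) 1 := mem_ball_self one_pos
    intro z hz
    rcases hdich z hz with h | h
    swap
    · exact h
    exfalso
    have hpre := (convex_ball (0 : ℂ) 1).isPreconnected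
    have h0S : (0 : ℂ) ∈ interior S' := by
      refine (hdich' 0 h00).resolve_left fun h => h0 ?_
      exact Filter.Eventually.self_of_nhds h
    obtain ⟨w, -, hw1, hw2⟩ := hpre S (interior S') hSo hSo' hdich' ⟨z, hz, h⟩ ⟨0, h00, h0S⟩
    exact hdisj w hw1 hw2
  have hfin : (V ∩ closedBall (0 : ℂ) s).Finite := by
    by_contra hinf
    obtain ⟨z, hz, hacc⟩ := Set.Infinite.exists_accPt_of_subset_isCompact
      (hs := hinf) (isCompact_closedBall (0 : ℂ) s) inter_subset_right
    have h1 := accPt_iff_frequently_nhdsNE.1 hacc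
    obtain ⟨w, h2, h3⟩ := (h1.and_eventually (hiso z (hsub hz))).exists
    exact h3 h2.1
  -- The exponents are the vanishing orders of the local functions at the finitely many points of
  -- `V` in the closed disc.
  refine ⟨hfin.toFinset, fun z => analyticOrderNatAt (a z) z, by simp [h0], fun z hz => ?_⟩
  refine ⟨hiso z (hsub hz), ?_⟩
  have han := ha z (hsub hz)
  have hne : ∀ᶠ w in 𝓝[≠] z, a z w ≠ 0 := by
    filter_upwards [hiso z (hsub hz), nhdsWithin_le_nhds (hV z (hsub hz))] with w h1 h2 h3
    exact h1 (h2.1 h3)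
  have hord : analyticOrderAt (a z) z ≠ ⊤ := by
    intro h
    rw [analyticOrderAt_eq_top] at h
    obtain ⟨w, h1, h2⟩ := (hne.and (nhdsWithin_le_nhds h)).exists
    exact h1 h2
  obtain ⟨g, hg, hgz, e⟩ := (han.analyticOrderAt_ne_top).1 hord
  set n : ℂ → ℕ := fun z => analyticOrderNatAt (a z) z
  by_cases hzV : z ∈ V
  · have hzZ : z ∈ hfin.toFinset := by simp [hzV]; simpa using hz
    have hpa : AnalyticAt ℂ (fun w => ∏ c ∈ hfin.toFinset.erase z, (w - c) ^ n c) z := by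
      refine Finset.analyticAt_fun_prod _ fun c _ => ?_
      fun_prop
    have hpz : ∏ c ∈ hfin.toFinset.erase z, (z - c) ^ n c ≠ 0 :=
      Finset.prod_ne_zero_iff.2 fun c hc =>
        pow_ne_zero _ (sub_ne_zero.2 (Finset.ne_of_mem_erase hc).symm)
    refine ⟨fun w => g w / ∏ c ∈ hfin.toFinset.erase z, (w - c) ^ n c, hg.div hpa hpz,
      div_ne_zero hgz hpz, ?_⟩
    filter_upwards [e, hpa.continuousAt.eventually_ne hpz] with w h1 h2
    rw [h1, ← Finset.mul_prod_erase _ _ hzZ, smul_eq_mul]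
    field_simp
    simp only [n]
    ring
  · have hza : a z z ≠ 0 := fun h => hzV ((hV z (hsub hz)).self_of_nhds.1 h)
    have hpa : AnalyticAt ℂ (fun w => ∏ c ∈ hfin.toFinset, (w - c) ^ n c) z := by
      refine Finset.analyticAt_fun_prod _ fun c _ => ?_
      fun_prop
    have hpz : ∏ c ∈ hfin.toFinset, (z - c) ^ n c ≠ 0 :=
      Finset.prod_ne_zero_iff.2 fun c hc =>
        pow_ne_zero _ (sub_ne_zero.2 (by rintro rfl; simp at hc; exact hzV hc.1))
    refine ⟨fun w => a z w / ∏ c ∈ hfin.toFinset, (w - c) ^ n c, han.div hpa hpz,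
      div_ne_zero hza hpz, ?_⟩
    filter_upwards [hpa.continuousAt.eventually_ne hpz] with w h2
    field_simp

/-- A holomorphic map from the unit disc to projective space has a holomorphic lift over every
smaller disc. -/
theorem exists_lift {f : ℂ → PN N} (hf : ∀ z ∈ ball (0 : ℂ) 1, HolAt f z) {s : ℝ} (hs : s < 1) :
    ∃ F : ℂ → Cn N, ∀ z ∈ closedBall (0 : ℂ) s, IsLift f z F := by
  classical
  obtain ⟨j, hj⟩ := exists_coord_ne_zero (f 0).rep_nonzero
  have hrep : ∀ {w : ℂ} {v : Cn N} (h : v ≠ 0), f w = Projectivization.mk ℂ v h →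
      ∃ c : ℂ, c ≠ 0 ∧ (f w).rep = c • v := by
    intro w v h e
    rw [e]; exact rep_mk v h
  choose! F hF using hf
  set V : Set ℂ := {w | (f w).rep j = 0}
  obtain ⟨Z, n, -, hZ⟩ := exists_common_divisor (a := fun z w => F z w j) (V := V)
    (fun z hz => analyticAt_coord (hF z hz).1 j) (fun z hz => by
      filter_upwards [(hF z hz).2] with w ⟨h1, e1⟩
      obtain ⟨c, hc, e⟩ := hrep h1 e1
      simp [V, e, hc]) hj hs
  -- Dividing by the `j`-th coordinate makes the representative independent of choices but creates
  -- poles; the polynomial `p`, with the same zeros as that coordinate, cancels them. `F0` is wrong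
  -- only at those zeros, where a limit over punctured neighbourhoods repairs it.
  set p : ℂ → ℂ := fun w => ∏ c ∈ Z, (w - c) ^ n c
  set F0 : ℂ → Cn N := fun w => (p w / (f w).rep j) • (f w).rep
  refine ⟨fun z => limUnder (𝓝[≠] z) F0, fun z hz => ?_⟩
  have hz1 : z ∈ ball (0 : ℂ) 1 := closedBall_subset_ball hs hz
  obtain ⟨hV, h, hh, hhz, e⟩ := hZ z hz
  set G : ℂ → Cn N := fun w => (h w)⁻¹ • F z w
  have hG : IsLift f z G := (hF z hz1).smul (hh.inv hhz) (inv_ne_zero hhz)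
  have hFG : ∀ᶠ w in 𝓝[≠] z, F0 w = G w := by
    filter_upwards [hV, nhdsWithin_le_nhds e, nhdsWithin_le_nhds (hF z hz1).2,
      nhdsWithin_le_nhds (hh.continuousAt.eventually_ne hhz)] with w h1 h2 ⟨h3, e3⟩ h4
    obtain ⟨c, hc, e⟩ := hrep h3 e3
    have h5 : F z w j ≠ 0 := fun h5 => h1 (by simp [V, e, h5])
    have h6 : p w = F z w j / h w := by rw [eq_div_iff h4]; exact h2.symm
    simp only [F0, G, h6, e, smul_smul]
    congr 1
    simp only [PiLp.smul_apply, smul_eq_mul]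
    field_simp
  have hlim : ∀ᶠ w in 𝓝 z, limUnder (𝓝[≠] w) F0 = G w := by
    have h1 : ∀ᶠ w in 𝓝 z, w ≠ z → F0 w = G w := eventually_nhdsWithin_iff.1 hFG
    filter_upwards [h1.eventually_nhds, hG.1.eventually_analyticAt] with w hw hGw
    have h2 : F0 =ᶠ[𝓝[≠] w] G := by
      by_cases e : w = z
      · subst e; exact hFG
      · refine nhdsWithin_le_nhds ?_
        filter_upwards [hw, isOpen_ne.mem_nhds e] with w' h2 h3 using h2 h3
    exact Tendsto.limUnder_eq ((hGw.continuousAt.tendsto.mono_left nhdsWithin_le_nhds).congr' h2.symm)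
  exact hG.congr (hlim.mono fun w hw => hw.symm)

/-! ### The Jensen formula for functions of class `C²` on discs -/

/-- Multiplication by a bump function that equals 1 on the smaller disc. It reduces the integral
formulas to functions on the whole plane. -/
theorem exists_contDiff_extension {E : Type*} [NormedAddCommGroup E] [NormedSpace ℝ E]
    {n : ℕ∞} {V : ℂ → E} {r R : ℝ} (hV : ContDiffOn ℝ n V (ball 0 R)) (h0 : 0 < r) (hr : r < R) :
    ∃ V' : ℂ → E, ContDiff ℝ n V' ∧ EqOn V' V (closedBall 0 r) := by
  let χ : ContDiffBump (0 : ℂ) := ⟨r, (r + R) / 2, h0, by linarith⟩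
  refine ⟨fun z => χ z • V z, ?_, fun z hz => ?_⟩
  · refine contDiff_iff_contDiffAt.2 fun z => ?_
    by_cases hz : z ∈ ball (0 : ℂ) R
    · exact χ.contDiffAt.smul (hV.contDiffAt (isOpen_ball.mem_nhds hz))
    · have h1 : z ∉ tsupport χ := by
        rw [χ.tsupport_eq]
        simp only [mem_closedBall, mem_ball, not_lt, not_le, dist_zero_right] at hz ⊢
        change (r + R) / 2 < _
        linarith
      have h2 : (fun z => χ z • V z) =ᶠ[𝓝 z] fun _ => 0 := by
        filter_upwards [notMem_tsupport_iff_eventuallyEq.1 h1] with w hw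
        simp [hw]
      exact contDiffAt_const.congr_of_eventuallyEq h2
  · simp [χ.one_of_mem_closedBall hz]

theorem continuous_circle_integral {g : ℂ → ℂ} (hg : Continuous g) :
    Continuous fun ρ : ℝ => ∫ θ in (0 : ℝ)..2 * Real.pi, g (circleMap 0 ρ θ) := by
  apply intervalIntegral.continuous_parametric_intervalIntegral_of_continuous'
  simp only [circleMap, Function.uncurry_def]
  fun_prop

theorem setIntegral_ball {w : ℂ → ℂ} (hw : Continuous w) {t : ℝ} (ht : 0 ≤ t) :
    ∫ z in ball (0 : ℂ) t, w z =
      ∫ ρ in (0 : ℝ)..t, (ρ : ℂ) * ∫ θ in (0 : ℝ)..2 * Real.pi, w (circleMap 0 ρ θ) := by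
  have hpi := Real.pi_pos
  rw [← integral_indicator measurableSet_ball, ← Complex.integral_comp_polarCoord_symm]
  have hsymm : ∀ p : ℝ × ℝ, Complex.polarCoord.symm p = circleMap 0 p.1 p.2 := by
    intro p
    rw [Complex.polarCoord_symm_apply, circleMap, Complex.exp_mul_I]; simp
  have h1 : ∀ p ∈ polarCoord.target, p.1 • (ball (0 : ℂ) t).indicator w (Complex.polarCoord.symm p)
      = (Ioo 0 t ×ˢ Ioo (-Real.pi) Real.pi).indicator
        (fun p : ℝ × ℝ => (p.1 : ℂ) * w (circleMap 0 p.1 p.2)) p := by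
    rintro ⟨ρ, θ⟩ hp
    rw [polarCoord_target] at hp
    obtain ⟨h1, h2⟩ := hp
    simp only [mem_Ioi] at h1
    rw [hsymm]
    by_cases h : ρ < t
    · rw [indicator_of_mem, indicator_of_mem]
      · simp
      · exact ⟨⟨h1, h⟩, h2⟩
      · simpa [abs_of_pos h1] using h
    · rw [indicator_of_notMem, indicator_of_notMem]
      · simp
      · exact fun h3 => h h3.1.2
      · simpa [abs_of_pos h1] using h
  rw [setIntegral_congr_fun polarCoord.open_target.measurableSet h1,
    setIntegral_indicator (measurableSet_Ioo.prod measurableSet_Ioo)]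
  have h2 : polarCoord.target ∩ Ioo 0 t ×ˢ Ioo (-Real.pi) Real.pi
      = Ioo 0 t ×ˢ Ioo (-Real.pi) Real.pi := by
    rw [polarCoord_target]
    refine inter_eq_right.2 (prod_mono (fun x hx => hx.1) subset_rfl)
  have hcont : Continuous fun p : ℝ × ℝ => (p.1 : ℂ) * w (circleMap 0 p.1 p.2) := by
    simp only [circleMap]; fun_prop
  rw [h2, Measure.volume_eq_prod, setIntegral_prod]
  · rw [intervalIntegral.integral_of_le ht, integral_Ioc_eq_integral_Ioo]
    refine setIntegral_congr_fun measurableSet_Ioo fun ρ _ => ?_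
    simp only
    rw [integral_const_mul, ← integral_Ioc_eq_integral_Ioo,
      ← intervalIntegral.integral_of_le (by linarith)]
    congr 1
    have := (periodic_circleMap 0 ρ).comp w
    have h3 := this.intervalIntegral_add_eq 0 (-Real.pi)
    simp only [zero_add, Function.comp_def] at h3
    rw [h3]
    congr 1
    ring
  · refine (hcont.continuousOn.integrableOn_compact (isCompact_Icc (a := ((0 : ℝ), -Real.pi))
      (b := (t, Real.pi)))).mono_set ?_
    rintro ⟨a, b⟩ ⟨h1, h2⟩
    exact ⟨⟨h1.1.le, h2.1.le⟩, ⟨h1.2.le, h2.2.le⟩⟩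

/-- The operation `w ↦ ∫₀^r dt/t ∫_{𝔻(t)} w`. -/
noncomputable def radialInt (w : ℂ → ℂ) (r : ℝ) : ℂ :=
  ∫ t in (0 : ℝ)..r, ((1 / t : ℝ) : ℂ) * ∫ z in ball (0 : ℂ) t, w z

theorem radialInt_congr {w w' : ℂ → ℂ} {r : ℝ} (hr : 0 ≤ r) (h : EqOn w w' (closedBall 0 r)) :
    radialInt w r = radialInt w' r := by
  refine intervalIntegral.integral_congr fun t ht => ?_
  rw [uIcc_of_le hr] at ht
  congr 1
  exact setIntegral_congr_fun measurableSet_ball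
    (h.mono (ball_subset_closedBall.trans (closedBall_subset_closedBall ht.2)))

theorem intervalIntegrable_radial {w : ℂ → ℂ} (hw : Continuous w) {r : ℝ} (hr : 0 ≤ r) :
    IntervalIntegrable (fun t : ℝ => ((1 / t : ℝ) : ℂ) * ∫ z in ball (0 : ℂ) t, w z) volume 0 r := by
  set g : ℝ → ℂ := fun ρ => ∫ θ in (0 : ℝ)..2 * Real.pi, w (circleMap 0 ρ θ)
  have hg : Continuous g := continuous_circle_integral hw
  obtain ⟨C, hC⟩ := (isCompact_Icc : IsCompact (Icc (0 : ℝ) r)).exists_bound_of_continuousOn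
    hg.continuousOn
  have hA : Continuous fun t : ℝ => ∫ ρ in (0 : ℝ)..t, (ρ : ℂ) * g ρ :=
    intervalIntegral.continuous_primitive
      (fun a b => (by fun_prop : Continuous fun ρ : ℝ => (ρ : ℂ) * g ρ).intervalIntegrable a b) 0
  rw [intervalIntegrable_iff_integrableOn_Ioc_of_le hr]
  have hcongr : EqOn (fun t : ℝ => ((1 / t : ℝ) : ℂ) * ∫ ρ in (0 : ℝ)..t, (ρ : ℂ) * g ρ)
      (fun t : ℝ => ((1 / t : ℝ) : ℂ) * ∫ z in ball (0 : ℂ) t, w z) (Ioc 0 r) := fun t ht => by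
    simp only [setIntegral_ball hw ht.1.le, g]
  refine IntegrableOn.congr_fun ?_ hcongr measurableSet_Ioc
  refine Integrable.of_bound ?_ (r * C) ?_
  · have hinv : ContinuousOn (fun t : ℝ => ((1 / t : ℝ) : ℂ)) (Ioc 0 r) :=
      Complex.continuous_ofReal.comp_continuousOn
        (continuousOn_const.div continuousOn_id fun t ht => ht.1.ne')
    exact (hinv.mul hA.continuousOn).aestronglyMeasurable measurableSet_Ioc
  · refine (ae_restrict_iff' measurableSet_Ioc).2 (Eventually.of_forall fun t ht => ?_)
    have h0 : 0 < t := ht.1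
    -- The area integral is O(t²), which absorbs the singular factor 1/t.
    have h1 : ‖∫ ρ in (0 : ℝ)..t, (ρ : ℂ) * g ρ‖ ≤ (t * C) * |t - 0| := by
      refine intervalIntegral.norm_integral_le_of_norm_le_const fun ρ hρ => ?_
      rw [uIoc_of_le h0.le] at hρ
      rw [norm_mul, Complex.norm_real, Real.norm_of_nonneg hρ.1.le]
      have := hC ρ ⟨hρ.1.le, hρ.2.trans ht.2⟩
      exact mul_le_mul hρ.2 this (norm_nonneg _) h0.le
    have hC0 : 0 ≤ C := (norm_nonneg _).trans (hC 0 ⟨le_rfl, hr⟩)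
    rw [norm_mul, Complex.norm_real, Real.norm_of_nonneg (by positivity), sub_zero, abs_of_pos h0] at *
    calc 1 / t * ‖∫ ρ in (0 : ℝ)..t, (ρ : ℂ) * g ρ‖ ≤ 1 / t * (t * C * t) := by gcongr
      _ = t * C := by field_simp
      _ ≤ r * C := by gcongr; exact ht.2

/-- The trace of the Hessian may be computed in any orthonormal basis; with `e = e^{iθ}` the two
terms are the radial and the tangential second derivative. -/
theorem laplacian_eq_of_rotation (V : ℂ → ℂ) (z e : ℂ) (he : ‖e‖ = 1) :
    Laplacian.laplacian V z = fderiv ℝ (fderiv ℝ V) z e e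
      + fderiv ℝ (fderiv ℝ V) z (e * Complex.I) (e * Complex.I) := by
  rw [InnerProductSpace.laplacian_eq_iteratedFDeriv_complexPlane]
  simp only [iteratedFDeriv_two_apply]
  have h1 : e = e.re • (1 : ℂ) + e.im • Complex.I := by simp [Complex.re_add_im]
  have h2 : e * Complex.I = (-e.im) • (1 : ℂ) + e.re • Complex.I := by
    apply Complex.ext <;> simp
  have h3 : e.re * e.re + e.im * e.im = 1 := by
    rw [← Complex.normSq_apply, Complex.normSq_eq_norm_sq, he]; norm_num
  have h3' : (e.re : ℂ) * e.re + e.im * e.im = 1 := by exact_mod_cast h3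
  set B := fderiv ℝ (fderiv ℝ V) z
  have key : ∀ a b : ℝ, B (a • (1 : ℂ) + b • Complex.I) (a • (1 : ℂ) + b • Complex.I) =
      a * a * B 1 1 + a * b * (B 1 Complex.I + B Complex.I 1) + b * b * B Complex.I Complex.I := by
    intro a b
    simp only [map_add, map_smul, add_apply, smul_apply]
    simp only [Complex.real_smul]
    ring
  rw [h2, key]
  nth_rw 1 2 [h1]
  rw [key]
  push_cast
  change B 1 1 + B Complex.I Complex.I = _
  linear_combination (-(B 1 1) - B Complex.I Complex.I) * h3'

/-- The Jensen formula on the disc for functions of class `C²` on the plane. -/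
theorem radialInt_laplacian_of_contDiff {V : ℂ → ℂ} (hV : ContDiff ℝ 2 V) {r : ℝ} (hr : 0 ≤ r) :
    radialInt (fun z => (1 / (2 * Real.pi) : ℝ) * Laplacian.laplacian V z) r =
      Real.circleAverage V 0 r - V 0 := by
  have hpi := Real.pi_pos
  set D1 : ℂ → ℂ →L[ℝ] ℂ := fderiv ℝ V
  set D2 : ℂ → ℂ →L[ℝ] ℂ →L[ℝ] ℂ := fderiv ℝ D1
  have hD1 : ContDiff ℝ 1 D1 := hV.fderiv_right (by norm_num)
  have cD1 : Continuous D1 := hD1.continuous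
  have cD2 : Continuous D2 := hD1.continuous_fderiv (by norm_num)
  have dV : ∀ z, HasFDerivAt V (D1 z) z := fun z =>
    (hV.differentiable (by norm_num) z).hasFDerivAt
  have dD1 : ∀ z, HasFDerivAt D1 (D2 z) z := fun z =>
    (hD1.differentiable (by norm_num) z).hasFDerivAt
  set e : ℝ → ℂ := fun θ => Complex.exp (θ * Complex.I)
  have ce : Continuous e := by fun_prop
  have hcm : ∀ ρ θ, circleMap 0 ρ θ = ρ * e θ := fun ρ θ => by simp [circleMap, e]
  have de : ∀ θ, HasDerivAt e (e θ * Complex.I) θ := by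
    intro θ
    have := ((Complex.ofRealCLM.hasDerivAt (x := θ)).mul_const Complex.I).cexp
    simpa [e] using this
  have ne : ∀ θ, ‖e θ‖ = 1 := fun θ => Complex.norm_exp_ofReal_mul_I θ
  have dρ : ∀ ρ θ : ℝ, HasDerivAt (fun ρ : ℝ => (ρ : ℂ) * e θ) (e θ) ρ := by
    intro ρ θ
    simpa using (Complex.ofRealCLM.hasDerivAt (x := ρ)).mul_const (e θ)
  have dθ : ∀ ρ θ : ℝ, HasDerivAt (fun θ : ℝ => (ρ : ℂ) * e θ) (ρ * (e θ * Complex.I)) θ :=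
    fun ρ θ => (de θ).const_mul (ρ : ℂ)
  -- `Q` is the radial derivative of `V`, and `S` below is the derivative of ρQ in ρ.
  set Q : ℝ → ℝ → ℂ := fun ρ θ => D1 (ρ * e θ) (e θ)
  have cQ : Continuous fun p : ℝ × ℝ => Q p.1 p.2 := by
    simp only [Q]; fun_prop
  set S : ℝ → ℝ → ℂ := fun ρ θ => Q ρ θ + ρ * D2 (ρ * e θ) (e θ) (e θ)
  have cS : Continuous fun p : ℝ × ℝ => S p.1 p.2 := by
    simp only [S]; fun_prop
  have cL : Continuous (fun z => Laplacian.laplacian V z) := by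
    have : (fun z => Laplacian.laplacian V z) =
        fun z => D2 z 1 1 + D2 z (1 * Complex.I) (1 * Complex.I) :=
      funext fun z => laplacian_eq_of_rotation V z 1 (by simp)
    rw [this]; fun_prop
  have swap : ∀ (G : ℝ → ℝ → ℂ) (hG : Continuous fun p : ℝ × ℝ => G p.1 p.2) (t : ℝ),
      ∫ θ in (0 : ℝ)..2 * Real.pi, ∫ ρ in (0 : ℝ)..t, G ρ θ =
        ∫ ρ in (0 : ℝ)..t, ∫ θ in (0 : ℝ)..2 * Real.pi, G ρ θ := by
    intro G hG t
    refine intervalIntegral_intervalIntegral_swap ?_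
    have h1 : Continuous fun p : ℝ × ℝ => G p.2 p.1 := hG.comp continuous_swap
    exact (h1.continuousOn.integrableOn_compact
      (isCompact_uIcc.prod isCompact_uIcc)).mono_set (prod_mono uIoc_subset_uIcc uIoc_subset_uIcc)
  -- first derivative in the radius
  have s1 : ∀ t θ : ℝ, ∫ ρ in (0 : ℝ)..t, Q ρ θ = V (t * e θ) - V 0 := by
    intro t θ
    have := intervalIntegral.integral_eq_sub_of_hasDerivAt (a := 0) (b := t)
      (f := fun ρ : ℝ => V (ρ * e θ)) (f' := fun ρ => Q ρ θ)
      (fun ρ _ => (dV _).comp_hasDerivAt ρ (dρ ρ θ))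
      ((cQ.comp (by fun_prop : Continuous fun ρ : ℝ => (ρ, θ))).intervalIntegrable _ _)
    simpa using this
  have s3 : ∀ t θ : ℝ, ∫ ρ in (0 : ℝ)..t, S ρ θ = t * Q t θ := by
    intro t θ
    have := intervalIntegral.integral_eq_sub_of_hasDerivAt (a := 0) (b := t)
      (f := fun ρ : ℝ => (ρ : ℂ) * Q ρ θ) (f' := fun ρ => S ρ θ)
      (fun ρ _ => by
        have h1 := ((dD1 _).comp_hasDerivAt ρ (dρ ρ θ)).clm_apply (hasDerivAt_const ρ (e θ))
        have h2 := (Complex.ofRealCLM.hasDerivAt (x := ρ)).mul h1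
        refine HasDerivAt.congr_deriv h2 ?_
        simp [S, Q])
      ((cS.comp (by fun_prop : Continuous fun ρ : ℝ => (ρ, θ))).intervalIntegrable _ _)
    simpa using this
  -- ρΔV - S is the θ-derivative of the tangential derivative of `V`, which is periodic, so its
  -- integral over the circle is zero.
  have s4 : ∀ ρ : ℝ, ∫ θ in (0 : ℝ)..2 * Real.pi, S ρ θ =
      ρ * ∫ θ in (0 : ℝ)..2 * Real.pi, Laplacian.laplacian V (circleMap 0 ρ θ) := by
    intro ρ
    have h1 := intervalIntegral.integral_eq_sub_of_hasDerivAt (a := 0) (b := 2 * Real.pi)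
      (f := fun θ : ℝ => D1 (ρ * e θ) (e θ * Complex.I))
      (f' := fun θ => ρ * Laplacian.laplacian V (circleMap 0 ρ θ) - S ρ θ)
      (fun θ _ => by
        have h1 := ((dD1 _).comp_hasDerivAt θ (dθ ρ θ)).clm_apply ((de θ).mul_const Complex.I)
        refine HasDerivAt.congr_deriv h1 ?_
        have e1 : (ρ : ℂ) * (e θ * Complex.I) = ρ • (e θ * Complex.I) := by simp
        have e2 : e θ * Complex.I * Complex.I = - e θ := by
          rw [mul_assoc, Complex.I_mul_I]; ring
        rw [laplacian_eq_of_rotation V _ (e θ) (ne θ), hcm, e1, e2]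
        have e3 : D2 (ρ * e θ) (ρ • (e θ * Complex.I)) (e θ * Complex.I) =
            ρ * D2 (ρ * e θ) (e θ * Complex.I) (e θ * Complex.I) := by
          rw [map_smul]; simp
        rw [e3, map_neg]
        change _ + -(Q ρ θ) = ρ * (D2 _ _ _ + D2 _ _ _) - (Q ρ θ + _)
        ring)
      (by
        refine Continuous.intervalIntegrable ?_ _ _
        have := cS.comp (by fun_prop : Continuous fun θ : ℝ => (ρ, θ))
        simp only [Function.comp_def] at this
        have h2 : Continuous fun θ : ℝ => Laplacian.laplacian V (circleMap 0 ρ θ) :=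
          cL.comp (continuous_circleMap 0 ρ)
        fun_prop)
    have he : e (2 * Real.pi) = e 0 := by simp [e]
    rw [he, sub_self, intervalIntegral.integral_sub, intervalIntegral.integral_const_mul,
      sub_eq_zero] at h1
    · exact h1.symm
    · exact ((cL.comp (continuous_circleMap 0 ρ)).const_mul _ |>.intervalIntegrable _ _)
    · exact (cS.comp (by fun_prop : Continuous fun θ : ℝ => (ρ, θ))).intervalIntegrable _ _
  -- The divergence theorem on the disc: the integral of the Laplacian is the flux `t ∫ Q t θ dθ`,
  -- and 1/t removes the length factor. Integration in t then recovers the values of `V` by `s1`.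
  have s5 : ∀ t : ℝ, 0 < t → ((1 / t : ℝ) : ℂ) *
      ∫ z in ball (0 : ℂ) t, (1 / (2 * Real.pi) : ℝ) * Laplacian.laplacian V z =
      (1 / (2 * Real.pi) : ℝ) * ∫ θ in (0 : ℝ)..2 * Real.pi, Q t θ := by
    intro t ht
    have ht' : (t : ℂ) ≠ 0 := by exact_mod_cast ht.ne'
    rw [integral_const_mul, setIntegral_ball cL ht.le]
    simp_rw [← s4]
    rw [← swap S cS]
    simp_rw [s3]
    rw [intervalIntegral.integral_const_mul]
    push_cast
    field_simp
  rw [radialInt]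
  rw [intervalIntegral.integral_congr_ae (g := fun t : ℝ => (1 / (2 * Real.pi) : ℝ) *
    ∫ θ in (0 : ℝ)..2 * Real.pi, Q t θ)
    (Eventually.of_forall fun t ht => by
      rw [uIoc_of_le hr] at ht; exact s5 t ht.1)]
  rw [intervalIntegral.integral_const_mul, ← swap Q cQ]
  simp_rw [s1]
  rw [intervalIntegral.integral_sub, intervalIntegral.integral_const, Real.circleAverage]
  · simp only [hcm]
    have : (2 * Real.pi : ℂ) ≠ 0 := by
      exact_mod_cast (by positivity : (2 * Real.pi : ℝ) ≠ 0)
    simp only [Complex.real_smul]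
    push_cast
    field_simp
    simp
  · refine Continuous.intervalIntegrable ?_ _ _
    have := hV.continuous
    fun_prop
  · exact intervalIntegrable_const

theorem continuousOn_extension {w : ℂ → ℂ} {r R : ℝ} (hw : ContinuousOn w (ball 0 R))
    (h0 : 0 < r) (hr : r < R) : ∃ w' : ℂ → ℂ, Continuous w' ∧ EqOn w' w (closedBall 0 r) := by
  obtain ⟨w', h1, h2⟩ := exists_contDiff_extension (n := 0) (contDiffOn_zero.2 hw) h0 hr
  exact ⟨w', h1.continuous, h2⟩

theorem radialInt_laplacian {V : ℂ → ℂ} {r R : ℝ} (hV : ∀ z ∈ ball (0 : ℂ) R, ContDiffAt ℝ 2 V z)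
    (h0 : 0 < r) (hr : r < R) :
    radialInt (fun z => (1 / (2 * Real.pi) : ℝ) * Laplacian.laplacian V z) r =
      Real.circleAverage V 0 r - V 0 := by
  obtain ⟨r', hr1, hr2⟩ := exists_between hr
  obtain ⟨V', hV', e⟩ := exists_contDiff_extension (n := 2)
    (fun z hz => (hV z hz).contDiffWithinAt) (h0.trans hr1) hr2
  have hee : ∀ z ∈ closedBall (0 : ℂ) r, V =ᶠ[𝓝 z] V' := fun z hz => by
    filter_upwards [isOpen_ball.mem_nhds (closedBall_subset_ball hr1 hz)] with w hw
    exact (e (ball_subset_closedBall hw)).symm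
  rw [radialInt_congr (w' := fun z => (1 / (2 * Real.pi) : ℝ) * Laplacian.laplacian V' z) h0.le
    fun z hz => by simp only [(InnerProductSpace.laplacian_congr_nhds (hee z hz)).self_of_nhds],
    radialInt_laplacian_of_contDiff hV' h0.le]
  congr 1
  · refine Real.circleAverage_congr_sphere fun z hz => ?_
    rw [abs_of_pos h0] at hz
    exact (hee z (sphere_subset_closedBall hz)).self_of_nhds.symm
  · exact (hee 0 (mem_closedBall_self h0.le)).self_of_nhds.symm

theorem intervalIntegrable_radial_of_continuousOn {w : ℂ → ℂ} {r R : ℝ}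
    (hw : ContinuousOn w (ball 0 R)) (h0 : 0 < r) (hr : r < R) :
    IntervalIntegrable (fun t : ℝ => ((1 / t : ℝ) : ℂ) * ∫ z in ball (0 : ℂ) t, w z)
      volume 0 r := by
  obtain ⟨w', h1, h2⟩ := continuousOn_extension hw h0 hr
  refine (intervalIntegrable_radial h1 h0.le).congr fun t ht => ?_
  rw [uIoc_of_le h0.le] at ht
  congr 1
  exact setIntegral_congr_fun measurableSet_ball
    (h2.mono (ball_subset_closedBall.trans (closedBall_subset_closedBall ht.2)))

theorem integrableOn_ball_of_continuousOn {w : ℂ → ℂ} {t R : ℝ}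
    (hw : ContinuousOn w (ball 0 R)) (ht : t < R) : IntegrableOn w (ball 0 t) :=
  ((hw.mono (closedBall_subset_ball ht)).integrableOn_compact
    (isCompact_closedBall _ _)).mono_set ball_subset_closedBall

theorem radialInt_add {w w' : ℂ → ℂ} {r R : ℝ} (hw : ContinuousOn w (ball 0 R))
    (hw' : ContinuousOn w' (ball 0 R)) (h0 : 0 < r) (hr : r < R) :
    radialInt (fun z => w z + w' z) r = radialInt w r + radialInt w' r := by
  rw [radialInt, radialInt, radialInt, ← intervalIntegral.integral_add
    (intervalIntegrable_radial_of_continuousOn hw h0 hr)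
    (intervalIntegrable_radial_of_continuousOn hw' h0 hr)]
  refine intervalIntegral.integral_congr fun t ht => ?_
  rw [uIcc_of_le h0.le] at ht
  rw [integral_add (integrableOn_ball_of_continuousOn hw (ht.2.trans_lt hr))
    (integrableOn_ball_of_continuousOn hw' (ht.2.trans_lt hr)), mul_add]

theorem radialInt_smul (c : ℂ) (w : ℂ → ℂ) (r : ℝ) :
    radialInt (fun z => c * w z) r = c * radialInt w r := by
  simp only [radialInt, integral_const_mul, ← intervalIntegral.integral_const_mul]
  congr 1; ext t; ring

theorem radialInt_ofReal (e : ℂ → ℝ) (r : ℝ) : radialInt (fun z => (e z : ℂ)) r =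
    ((∫ t in (0 : ℝ)..r, 1 / t * ∫ z in ball (0 : ℂ) t, e z : ℝ) : ℂ) := by
  rw [← intervalIntegral.integral_ofReal, radialInt]
  congr 1; ext t
  rw [integral_complex_ofReal]
  push_cast
  rfl

theorem intervalIntegrable_radial_ofReal {e : ℂ → ℝ} {r R : ℝ}
    (he : ContinuousOn e (ball 0 R)) (h0 : 0 < r) (hr : r < R) :
    IntervalIntegrable (fun t : ℝ => 1 / t * ∫ z in ball (0 : ℂ) t, e z) volume 0 r := by
  have h := intervalIntegrable_radial_of_continuousOn (w := fun z => (e z : ℂ))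
    (Complex.continuous_ofReal.comp_continuousOn he) h0 hr
  have h2 : IntervalIntegrable (fun t : ℝ => (((1 / t : ℝ) : ℂ) *
      ∫ z in ball (0 : ℂ) t, (e z : ℂ)).re) volume 0 r := ⟨h.1.re, h.2.re⟩
  refine h2.congr fun t _ => ?_
  simp only [integral_complex_ofReal]
  rw [← Complex.ofReal_mul, Complex.ofReal_re]

theorem radialInt_nonneg {w : ℂ → ℂ} {r : ℝ} (hr : 0 ≤ r)
    (h : ∀ z ∈ closedBall (0 : ℂ) r, (w z).im = 0 ∧ 0 ≤ (w z).re) :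
    (radialInt w r).im = 0 ∧ 0 ≤ (radialInt w r).re := by
  rw [radialInt_congr (w' := fun z => ((w z).re : ℂ)) hr fun z hz =>
    Complex.ext (by simp) (by simp [(h z hz).1]), radialInt_ofReal]
  refine ⟨Complex.ofReal_im _, ?_⟩
  rw [Complex.ofReal_re]
  refine intervalIntegral.integral_nonneg hr fun t ht => mul_nonneg (by simpa using ht.1) ?_
  refine setIntegral_nonneg measurableSet_ball fun z hz => (h z ?_).2
  exact closedBall_subset_closedBall ht.2 (ball_subset_closedBall hz)

theorem norm_radialInt_le {w : ℂ → ℂ} {e : ℂ → ℝ} {r R : ℝ} (he : ContinuousOn e (ball 0 R))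
    (h0 : 0 < r) (hr : r < R) (h : ∀ z ∈ closedBall (0 : ℂ) r, ‖w z‖ ≤ e z) :
    ‖radialInt w r‖ ≤ (radialInt (fun z => (e z : ℂ)) r).re := by
  rw [radialInt_ofReal, Complex.ofReal_re]
  refine intervalIntegral.norm_integral_le_of_norm_le h0.le (Eventually.of_forall fun t ht => ?_)
    (intervalIntegrable_radial_ofReal he h0 hr)
  rw [norm_mul, Complex.norm_real, Real.norm_of_nonneg (one_div_pos.2 ht.1).le]
  refine mul_le_mul_of_nonneg_left ?_ (one_div_pos.2 ht.1).le
  refine norm_integral_le_of_norm_le ?_ ?_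
  · exact ((he.mono (closedBall_subset_ball (ht.2.trans_lt hr))).integrableOn_compact
      (isCompact_closedBall _ _)).mono_set ball_subset_closedBall
  · refine (ae_restrict_iff' measurableSet_ball).2 (Eventually.of_forall fun z hz => h z ?_)
    exact closedBall_subset_closedBall ht.2 (ball_subset_closedBall hz)

theorem radialInt_mono_radius {e : ℂ → ℝ} {s r R : ℝ} (he : ContinuousOn e (ball 0 R))
    (h0 : 0 < s) (hs : s ≤ r) (hr : r < R) (hpos : ∀ z ∈ ball (0 : ℂ) R, 0 ≤ e z) :
    (radialInt (fun z => (e z : ℂ)) s).re ≤ (radialInt (fun z => (e z : ℂ)) r).re := by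
  rw [radialInt_ofReal, radialInt_ofReal, Complex.ofReal_re, Complex.ofReal_re]
  refine intervalIntegral.integral_mono_interval le_rfl h0.le hs ?_
    (intervalIntegrable_radial_ofReal he (h0.trans_le hs) hr)
  refine (ae_restrict_iff' measurableSet_Ioc).2 (Eventually.of_forall fun t ht => ?_)
  refine mul_nonneg (one_div_pos.2 ht.1).le (setIntegral_nonneg measurableSet_ball fun z hz => ?_)
  exact hpos z (ball_subset_ball (ht.2.trans hr.le) hz)

/-! ### The Fubini–Study density -/

/-- Reduces a diagonal value of the Hessian to calculus in one real variable. -/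
theorem fderiv_fderiv_eq_of_line {u : ℂ → ℂ} {z e : ℂ} (hu : ContDiffAt ℝ 2 u z) {u1 : ℝ → ℂ}
    {c : ℂ} (h1 : ∀ᶠ t : ℝ in 𝓝 0, HasDerivAt (fun s : ℝ => u (z + s * e)) (u1 t) t)
    (h2 : HasDerivAt u1 c 0) : fderiv ℝ (fderiv ℝ u) z e e = c := by
  have hline : ∀ t : ℝ, HasDerivAt (fun s : ℝ => z + s * e) e t := fun t => by
    simpa using ((Complex.ofRealCLM.hasDerivAt (x := t)).mul_const e).const_add z
  have hl0 : Tendsto (fun s : ℝ => z + s * e) (𝓝 0) (𝓝 z) := by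
    have := (hline 0).continuousAt.tendsto
    simpa using this
  have hd : ∀ᶠ w in 𝓝 z, DifferentiableAt ℝ u w := by
    filter_upwards [hu.eventually (by simp)] with w hw
    exact hw.differentiableAt (by norm_num)
  have h3 : ∀ᶠ t : ℝ in 𝓝 0, fderiv ℝ u (z + t * e) e = u1 t := by
    filter_upwards [h1, hl0.eventually hd] with t ht hdt
    exact (hdt.hasFDerivAt.comp_hasDerivAt t (hline t)).unique ht
  have hd2 : HasFDerivAt (fderiv ℝ u) (fderiv ℝ (fderiv ℝ u) z) z :=
    ((hu.fderiv_right (m := 1) (by norm_num)).differentiableAt (by norm_num)).hasFDerivAt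
  have h4 : HasDerivAt (fun t : ℝ => fderiv ℝ u (z + t * e)) (fderiv ℝ (fderiv ℝ u) z e) 0 :=
    hd2.comp_hasDerivAt_of_eq 0 (hline 0) (by simp)
  have h5 := h4.clm_apply (hasDerivAt_const (0 : ℝ) e)
  have h6 : HasDerivAt (fun t : ℝ => fderiv ℝ u (z + t * e) e) c 0 := h2.congr_of_eventuallyEq h3
  have h7 := h5.unique h6
  rwa [map_zero, add_zero] at h7

theorem hasDerivAt_line {F : ℂ → Cn N} {z e : ℂ} {t : ℝ} (hF : AnalyticAt ℂ F (z + t * e)) :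
    HasDerivAt (fun s : ℝ => F (z + s * e)) (e • deriv F (z + t * e)) t := by
  have hline : HasDerivAt (fun s : ℝ => z + s * e) e t := by
    simpa using ((Complex.ofRealCLM.hasDerivAt (x := t)).mul_const e).const_add z
  exact hF.differentiableAt.hasDerivAt.scomp t hline

/-- The density of the pullback of the Fubini–Study form. -/
noncomputable def fsDens (F : ℂ → Cn N) (z : ℂ) : ℝ :=
  (‖F z‖ ^ 2 * ‖deriv F z‖ ^ 2 - ‖inner ℂ (F z) (deriv F z)‖ ^ 2) / ‖F z‖ ^ 4 / Real.pi

theorem contDiffAt_log_norm {F : ℂ → Cn N} {z : ℂ} (hF : AnalyticAt ℂ F z) (hz : F z ≠ 0) :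
    ContDiffAt ℝ 2 (fun w => ((Real.log ‖F w‖ : ℝ) : ℂ)) z := by
  have h1 : ContDiffAt ℝ 2 F z := (hF.contDiffAt (n := 2)).restrict_scalars ℝ
  have h2 : ContDiffAt ℝ 2 (fun w => Real.log ‖F w‖) z := (h1.norm ℂ hz).log (norm_ne_zero_iff.2 hz)
  exact Complex.ofRealCLM.contDiff.contDiffAt.comp z h2

theorem fderiv_fderiv_log_norm {F : ℂ → Cn N} {z : ℂ} (hF : AnalyticAt ℂ F z) (hz : F z ≠ 0)
    (e : ℂ) : fderiv ℝ (fderiv ℝ (fun w => ((Real.log ‖F w‖ : ℝ) : ℂ))) z e e =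
      (((‖e‖ ^ 2 * ‖deriv F z‖ ^ 2 + (e ^ 2 * inner ℂ (F z) (deriv (deriv F) z)).re) / ‖F z‖ ^ 2
        - 2 * (e * inner ℂ (F z) (deriv F z)).re ^ 2 / ‖F z‖ ^ 4 : ℝ) : ℂ) := by
  set γ : ℝ → Cn N := fun t => F (z + t * e)
  set γ1 : ℝ → Cn N := fun t => e • deriv F (z + t * e)
  have hl0 : Tendsto (fun s : ℝ => z + s * e) (𝓝 0) (𝓝 z) := by
    have : Continuous fun s : ℝ => z + s * e := by fun_prop
    simpa using this.tendsto 0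
  have hself : ∀ x : Cn N, (inner ℂ x x).re = ‖x‖ ^ 2 := fun x => by
    rw [inner_self_eq_norm_sq_to_K]; norm_cast
  have hγ : ∀ᶠ t : ℝ in 𝓝 0, HasDerivAt γ (γ1 t) t := by
    filter_upwards [hl0.eventually hF.eventually_analyticAt] with t ht
    exact hasDerivAt_line ht
  have hF0 : AnalyticAt ℂ F (z + (0 : ℝ) * e) := by simpa using hF
  have hγ1 : HasDerivAt γ1 (e • e • deriv (deriv F) z) 0 := by
    have := (hasDerivAt_line (F := deriv F) (z := z) (e := e) (t := 0) hF0.deriv).const_smul e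
    refine HasDerivAt.congr_deriv this ?_
    simp
  have hγ0 : HasDerivAt γ (γ1 0) 0 := hγ.self_of_nhds
  have e0 : γ 0 = F z := by simp [γ]
  have e1 : γ1 0 = e • deriv F z := by simp [γ1]
  have hγne : ∀ᶠ t : ℝ in 𝓝 0, γ t ≠ 0 :=
    hl0.eventually (hF.continuousAt.eventually_ne hz)
  have hn2 : ∀ t, HasDerivAt γ (γ1 t) t →
      HasDerivAt (fun t => ‖γ t‖ ^ 2) (2 * (inner ℂ (γ t) (γ1 t)).re) t := by
    intro t ht
    have h1 := (Complex.reCLM.hasFDerivAt.comp_hasDerivAt t (ht.inner ℂ ht))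
    have h2 : (fun t => ‖γ t‖ ^ 2) = Complex.reCLM ∘ fun t => inner ℂ (γ t) (γ t) := by
      funext t; simp only [Function.comp]; exact (hself _).symm
    rw [h2]
    refine h1.congr_deriv ?_
    rw [Complex.reCLM_apply, Complex.add_re, ← inner_conj_symm (γ1 t) (γ t), Complex.conj_re]
    ring
  set u1 : ℝ → ℝ := fun t => (inner ℂ (γ t) (γ1 t)).re / ‖γ t‖ ^ 2
  refine fderiv_fderiv_eq_of_line (contDiffAt_log_norm hF hz) (u1 := fun t => (u1 t : ℂ)) ?_ ?_
  · filter_upwards [hγ, hγne] with t ht hne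
    have h1 := ((hn2 t ht).log (pow_ne_zero 2 (norm_ne_zero_iff.2 hne))).const_mul (1 / 2 : ℝ)
    have h2 : (fun t => Real.log ‖γ t‖) = fun t => (1 / 2 : ℝ) * Real.log (‖γ t‖ ^ 2) := by
      funext t; rw [Real.log_pow]; push_cast; ring
    have h3 : HasDerivAt (fun t => Real.log ‖γ t‖) (u1 t) t := by
      rw [h2]
      refine h1.congr_deriv ?_
      simp only [u1]; ring
    exact h3.ofReal_comp
  · have h1 := Complex.reCLM.hasFDerivAt.comp_hasDerivAt 0 (hγ0.inner ℂ hγ1)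
    have hne0 : ‖γ 0‖ ^ 2 ≠ 0 := pow_ne_zero 2 (norm_ne_zero_iff.2 hγne.self_of_nhds)
    have h2 := h1.div (hn2 0 hγ0) hne0
    have h3 : HasDerivAt u1 _ 0 := h2
    refine (h3.ofReal_comp).congr_deriv ?_
    congr 1
    have hz' := norm_ne_zero_iff.2 hz
    simp only [Function.comp_def, Complex.reCLM_apply, e0, e1]
    rw [Complex.add_re, hself, norm_smul, inner_smul_right, inner_smul_right, inner_smul_right]
    have : e * (e * inner ℂ (F z) (deriv (deriv F) z)) = e ^ 2 * inner ℂ (F z) (deriv (deriv F) z) := by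
      ring
    rw [this]
    field_simp
    ring

/-- The terms with F'' carry the factor e², so they cancel between the directions 1 and i; the
squares of the real parts add up to the squared norm of ⟨F, F'⟩. -/
theorem laplacian_log_norm {F : ℂ → Cn N} {z : ℂ} (hF : AnalyticAt ℂ F z) (hz : F z ≠ 0) :
    (1 / (2 * Real.pi) : ℝ) * Laplacian.laplacian (fun w => ((Real.log ‖F w‖ : ℝ) : ℂ)) z =
      (fsDens F z : ℂ) := by
  rw [laplacian_eq_of_rotation _ z 1 (by simp), fderiv_fderiv_log_norm hF hz,
    fderiv_fderiv_log_norm hF hz, fsDens, ← Complex.ofReal_add, ← Complex.ofReal_mul]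
  congr 1
  have hz' := norm_ne_zero_iff.2 hz
  have hpi := Real.pi_pos.ne'
  rw [← Complex.normSq_eq_norm_sq (inner ℂ (F z) (deriv F z)), Complex.normSq_apply]
  simp
  field_simp
  ring

/-- The defect in the Cauchy–Schwarz inequality is the squared norm of the part of F' orthogonal to
F. This form shows nonnegativity and allows comparison with other horizontal forms. -/
theorem fsDens_eq {F : ℂ → Cn N} {z : ℂ} (hz : F z ≠ 0) :
    fsDens F z = ‖deriv F z - (inner ℂ (F z) (deriv F z) / (‖F z‖ : ℂ) ^ 2) • F z‖ ^ 2
      / ‖F z‖ ^ 2 / Real.pi := by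
  have hz' := norm_ne_zero_iff.2 hz
  have hz'' : (‖F z‖ : ℂ) ≠ 0 := by exact_mod_cast hz'
  rw [fsDens, norm_sub_inner_smul_sq hz]
  have : inner ℂ (F z) (deriv F z) / (‖F z‖ : ℂ) -
      inner ℂ (F z) (deriv F z) / (‖F z‖ : ℂ) ^ 2 * ‖F z‖ = 0 := by
    field_simp; ring
  rw [this, norm_inner_symm (deriv F z) (F z)]
  field_simp
  simp

theorem fsDens_nonneg {F : ℂ → Cn N} {z : ℂ} (hz : F z ≠ 0) : 0 ≤ fsDens F z := by
  rw [fsDens_eq hz]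
  have := Real.pi_pos
  positivity

theorem continuousAt_fsDens {F : ℂ → Cn N} {z : ℂ} (hF : AnalyticAt ℂ F z) (hz : F z ≠ 0) :
    ContinuousAt (fsDens F) z := by
  have h1 := hF.continuousAt
  have h2 := hF.deriv.continuousAt
  have h3 : ContinuousAt (fun w => inner ℂ (F w) (deriv F w)) z := h1.inner h2
  refine ContinuousAt.div_const (ContinuousAt.div ?_ (h1.norm.pow 4)
    (pow_ne_zero 4 (norm_ne_zero_iff.2 hz))) _
  exact ((h1.norm.pow 2).mul (h2.norm.pow 2)).sub (h3.norm.pow 2)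

theorem norm_coord_le (v : Cn N) (j : Fin (N + 1)) : ‖v j‖ ≤ ‖v‖ := PiLp.norm_apply_le v j

/-- The densities of forms are bounded by the Fubini–Study density. -/
theorem norm_dens_le (η : Form11 N) {M : ℝ} (hM : ∀ v : Cn N, ‖v‖ = 1 → ‖η.1 v‖ ≤ M)
    {F : ℂ → Cn N} {z : ℂ} (hz : F z ≠ 0) :
    ‖dens η F z‖ ≤ ((N + 1) ^ 2 * Real.pi * M) * fsDens F z := by
  obtain ⟨-, h2, h3⟩ := η.2
  have hz' := norm_pos_iff.2 hz
  have hpi := Real.pi_pos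
  set t := inner ℂ (F z) (deriv F z) / (‖F z‖ : ℂ) ^ 2
  set a := deriv F z - t • F z
  have e : deriv F z = a + t • F z := by simp [a]
  -- Scale invariance moves the bound from the unit sphere to `F z`. Only the orthogonal part `a` of
  -- the derivative counts, and the (N+1)² entries account for the constant.
  have hh : ∀ j k, ‖η.1 (F z) j k‖ ≤ M / ‖F z‖ ^ 2 := by
    intro j k
    have hc : ((‖F z‖⁻¹ : ℝ) : ℂ) ≠ 0 := by exact_mod_cast inv_ne_zero hz'.ne'
    have h4 := h3 _ hc (F z) hz j k
    have h5 := hM (((‖F z‖⁻¹ : ℝ) : ℂ) • F z) (by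
      rw [norm_smul, Complex.norm_real, norm_inv, norm_norm, inv_mul_cancel₀ hz'.ne'])
    rw [← h4, Complex.conj_ofReal, norm_mul, norm_mul, Complex.norm_real, norm_inv, norm_norm,
      le_div_iff₀ (by positivity)]
    have h6 : ‖η.1 (((‖F z‖⁻¹ : ℝ) : ℂ) • F z) j k‖ ≤ M :=
      ((norm_le_pi_norm _ k).trans (norm_le_pi_norm _ j)).trans h5
    calc _ = ‖η.1 (((‖F z‖⁻¹ : ℝ) : ℂ) • F z) j k‖ := by field_simp
      _ ≤ M := h6
  rw [fsDens_eq hz, dens]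
  have e' : ∀ j, deriv F z j = (a + t • F z) j := fun j => by rw [← e]
  simp_rw [e']
  rw [sum_horizontal (h2 _ hz).1 (h2 _ hz).2]
  calc _ ≤ ∑ _j : Fin (N + 1), ∑ _k : Fin (N + 1), M / ‖F z‖ ^ 2 * (‖a‖ * ‖a‖) := by
        refine (norm_sum_le _ _).trans (Finset.sum_le_sum fun j _ => ?_)
        refine (norm_sum_le _ _).trans (Finset.sum_le_sum fun k _ => ?_)
        rw [norm_mul, norm_mul, RCLike.norm_conj]
        exact mul_le_mul (hh j k) (mul_le_mul (norm_coord_le _ _) (norm_coord_le _ _)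
          (norm_nonneg _) (norm_nonneg _)) (by positivity) ((norm_nonneg _).trans (hh j k))
    _ = _ := by
        simp only [Finset.sum_const, Finset.card_univ, Fintype.card_fin, nsmul_eq_mul]
        push_cast
        field_simp
        rfl

/-! ### Degrees of discs -/

theorem discCurrent_eq_radialInt (f : ℂ → PN N) (r : ℝ) (η : Form11 N) :
    discCurrent f r η = radialInt (pullDens f η) r := rfl

theorem IsHolDisc.continuousOn_pullDens {X : Set (PN N)} {f : ℂ → PN N} (hf : IsHolDisc X f)
    (η : Form11 N) : ContinuousOn (pullDens f η) (ball 0 1) := fun z hz =>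
  (continuousAt_pullDens η (hf z hz).1).continuousWithinAt

theorem IsHolDisc.eventually_mem {X : Set (PN N)} {f : ℂ → PN N} (hf : IsHolDisc X f) {z : ℂ}
    (hz : z ∈ ball (0 : ℂ) 1) : ∀ᶠ w in 𝓝 z, f w ∈ X := by
  filter_upwards [isOpen_ball.mem_nhds hz] with w hw using (hf w hw).2

theorem circleAverage_ofReal (g : ℂ → ℝ) (c : ℂ) (r : ℝ) :
    Real.circleAverage (fun z => (g z : ℂ)) c r = ((Real.circleAverage g c r : ℝ) : ℂ) := by
  simp only [Real.circleAverage, intervalIntegral.integral_ofReal, Complex.real_smul, smul_eq_mul,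
    Complex.ofReal_mul]

theorem discCurrent_of_potential {f : ℂ → PN N} {η : Form11 N} {V : ℂ → ℂ} {r R : ℝ}
    (hV : ∀ z ∈ ball (0 : ℂ) R, ContDiffAt ℝ 2 V z)
    (h : ∀ z ∈ ball (0 : ℂ) R,
      pullDens f η z = (1 / (2 * Real.pi) : ℝ) * Laplacian.laplacian V z)
    (h0 : 0 < r) (hr : r < R) : discCurrent f r η = Real.circleAverage V 0 r - V 0 := by
  rw [discCurrent_eq_radialInt, ← radialInt_laplacian hV h0 hr]
  exact radialInt_congr h0.le fun z hz => h z (closedBall_subset_ball hr hz)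

theorem IsGermIn.mem_cone {X : Set (PN N)} {F : ℂ → Cn N} {z : ℂ} (h : IsGermIn X F z) :
    F z ∈ cone X := h.2.self_of_nhds

theorem SmoothOnCone.contDiffAt_comp {A : Type*} [NormedAddCommGroup A] [NormedSpace ℝ A]
    {X : Set (PN N)} {u : Cn N → A} (hu : SmoothOnCone X u) {F : ℂ → Cn N} {z : ℂ}
    (hF : IsGermIn X F z) : ContDiffAt ℝ 2 (fun w => u (F w)) z := by
  obtain ⟨h, hX⟩ := hF.mem_cone
  obtain ⟨U, w, hU, hvU, hw, e⟩ := hu (F z) h hX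
  have h1 : ContDiffAt ℝ 2 F z := (hF.1.contDiffAt (n := 2)).restrict_scalars ℝ
  have h2 : ContDiffAt ℝ 2 w (F z) :=
    (hw.contDiffAt (hU.mem_nhds hvU)).of_le (WithTop.coe_le_coe.2 le_top)
  refine (h2.comp z h1).congr_of_eventuallyEq ?_
  filter_upwards [hF.1.continuousAt.eventually (hU.mem_nhds hvU), hF.2] with w' h3 ⟨h4, h5⟩
  exact e _ h3 h4 h5

/-- The function `u` need not be constant on lines, so the formula applies to log m as well as to
functions on X; this is why one fixed lift over a larger disc is needed. -/
theorem discCurrent_of_isDdc {X : Set (PN N)} {u : Cn N → ℂ} (hu : SmoothOnCone X u)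
    {η : Form11 N} (hη : IsDdc X univ u η) {f : ℂ → PN N} (hf : IsHolDisc X f) {F : ℂ → Cn N}
    {s r : ℝ} (hs : s < 1) (hF : ∀ z ∈ closedBall (0 : ℂ) s, IsLift f z F) (h0 : 0 < r)
    (hr : r < s) : discCurrent f r η = Real.circleAverage (fun w => u (F w)) 0 r - u (F 0) := by
  have hg : ∀ z ∈ ball (0 : ℂ) s, IsGermIn X F z := fun z hz =>
    (hF z (ball_subset_closedBall hz)).isGermIn (hf.eventually_mem (ball_subset_ball hs.le hz))
  refine discCurrent_of_potential (V := fun w => u (F w)) (R := s)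
    (fun z hz => hu.contDiffAt_comp (hg z hz)) (fun z hz => ?_) h0 hr
  rw [pullDens_eq η (hF z (ball_subset_closedBall hz))]
  exact hη F z (hg z hz) (mem_univ _)

theorem IsMetricO1.smoothOnCone_log {X : Set (PN N)} {m : Cn N → ℝ} (hm : IsMetricO1 X m) (k : ℕ) :
    SmoothOnCone X (fun v => ((Real.log (m v) / k : ℝ) : ℂ)) := by
  intro v hv hX
  obtain ⟨U, w, hU, hvU, hw, e⟩ := hm.smooth v hv hX
  have hwv : 0 < w v := by rw [← e v hvU hv hX]; exact hm.pos v hv hX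
  refine ⟨U ∩ w ⁻¹' Ioi 0, fun v => ((Real.log (w v) / k : ℝ) : ℂ),
    hw.continuousOn.isOpen_inter_preimage hU isOpen_Ioi, ⟨hvU, hwv⟩, ?_, ?_⟩
  · refine Complex.ofRealCLM.contDiff.comp_contDiffOn ?_
    exact ((hw.mono inter_subset_left).log fun v hv => (ne_of_gt hv.2)).div_const _
  · rintro v' ⟨h1, -⟩ h' hX'
    simp only [e v' h1 h' hX']

theorem IsMetricO1.exists_log_bound {X : Set (PN N)} (hX : IsZariskiClosed X) {m : Cn N → ℝ}
    (hm : IsMetricO1 X m) :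
    ∃ C, 0 ≤ C ∧ ∀ v ∈ cone X, |Real.log ‖v‖ - Real.log (m v)| ≤ C := by
  -- Both norms are homogeneous of degree 1, so the logarithm of their ratio is constant on lines.
  obtain ⟨C, hC⟩ := exists_bound_of_homog hX (u := fun v => Real.log ‖v‖ - Real.log (m v)) (by
    refine ContinuousOn.sub ?_ ?_
    · exact continuous_norm.continuousOn.log fun v hv => norm_ne_zero_iff.2 hv.1
    · exact hm.smooth.continuousOn.log fun v hv => (hm.pos v hv.1 hv.2).ne') (by
    rintro v ⟨hv, hvX⟩ c hc
    have h1 := norm_ne_zero_iff.2 hc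
    have h2 := norm_ne_zero_iff.2 hv
    have h3 := (hm.pos v hv hvX).ne'
    rw [hm.homog v hv hvX, norm_smul, Real.log_mul h1 h2, Real.log_mul h1 h3]
    ring)
  exact ⟨max C 0, le_max_right _ _, fun v hv => (hC v hv).trans (le_max_left _ _)⟩

theorem radialInt_fsDens {F : ℂ → Cn N} {r R : ℝ}
    (hF : ∀ z ∈ ball (0 : ℂ) R, AnalyticAt ℂ F z ∧ F z ≠ 0) (h0 : 0 < r) (hr : r < R) :
    radialInt (fun z => (fsDens F z : ℂ)) r =
      ((Real.circleAverage (fun z => Real.log ‖F z‖) 0 r - Real.log ‖F 0‖ : ℝ) : ℂ) := by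
  rw [Complex.ofReal_sub, ← circleAverage_ofReal, ← radialInt_laplacian
    (fun z hz => contDiffAt_log_norm (hF z hz).1 (hF z hz).2) h0 hr]
  refine radialInt_congr h0.le fun z hz => ?_
  have := hF z (closedBall_subset_ball hr hz)
  exact (laplacian_log_norm this.1 this.2).symm

theorem abs_circleAverage_sub_le {u v : ℂ → ℝ} {r C : ℝ} (hr : 0 < r)
    (hu : ContinuousOn u (sphere 0 r)) (hv : ContinuousOn v (sphere 0 r))
    (h : ∀ z ∈ sphere (0 : ℂ) r, |u z - v z| ≤ C) :
    |Real.circleAverage u 0 r - Real.circleAverage v 0 r| ≤ C := by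
  have hu' : CircleIntegrable u 0 r := hu.circleIntegrable hr.le
  have hv' : CircleIntegrable v 0 r := hv.circleIntegrable hr.le
  rw [← Real.circleAverage_fun_sub hu' hv']
  refine Real.abs_circleAverage_le_circleAverage_abs.trans ?_
  refine Real.circleAverage_mono_on_of_le_circle ?_ fun z hz => ?_
  · exact (hu.sub hv).abs.circleIntegrable hr.le
  · rw [abs_of_pos hr] at hz
    exact h z hz

/-- Comparison of the degree with the Fubini–Study energy of a lift. -/
theorem exists_energy_bound {X : Set (PN N)} (hX : IsZariskiClosed X) {k : ℕ} (hk : 0 < k)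
    {m : Cn N → ℝ} (hm : IsMetricO1 X m) {ηH : Form11 N} (hηH : IsAmpleChernForm X k m ηH) :
    ∃ C, 0 ≤ C ∧ ∀ (f : ℂ → PN N) (F : ℂ → Cn N) (s r : ℝ), IsHolDisc X f → s < 1 →
      (∀ z ∈ closedBall (0 : ℂ) s, IsLift f z F) → 0 < r → r < s →
      |(Real.circleAverage (fun z => Real.log ‖F z‖) 0 r - Real.log ‖F 0‖)
        - k * discDegree ηH f r| ≤ C := by
  obtain ⟨C, hC0, hC⟩ := hm.exists_log_bound hX
  -- One `C` for the mean over the circle, one for the value at the centre.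
  refine ⟨C + C, by positivity, fun f F s r hf hs hF h0 hr => ?_⟩
  have hk' : (k : ℝ) ≠ 0 := by exact_mod_cast hk.ne'
  have hcone : ∀ z ∈ closedBall (0 : ℂ) r, F z ∈ cone X := fun z hz => by
    have hz' : z ∈ closedBall (0 : ℂ) s := closedBall_subset_closedBall hr.le hz
    have := (hf z (closedBall_subset_ball hs hz')).2
    rw [(hF z hz').eq_mk] at this
    exact ⟨_, this⟩
  have hcont : ContinuousOn F (closedBall 0 r) := fun z hz =>
    (hF z (closedBall_subset_closedBall hr.le hz)).1.continuousAt.continuousWithinAt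
  have hd : discDegree ηH f r = (Real.circleAverage (fun w => Real.log (m (F w))) 0 r
      - Real.log (m (F 0))) / k := by
    have e1 : ∀ w, Real.log (m (F w)) / k = (k : ℝ)⁻¹ • Real.log (m (F w)) := fun w => by
      rw [smul_eq_mul]; ring
    rw [discDegree, discCurrent_of_isDdc (hm.smoothOnCone_log k) hηH hf hs hF h0 hr,
      circleAverage_ofReal, ← Complex.ofReal_sub, Complex.ofReal_re]
    simp_rw [e1]
    rw [Real.circleAverage_fun_smul, smul_eq_mul, smul_eq_mul]
    ring
  have hc1 : ContinuousOn (fun w => Real.log ‖F w‖) (sphere 0 r) :=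
    (hcont.mono sphere_subset_closedBall).norm.log fun z hz =>
      norm_ne_zero_iff.2 (hcone z (sphere_subset_closedBall hz)).1
  have hc2 : ContinuousOn (fun w => Real.log (m (F w))) (sphere 0 r) := by
    refine ContinuousOn.log ?_ fun z hz => ?_
    · exact hm.smooth.continuousOn.comp (hcont.mono sphere_subset_closedBall)
        fun z hz => hcone z (sphere_subset_closedBall hz)
    · obtain ⟨h1, h2⟩ := hcone z (sphere_subset_closedBall hz)
      exact (hm.pos _ h1 h2).ne'
  have h1 := abs_circleAverage_sub_le h0 hc1 hc2
    fun z hz => hC _ (hcone z (sphere_subset_closedBall hz))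
  have h2 := hC _ (hcone 0 (mem_closedBall_self h0.le))
  rw [hd, mul_div_cancel₀ _ hk']
  rw [abs_le] at h1 h2 ⊢
  constructor <;> linarith [h1.1, h1.2, h2.1, h2.2]

/-- Bounds for the currents of discs in terms of their degrees. -/
theorem exists_degree_estimates {X : Set (PN N)} (hX : IsZariskiClosed X) {k : ℕ} (hk : 0 < k)
    {m : Cn N → ℝ} (hm : IsMetricO1 X m) {ηH : Form11 N} (hηH : IsAmpleChernForm X k m ηH) :
    ∃ C, 0 ≤ C ∧ ∀ f : ℂ → PN N, IsHolDisc X f → ∀ r, 0 < r → r < 1 →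
      (∀ (η : Form11 N) (M : ℝ), (∀ v : Cn N, ‖v‖ = 1 → ‖η.1 v‖ ≤ M) →
        ‖discCurrent f r η‖ ≤ ((N + 1) ^ 2 * Real.pi * M) * (k * discDegree ηH f r + C)) ∧
      ∀ s, 0 < s → s ≤ r → k * discDegree ηH f s ≤ k * discDegree ηH f r + C := by
  obtain ⟨C, hC0, hC⟩ := exists_energy_bound hX hk hm hηH
  -- Domination by the Fubini–Study energy costs one `C`. Comparison of two radii costs two, since
  -- each degree is exchanged for an energy, and the energy is monotone.
  refine ⟨C + C, by positivity, fun f hf r h0 hr => ?_⟩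
  obtain ⟨R, hR1, hR2⟩ := exists_between hr
  obtain ⟨F, hF⟩ := exists_lift (fun z hz => (hf z hz).1) hR2
  have hFa : ∀ z ∈ ball (0 : ℂ) R, AnalyticAt ℂ F z ∧ F z ≠ 0 := fun z hz =>
    ⟨(hF z (ball_subset_closedBall hz)).1, (hF z (ball_subset_closedBall hz)).ne_zero⟩
  have hcont : ContinuousOn (fsDens F) (ball 0 R) := fun z hz =>
    (continuousAt_fsDens (hFa z hz).1 (hFa z hz).2).continuousWithinAt
  have hEr := abs_le.1 (hC f F R r hf hR2 hF h0 hR1)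
  have hfs := radialInt_fsDens hFa h0 hR1
  refine ⟨fun η M hM => ?_, fun s hs hsr => ?_⟩
  · have hM0 : 0 ≤ M := by
      obtain ⟨v, h, hv, -⟩ := exists_unit_rep (f 0)
      exact (norm_nonneg _).trans (hM v hv)
    have hpi := Real.pi_pos
    have h1 := norm_radialInt_le (w := pullDens f η)
      (e := fun z => ((N + 1) ^ 2 * Real.pi * M) * fsDens F z) (continuousOn_const.mul hcont) h0 hR1
      fun z hz => by
        have hz' := closedBall_subset_closedBall hR1.le hz
        rw [pullDens_eq η (hF z hz')]
        exact norm_dens_le η hM (hF z hz').ne_zero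
    have h2 : radialInt (fun z => ((((N + 1) ^ 2 * Real.pi * M) * fsDens F z : ℝ) : ℂ)) r =
        (((N + 1) ^ 2 * Real.pi * M : ℝ) : ℂ) * radialInt (fun z => (fsDens F z : ℂ)) r := by
      rw [← radialInt_smul]; push_cast; rfl
    rw [h2, hfs, ← Complex.ofReal_mul, Complex.ofReal_re] at h1
    refine h1.trans (mul_le_mul_of_nonneg_left ?_ (by positivity))
    linarith [hEr.2]
  · have h1 := radialInt_mono_radius hcont hs hsr hR1 fun z hz => fsDens_nonneg (hFa z hz).2
    rw [hfs, radialInt_fsDens hFa hs (hsr.trans_lt hR1), Complex.ofReal_re, Complex.ofReal_re] at h1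
    have hEs := abs_le.1 (hC f F R s hf hR2 hF hs (hsr.trans_lt hR1))
    linarith [hEs.1, hEr.2]

/-! ### Weak limits -/

theorem dens_add (η θ : Form11 N) (F : ℂ → Cn N) (z : ℂ) :
    dens (η + θ) F z = dens η F z + dens θ F z := by
  simp [dens, add_mul, Finset.sum_add_distrib]

theorem dens_const_smul (c : ℂ) (η : Form11 N) (F : ℂ → Cn N) (z : ℂ) :
    dens (c • η) F z = c * dens η F z := by
  simp only [dens, Submodule.coe_smul, Pi.smul_apply, smul_eq_mul, mul_assoc c, ← Finset.mul_sum]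

/-- The current of a disc as a linear functional. -/
noncomputable def discCurrentLinear {X : Set (PN N)} {f : ℂ → PN N} (hf : IsHolDisc X f) {r : ℝ}
    (h0 : 0 < r) (hr : r < 1) : Form11 N →ₗ[ℂ] ℂ where
  toFun η := discCurrent f r η
  map_add' η θ := by
    rw [discCurrent_eq_radialInt, discCurrent_eq_radialInt, discCurrent_eq_radialInt,
      ← radialInt_add (hf.continuousOn_pullDens η) (hf.continuousOn_pullDens θ) h0 hr]
    congr 1; funext z
    simp only [pullDens]
    split_ifs
    · exact dens_add _ _ _ _
    · simp
  map_smul' c η := by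
    rw [discCurrent_eq_radialInt, discCurrent_eq_radialInt, RingHom.id_apply, smul_eq_mul,
      ← radialInt_smul]
    congr 1; funext z
    simp only [pullDens]
    split_ifs
    · exact dens_const_smul _ _ _ _
    · simp

theorem discCurrent_eq_zero_of_mem_vanishingOn {X : Set (PN N)} {f : ℂ → PN N}
    (hf : IsHolDisc X f) {r : ℝ} (h0 : 0 < r) (hr : r < 1) {η : Form11 N}
    (hη : η ∈ vanishingOn X) : discCurrent f r η = 0 := by
  rw [discCurrent_eq_radialInt, radialInt_congr (w' := fun _ => 0) h0.le]
  · simp [radialInt]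
  · intro z hz
    have hz' := closedBall_subset_ball hr hz
    obtain ⟨F, hF⟩ := (hf z hz').1
    rw [pullDens_eq η hF]
    exact hη F z (hF.isGermIn (hf.eventually_mem hz'))

/-- Continuous functions on the compact unit sphere form a separable metric space, hence so does the
subset of restrictions of smooth forms. C⁰ density suffices because the normalised currents are
bounded for the C⁰ norm. -/
theorem exists_dense_seq_forms (N : ℕ) : ∃ η : ℕ → Form11 N, ∀ (θ : Form11 N) (ε : ℝ), 0 < ε →
    ∃ i, ∀ v : Cn N, ‖v‖ = 1 → ‖(θ - η i).1 v‖ ≤ ε := by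
  have hcont : ∀ θ : Form11 N, Continuous fun v : sphere (0 : Cn N) 1 => θ.1 v := fun θ => by
    refine (θ.2.1.continuousOn.mono fun v hv => ?_).domRestrict
    rintro rfl
    simp at hv
  let R : Form11 N → C(sphere (0 : Cn N) 1, Coeff N) := fun θ => ⟨fun v => θ.1 v, hcont θ⟩
  have : Nonempty (range R) := ⟨⟨R 0, 0, rfl⟩⟩
  have hd := TopologicalSpace.denseRange_denseSeq (range R)
  choose η hη using fun i => (TopologicalSpace.denseSeq (range R) i).2
  refine ⟨η, fun θ ε hε => ?_⟩
  obtain ⟨i, hi⟩ := hd.exists_dist_lt ⟨R θ, θ, rfl⟩ hε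
  refine ⟨i, fun v hv => ?_⟩
  rw [Subtype.dist_eq, ← hη i] at hi
  have h1 := (ContinuousMap.dist_apply_le_dist (f := R θ) (g := R (η i))
    ⟨v, mem_sphere_zero_iff_norm.2 hv⟩).trans hi.le
  rw [dist_eq_norm] at h1
  exact h1

/-- Weak compactness of families of functionals that are bounded for the `C⁰` norm. -/
theorem exists_weak_limit {L : ℕ → Form11 N →ₗ[ℂ] ℂ} {K : ℝ}
    (hL : ∀ᶠ n in atTop, ∀ (η : Form11 N) (M : ℝ), (∀ v : Cn N, ‖v‖ = 1 → ‖η.1 v‖ ≤ M) →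
      ‖L n η‖ ≤ K * M) :
    ∃ (χ : ℕ → ℕ) (T : Form11 N →ₗ[ℂ] ℂ), StrictMono χ ∧
      ∀ η, Tendsto (fun n => L (χ n) η) atTop (𝓝 (T η)) := by
  obtain ⟨η, hη⟩ := exists_dense_seq_forms N
  have hbd : ∀ θ : Form11 N, ∃ M, ∀ v : Cn N, ‖v‖ = 1 → ‖θ.1 v‖ ≤ M := fun θ => by
    obtain ⟨M, hM⟩ := (isCompact_sphere (0 : Cn N) 1).exists_bound_of_continuousOn
      (θ.2.1.continuousOn.mono fun v hv => by rintro rfl; simp at hv)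
    exact ⟨M, fun v hv => hM v (mem_sphere_zero_iff_norm.2 hv)⟩
  choose M hM using hbd
  have hcomp : IsCompact (Set.pi univ fun i => closedBall (0 : ℂ) (K * M (η i))) :=
    isCompact_univ_pi fun i => isCompact_closedBall _ _
  -- Sequential compactness of a countable product of discs replaces the diagonal argument;
  -- convergence on all forms follows by approximation within `δ`, chosen so that `K * δ < ε / 3`.
  obtain ⟨a, -, χ, hχ, hlim⟩ := hcomp.tendsto_subseq' (x := fun n i => L n (η i))
    (Eventually.frequently (hL.mono fun n hn i _ => by
      simpa using hn (η i) _ (hM (η i))))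
  have hlim' : ∀ i, Tendsto (fun n => L (χ n) (η i)) atTop (𝓝 (a i)) := fun i =>
    (tendsto_pi_nhds.1 hlim) i
  have hLχ := hχ.tendsto_atTop.eventually hL
  have hconv : ∀ θ, ∃ l, Tendsto (fun n => L (χ n) θ) atTop (𝓝 l) := by
    intro θ
    refine cauchySeq_tendsto_of_complete (Metric.cauchySeq_iff'.2 fun ε hε => ?_)
    set δ := ε / (4 * (|K| + 1))
    have hδ : 0 < δ := by positivity
    have hKδ : K * δ < ε / 3 := by
      have h1 : K * δ ≤ |K| * δ := mul_le_mul_of_nonneg_right (le_abs_self K) hδ.le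
      have h2 : |K| * δ ≤ ε / 4 := by
        simp only [δ]
        rw [mul_div_assoc', div_le_div_iff₀ (by positivity) (by norm_num)]
        nlinarith [abs_nonneg K]
      linarith
    obtain ⟨i, hi⟩ := hη θ δ hδ
    obtain ⟨n1, h1⟩ := Metric.cauchySeq_iff.1 (hlim' i).cauchySeq (ε / 3) (by positivity)
    obtain ⟨n2, h2⟩ := eventually_atTop.1 hLχ
    refine ⟨max n1 n2, fun n hn => ?_⟩
    have h3 := h1 n ((le_max_left _ _).trans hn) (max n1 n2) (le_max_left _ _)
    have h4 := h2 n ((le_max_right _ _).trans hn) _ _ hi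
    have h5 := h2 (max n1 n2) (le_max_right _ _) _ _ hi
    rw [map_sub] at h4 h5
    rw [dist_eq_norm] at h3 ⊢
    calc ‖L (χ n) θ - L (χ (max n1 n2)) θ‖ = ‖(L (χ n) θ - L (χ n) (η i)) +
          (L (χ n) (η i) - L (χ (max n1 n2)) (η i)) -
          (L (χ (max n1 n2)) θ - L (χ (max n1 n2)) (η i))‖ := by congr 1; ring
      _ ≤ ‖L (χ n) θ - L (χ n) (η i)‖ + ‖L (χ n) (η i) - L (χ (max n1 n2)) (η i)‖ +
          ‖L (χ (max n1 n2)) θ - L (χ (max n1 n2)) (η i)‖ :=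
        (norm_sub_le _ _).trans (add_le_add_left (norm_add_le _ _) _)
      _ < ε := by linarith
  choose T hT using hconv
  refine ⟨χ, { toFun := T, map_add' := fun θ θ' => ?_, map_smul' := fun c θ => ?_ }, hχ, hT⟩
  · refine tendsto_nhds_unique (hT (θ + θ')) ?_
    simpa using (hT θ).add (hT θ')
  · refine tendsto_nhds_unique (hT (c • θ)) ?_
    simpa using (hT θ).const_mul c

/-! ### Intersection with effective divisors -/

theorem pval_mul (P Q : Poly N) (p : PN N) : pval (P * Q) p = pval P p * pval Q p := by
  simp [pval]

theorem pval_sub (P Q : Poly N) (p : PN N) : pval (P - Q) p = pval P p - pval Q p := by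
  simp [pval]

theorem pval_one (p : PN N) : pval (1 : Poly N) p = 1 := by simp [pval]

/-- The local equations of a divisor do not vanish outside its support. -/
theorem CartierDivisor.RegularEq.pval_ne_zero {X : Set (PN N)} (hX : IsProjectiveVariety X)
    {E : CartierDivisor X} {x : PN N} (hx : x ∈ X) {A B : Poly N} (h : E.RegularEq x A B)
    (hsupp : x ∉ E.support) : pval A x ≠ 0 := by
  have hu : UnitEquivAt X x (E.P x) (E.Q x) 1 1 := by
    by_contra hn
    exact hsupp ⟨hx, hn⟩
  obtain ⟨A', B', d', hA', hB', hA0, hB0, e'⟩ := hu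
  obtain ⟨d, hA, hB, hBx, e⟩ := h
  -- A'/B' and A/B represent the same rational function on X. Irreducibility cancels `Q x`, so A'B =
  -- AB' on X, and a zero of `A` at `x` would contradict that `A'` and `B` do not vanish there.
  have hdeg : (A' * B - A * B').IsHomogeneous (d + d') := by
    refine MvPolynomial.IsHomogeneous.sub ?_ (hA.mul hB')
    exact add_comm d' d ▸ hA'.mul hB
  have hzero : ∀ p ∈ X, pval (E.Q x) p * pval (A' * B - A * B') p = 0 := by
    intro p hp
    have h1 := e' p hp
    have h2 := e p hp
    rw [pval_one] at h1
    rw [pval_sub, pval_mul, pval_mul]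
    linear_combination (-(pval B p)) * h1 + pval B' p * h2
  rcases hX.irreducible _ _ _ _ (E.homogQ x hx) hdeg hzero with h1 | h1
  · obtain ⟨p, hp, hne⟩ := E.nonzeroQ x hx
    exact absurd (h1 p hp) hne
  · intro hA0'
    have := h1 x hx
    rw [pval_sub, pval_mul, pval_mul, hA0', zero_mul, sub_zero] at this
    exact mul_ne_zero hA0 hBx this

/-- The mean over a circle of the logarithm of the modulus of a polynomial. -/
theorem le_circleAverage_sum_log (Z : Finset ℂ) (n : ℂ → ℕ) (h0 : (0 : ℂ) ∉ Z) {r : ℝ}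
    (hr : 0 < r) :
    CircleIntegrable (fun w => ∑ c ∈ Z, (n c : ℝ) * Real.log ‖w - c‖) 0 r ∧
    ∑ c ∈ Z, (n c : ℝ) * Real.log ‖(0 : ℂ) - c‖ ≤
      Real.circleAverage (fun w => ∑ c ∈ Z, (n c : ℝ) * Real.log ‖w - c‖) 0 r := by
  have hint : ∀ c ∈ Z, CircleIntegrable (fun w => (n c : ℝ) * Real.log ‖w - c‖) 0 r :=
    fun c _ => (circleIntegrable_log_norm_sub_const r).const_fun_smul (a := (n c : ℝ))
  refine ⟨CircleIntegrable.fun_sum Z hint, ?_⟩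
  rw [Real.circleAverage_fun_sum hint]
  refine Finset.sum_le_sum fun c hc => ?_
  have h1 : Real.circleAverage (fun w => (n c : ℝ) * Real.log ‖w - c‖) 0 r =
      n c * Real.circleAverage (fun w => Real.log ‖w - c‖) 0 r :=
    Real.circleAverage_fun_smul (a := (n c : ℝ)) (f := fun w => Real.log ‖w - c‖)
  -- The mean of log|w - c| over the circle is log max(r, |c|), which is at least its value log|c|
  -- at the centre.
  rw [h1, circleAverage_log_norm_sub_const_eq_log_radius_add_posLog hr.ne']
  refine mul_le_mul_of_nonneg_left ?_ (Nat.cast_nonneg _)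
  have hc0 : ‖(0 : ℂ) - c‖ ≠ 0 := by
    rw [zero_sub, norm_neg, norm_ne_zero_iff]
    rintro rfl; exact h0 hc
  have h2 : Real.log (|r|⁻¹ * ‖(0 : ℂ) - c‖) ≤ Real.posLog (|r|⁻¹ * ‖(0 : ℂ) - c‖) :=
    le_max_right _ _
  rw [abs_of_pos hr, Real.log_mul (inv_ne_zero hr.ne') hc0, Real.log_inv] at h2
  linarith

/-- Local data of a metrised effective divisor along a disc: the norm `ρ` of the section is,
near each point, `|a| e^{-u}` with `a` analytic and `u` smooth. -/
theorem le_discCurrent_of_local {f : ℂ → PN N} {η : Form11 N} {ρ : ℂ → ℝ}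
    {a : ℂ → ℂ → ℂ} {u : ℂ → ℂ → ℝ}
    (ha : ∀ z ∈ ball (0 : ℂ) 1, AnalyticAt ℂ (a z) z)
    (hu : ∀ z ∈ ball (0 : ℂ) 1, ContDiffAt ℝ 2 (u z) z)
    (hρ : ∀ z ∈ ball (0 : ℂ) 1, ∀ᶠ w in 𝓝 z, ρ w = ‖a z w‖ * Real.exp (-u z w))
    (hη : ∀ z ∈ ball (0 : ℂ) 1, pullDens f η z =
      (1 / (2 * Real.pi) : ℝ) * Laplacian.laplacian (fun w => (u z w : ℂ)) z)
    {C : ℝ} (hC : ∀ z ∈ ball (0 : ℂ) 1, ρ z ≤ C) (hρ0 : ρ 0 ≠ 0) {r : ℝ} (h0 : 0 < r)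
    (hr : r < 1) :
    (discCurrent f r η).im = 0 ∧ Real.log (ρ 0) - Real.log C ≤ (discCurrent f r η).re := by
  classical
  obtain ⟨s, hrs, hs⟩ := exists_between hr
  set V : Set ℂ := {w | ρ w = 0}
  have hρzero : ∀ z ∈ ball (0 : ℂ) 1, ∀ᶠ w in 𝓝 z, (a z w = 0 ↔ w ∈ V) := fun z hz => by
    filter_upwards [hρ z hz] with w hw
    simp [V, hw, (Real.exp_pos _).ne']
  obtain ⟨Z, n, hZ0, hZ⟩ := exists_common_divisor ha hρzero hρ0 hs
  choose! hV h hh hhz e using hZ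
  have hsub : closedBall (0 : ℂ) s ⊆ ball 0 1 := closedBall_subset_ball hs
  -- `L` is the logarithm of the modulus of the polynomial carrying the zeros of the section. The
  -- potential `pot` below equals `L` - log ρ off the zeros and is C² across them; the removed term
  -- log|h| is harmonic, so `pot` has the Laplacian of the local `u`.
  set L : ℂ → ℝ := fun w => ∑ c ∈ Z, (n c : ℝ) * Real.log ‖w - c‖
  have hL : ∀ w, (∏ c ∈ Z, (w - c) ^ n c) ≠ 0 → Real.log ‖∏ c ∈ Z, (w - c) ^ n c‖ = L w := by
    intro w hw
    rw [norm_prod, Real.log_prod fun c hc => norm_ne_zero_iff.2 (Finset.prod_ne_zero_iff.1 hw c hc)]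
    refine Finset.sum_congr rfl fun c _ => ?_
    rw [norm_pow, Real.log_pow]
  set pot : ℂ → ℝ := fun z => u z z - Real.log ‖h z z‖
  -- the potential at points outside the zero set, computed from any local data
  have hform : ∀ z w, ρ w ≠ 0 → ρ w = ‖a z w‖ * Real.exp (-u z w) →
      a z w = (∏ c ∈ Z, (w - c) ^ n c) * h z w →
      u z w - Real.log ‖h z w‖ = L w - Real.log (ρ w) := by
    intro z w h1 h2 h3
    have h4 : a z w ≠ 0 := by rintro h4; rw [h4] at h2; simp at h2; exact h1 h2
    have h5 := left_ne_zero_of_mul (h3 ▸ h4)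
    have h6 := right_ne_zero_of_mul (h3 ▸ h4)
    rw [h2, Real.log_mul (norm_ne_zero_iff.2 h4) (Real.exp_pos _).ne', Real.log_exp, h3, norm_mul,
      Real.log_mul (norm_ne_zero_iff.2 h5) (norm_ne_zero_iff.2 h6), hL w h5]
    ring
  have hpot : ∀ w ∈ closedBall (0 : ℂ) s, ρ w ≠ 0 → pot w = L w - Real.log (ρ w) :=
    fun w hw h1 => hform w w h1 (hρ w (hsub hw)).self_of_nhds (e w hw).self_of_nhds
  have hpotloc : ∀ z ∈ ball (0 : ℂ) s, pot =ᶠ[𝓝 z] fun w => u z w - Real.log ‖h z w‖ := by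
    intro z hz
    have hz' := ball_subset_closedBall hz
    filter_upwards [isOpen_ball.mem_nhds hz, hρ z (hsub hz'), e z hz',
      eventually_nhdsWithin_iff.1 (hV z hz')] with w hw h1 h2 h3
    by_cases hwz : w = z
    · subst hwz; rfl
    · rw [hform z w (h3 hwz) h1 h2]
      exact hpot w (ball_subset_closedBall hw) (h3 hwz)
  have hlog : ∀ z ∈ closedBall (0 : ℂ) s,
      InnerProductSpace.HarmonicAt (fun w => Real.log ‖h z w‖) z := fun z hz =>
    (hh z hz).harmonicAt_log_norm (hhz z hz)
  have hpotC : ∀ z ∈ ball (0 : ℂ) s, ContDiffAt ℝ 2 pot z := fun z hz =>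
    ((hu z (hsub (ball_subset_closedBall hz))).sub
      (hlog z (ball_subset_closedBall hz)).1).congr_of_eventuallyEq (hpotloc z hz)
  have hJ := discCurrent_of_potential (f := f) (η := η) (V := fun w => (pot w : ℂ)) (r := r) (R := s)
    (fun z hz => Complex.ofRealCLM.contDiff.contDiffAt.comp z (hpotC z hz)) (fun z hz => by
      have hz' := ball_subset_closedBall hz
      rw [hη z (hsub hz')]
      congr 1
      have e1 : (fun w => (pot w : ℂ)) =ᶠ[𝓝 z]
          (Complex.ofRealCLM ∘ u z) - (Complex.ofRealCLM ∘ fun w => Real.log ‖h z w‖) := by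
        filter_upwards [hpotloc z hz] with w hw
        simp [hw]
      rw [(InnerProductSpace.laplacian_congr_nhds e1).self_of_nhds,
        ContDiffAt.laplacian_sub (Complex.ofRealCLM.contDiff.contDiffAt.comp z (hu z (hsub hz')))
          (Complex.ofRealCLM.contDiff.contDiffAt.comp z (hlog z hz').1),
        ((hlog z hz').comp_CLM Complex.ofRealCLM).2.self_of_nhds]
      simp [Function.comp_def]) h0 hrs
  rw [circleAverage_ofReal, ← Complex.ofReal_sub] at hJ
  rw [hJ, Complex.ofReal_im, Complex.ofReal_re]
  refine ⟨rfl, ?_⟩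
  have hp0 := hpot 0 (mem_closedBall_self (h0.trans hrs).le) hρ0
  obtain ⟨hLi, hLm⟩ := le_circleAverage_sum_log Z n hZ0 h0
  have hpotcont : ContinuousOn pot (ball 0 s) := fun z hz =>
    (hpotC z hz).continuousAt.continuousWithinAt
  have hρnn : ∀ z ∈ ball (0 : ℂ) 1, 0 ≤ ρ z := fun z hz => by
    rw [(hρ z hz).self_of_nhds]; positivity
  have hsph : ∀ w ∈ sphere (0 : ℂ) r, w ∈ ball (0 : ℂ) s := fun w hw =>
    closedBall_subset_ball hrs (sphere_subset_closedBall hw)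
  -- comparison on the circle, away from finitely many points
  set L' : ℂ → ℝ := fun w => if w ∈ Z then pot w + Real.log C else L w
  -- Zeros on the circle give `L` a meaningless value, because the logarithm of 0 is 0 by
  -- convention. `L'` replaces it at these points by a value for which the comparison with `pot` is
  -- an equality; finitely many points do not affect the mean.
  have hLL' : Real.circleAverage L 0 r = Real.circleAverage L' 0 r ∧ CircleIntegrable L' 0 r := by
    have hcod : L =ᶠ[codiscreteWithin (sphere (0 : ℂ) |r|)] L' := by
      have h1 : ((Z : Set ℂ))ᶜ ∈ codiscreteWithin (sphere (0 : ℂ) |r|) :=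
        compl_finite_mem_codiscreteWithin Z.finite_toSet
      filter_upwards [h1] with w hw
      simp only [L']
      rw [if_neg (by simpa using hw)]
    exact ⟨Real.circleAverage_congr_codiscreteWithin hcod h0.ne', hLi.congr_codiscreteWithin hcod⟩
  have hmono : Real.circleAverage (fun w => L' w - Real.log C) 0 r ≤ Real.circleAverage pot 0 r := by
    refine Real.circleAverage_mono (hLL'.2.sub (circleIntegrable_const _ _ _)) ?_ fun w hw => ?_
    · exact (hpotcont.mono hsph).circleIntegrable h0.le
    · rw [abs_of_pos h0] at hw
      simp only [L']
      split_ifs with hwZ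
      · simp
      · have hws := ball_subset_closedBall (hsph w hw)
        have h1 : ρ w ≠ 0 := by
          intro h1
          have h2 := (e w hws).self_of_nhds
          rw [(hρzero w (hsub hws)).self_of_nhds.2 h1] at h2
          refine mul_ne_zero (Finset.prod_ne_zero_iff.2 fun c hc => pow_ne_zero _ ?_) (hhz w hws) h2.symm
          rw [sub_ne_zero]; rintro rfl; exact hwZ hc
        rw [hpot w hws h1]
        have := Real.log_le_log (lt_of_le_of_ne (hρnn w (hsub hws)) h1.symm) (hC w (hsub hws))
        linarith
  rw [Real.circleAverage_fun_sub hLL'.2 (circleIntegrable_const _ _ _), Real.circleAverage_const,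
    ← hLL'.1] at hmono
  -- The mean of `pot` is at least the mean of `L` minus log C, hence at least `L` 0 - log C, while
  -- `pot` at 0 is `L` 0 - log ρ(0).
  rw [hp0]
  have : L 0 ≤ Real.circleAverage L 0 r := hLm
  linarith

/-- The norm of the section of a metrised effective divisor, near a point of the cone. -/
theorem CartierDivisor.exists_local_norm {X : Set (PN N)} (hX : IsProjectiveVariety X)
    {E : CartierDivisor X} {η : Form11 N} (hη : E.IsChernForm η) :
    ∃ σ : Cn N → ℝ, (∀ v ∈ cone X, ∀ c : ℂ, c ≠ 0 → σ (c • v) = σ v) ∧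
      ∀ (v : Cn N) (h : v ≠ 0), Projectivization.mk ℂ v h ∈ X →
        ∃ (A B : Poly N) (U : Set (Cn N)) (u : Cn N → ℝ), IsOpen U ∧ v ∈ U ∧ ContDiffOn ℝ ∞ u U ∧
          (∀ v' ∈ U, v' ∈ cone X → MvPolynomial.eval (fun i => v' i) B ≠ 0 ∧
            σ v' = ‖MvPolynomial.eval (fun i => v' i) A / MvPolynomial.eval (fun i => v' i) B‖ *
              Real.exp (-u v')) ∧
          IsDdc X U (fun v' => (u v' : ℂ)) η ∧
          (σ v = 0 → Projectivization.mk ℂ v h ∈ E.support) := by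
  obtain ⟨ρ, hρ⟩ := hη
  refine ⟨coneFun ρ, fun v hv c hc => ?_, fun v h hvX => ?_⟩
  · rw [coneFun, coneFun, dif_neg (smul_ne_zero hc hv.1), dif_neg hv.1, mk_smul_eq hv.1]
  · obtain ⟨A, B, U, u, hreg, hU, hvU, hu, hloc, hdd⟩ := hρ v h hvX
    have hreg' := hreg
    obtain ⟨d, hA, hB, hB0, -⟩ := hreg
    have hmain : ∀ v' ∈ U, v' ∈ cone X → MvPolynomial.eval (fun i => v' i) B ≠ 0 ∧
            coneFun ρ v' =
              ‖MvPolynomial.eval (fun i => v' i) A / MvPolynomial.eval (fun i => v' i) B‖ *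
              Real.exp (-u v') := by
      rintro v' hv' ⟨h', hX'⟩
      obtain ⟨h1, h2⟩ := hloc v' hv' h' hX'
      obtain ⟨c, hc, e⟩ := rep_mk v' h'
      refine ⟨fun h3 => h1 ((pval_mk_eq_zero_iff hB h').2 h3), ?_⟩
      rw [coneFun, dif_neg h', h2, pval_mk hA h' e, pval_mk hB h' e,
        mul_div_mul_left _ _ (pow_ne_zero d hc)]
    refine ⟨A, B, U, u, hU, hvU, hu, hmain, hdd, fun h0 => ?_⟩
    by_contra hns
    have h1 := hreg'.pval_ne_zero hX hvX hns
    obtain ⟨h2, h3⟩ := hmain v hvU ⟨h, hvX⟩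
    rw [h0, eq_comm, mul_eq_zero, norm_eq_zero, div_eq_zero_iff] at h3
    rcases h3 with (h3 | h3) | h3
    · exact h1 ((pval_mk_eq_zero_iff hA h).2 h3)
    · exact h2 h3
    · exact (Real.exp_pos _).ne' h3

/-- The currents of discs whose centres stay away from the support of an effective divisor are
bounded from below on the Chern form of the divisor. -/
theorem CartierDivisor.exists_lower_bound {X : Set (PN N)} (hX : IsProjectiveVariety X)
    {E : CartierDivisor X} {η : Form11 N} (hη : E.IsChernForm η) {ε : ℝ} (hε : 0 < ε) :
    ∃ C, ∀ f : ℂ → PN N, IsHolDisc X f → (∀ q ∈ E.support, ε ≤ pdist (f 0) q) →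
      ∀ r, 0 < r → r < 1 → (discCurrent f r η).im = 0 ∧ C ≤ (discCurrent f r η).re := by
  obtain ⟨σ, hhom, hloc⟩ := E.exists_local_norm hX hη
  have hcont : ContinuousOn σ (cone X) := by
    rintro v ⟨hv, hvX⟩
    obtain ⟨A, B, U, u, hU, hvU, hu, hmain, -, -⟩ := hloc v hv hvX
    obtain ⟨h1, h2⟩ := hmain v hvU ⟨hv, hvX⟩
    have hc : ContinuousAt (fun v' : Cn N => ‖MvPolynomial.eval (fun i => v' i) A /
        MvPolynomial.eval (fun i => v' i) B‖ * Real.exp (-u v')) v := by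
      refine ContinuousAt.mul (ContinuousAt.norm (ContinuousAt.div ?_ ?_ h1)) ?_
      · exact (continuous_eval_coord A).continuousAt
      · exact (continuous_eval_coord B).continuousAt
      · exact (Real.continuous_exp.continuousAt).comp
          (hu.continuousOn.continuousAt (hU.mem_nhds hvU)).neg
    refine hc.continuousWithinAt.congr_of_eventuallyEq ?_ h2
    filter_upwards [nhdsWithin_le_nhds (hU.mem_nhds hvU), self_mem_nhdsWithin] with v' h3 h4
    exact (hmain v' h3 h4).2
  have hnn : ∀ v ∈ cone X, 0 ≤ σ v := by
    rintro v ⟨hv, hvX⟩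
    obtain ⟨A, B, U, u, hU, hvU, hu, hmain, -, -⟩ := hloc v hv hvX
    rw [(hmain v hvU ⟨hv, hvX⟩).2]
    positivity
  obtain ⟨C1, hC1⟩ := exists_bound_of_homog hX.closed hcont hhom
  -- lower bound away from the support
  have hlow : ∃ c2 > 0, ∀ (v : Cn N) (h : v ≠ 0), Projectivization.mk ℂ v h ∈ X →
      (∀ q ∈ E.support, ε ≤ pdist (Projectivization.mk ℂ v h) q) → c2 ≤ σ v := by
    -- Otherwise unit vectors with σ → 0 accumulate at a zero of σ, which lies over the support,
    -- contrary to the distance `ε`.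
    by_contra! hcon
    choose v hv hvX hvq hvσ using fun n : ℕ => hcon (1 / ((n : ℝ) + 1)) (by positivity)
    set w : ℕ → Cn N := fun n => ((‖v n‖⁻¹ : ℝ) : ℂ) • v n
    have hvc : ∀ n, v n ∈ cone X := fun n => ⟨hv n, hvX n⟩
    have hc0 : ∀ n, ((‖v n‖⁻¹ : ℝ) : ℂ) ≠ 0 := fun n => by
      exact_mod_cast inv_ne_zero (norm_ne_zero_iff.2 (hv n))
    obtain ⟨w', hw', χ, hχ, hlim⟩ := (isCompact_cone_sphere hX.closed).tendsto_subseq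
      (x := w) fun n => normalize_mem (hvc n)
    obtain ⟨hw0, hwX⟩ := hw'.1
    have hσ0 : Tendsto (fun n => σ (w (χ n))) atTop (𝓝 0) := by
      refine squeeze_zero (fun n => hnn _ (normalize_mem (hvc _)).1) (fun n => ?_)
        (tendsto_one_div_add_atTop_nhds_zero_nat.comp hχ.tendsto_atTop)
      simp only [w]
      rw [hhom _ (hvc _) _ (hc0 _)]
      exact (hvσ _).le
    have hσw : σ w' = 0 := tendsto_nhds_unique
      ((hcont w' hw'.1).tendsto.comp (tendsto_nhdsWithin_iff.2 ⟨hlim,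
        Eventually.of_forall fun n => (normalize_mem (hvc _)).1⟩)) hσ0
    obtain ⟨-, -, -, -, -, -, -, -, -, hs⟩ := hloc w' hw0 hwX
    have hpt : PTendsto (fun n => Projectivization.mk ℂ (v (χ n)) (hv _)) atTop
        (Projectivization.mk ℂ w' hw0) :=
      pTendsto_mk hw0 (Eventually.of_forall fun n =>
        ⟨smul_ne_zero (hc0 _) (hv _), (mk_smul_eq (hv _) _).symm⟩) hlim
    obtain ⟨n, hn⟩ := (hpt.lt hε).exists
    exact absurd (hvq (χ n) _ (hs hσw)) (not_le.2 hn)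
  obtain ⟨c2, hc2, hlow⟩ := hlow
  refine ⟨Real.log c2 - Real.log C1, fun f hf hfq r h0 hr => ?_⟩
  have hlift : ∀ z ∈ ball (0 : ℂ) 1, ∃ F, IsLift f z F := fun z hz => (hf z hz).1
  choose! F hF using hlift
  have hFX : ∀ z ∈ ball (0 : ℂ) 1, IsGermIn X (F z) z := fun z hz =>
    (hF z hz).isGermIn (hf.eventually_mem hz)
  have hdata : ∀ z ∈ ball (0 : ℂ) 1, ∃ (A B : Poly N) (U : Set (Cn N)) (u : Cn N → ℝ),
      IsOpen U ∧ F z z ∈ U ∧ ContDiffOn ℝ ∞ u U ∧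
          (∀ v' ∈ U, v' ∈ cone X → MvPolynomial.eval (fun i => v' i) B ≠ 0 ∧
            σ v' = ‖MvPolynomial.eval (fun i => v' i) A / MvPolynomial.eval (fun i => v' i) B‖ *
              Real.exp (-u v')) ∧ IsDdc X U (fun v' => (u v' : ℂ)) η := by
    intro z hz
    obtain ⟨h, hX'⟩ := (hFX z hz).mem_cone
    obtain ⟨A, B, U, u, hU, hvU, hu, hmain, hdd, -⟩ := hloc _ h hX'
    exact ⟨A, B, U, u, hU, hvU, hu, hmain, hdd⟩
  choose! A B U u hU hvU hu hmain hdd using hdata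
  set ρ : ℂ → ℝ := fun w => σ (f w).rep
  have hρF : ∀ w, ∀ G : Cn N, (∃ h : G ≠ 0, f w = Projectivization.mk ℂ G h) → f w ∈ X →
      ρ w = σ G := by
    rintro w G ⟨h, e⟩ hX'
    obtain ⟨c, hc, e1⟩ := rep_mk G h
    simp only [ρ]
    rw [e, e1]
    exact hhom G ⟨h, e ▸ hX'⟩ c hc
  have hev : ∀ (P : Poly N) (z : ℂ), z ∈ ball (0 : ℂ) 1 →
      AnalyticAt ℂ (fun w => MvPolynomial.eval (fun i => F z w i) P) z := by
    intro P z hz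
    have := (AnalyticOnNhd.eval_mvPolynomial (𝕜 := ℂ) P) (fun i => F z z i) (mem_univ _)
    exact this.fun_comp (f := fun w i => F z w i) (AnalyticAt.pi fun i => analyticAt_coord (hF z hz).1 i)
  have hres := le_discCurrent_of_local (f := f) (η := η) (ρ := ρ)
    (a := fun z w => MvPolynomial.eval (fun i => F z w i) (A z) /
      MvPolynomial.eval (fun i => F z w i) (B z)) (u := fun z w => u z (F z w)) (C := C1) (r := r)
    (fun z hz => (hev _ z hz).div (hev _ z hz) (hmain z hz _ (hvU z hz) (hFX z hz).mem_cone).1)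
    (fun z hz => by
      have h1 : ContDiffAt ℝ 2 (F z) z := ((hF z hz).1.contDiffAt (n := 2)).restrict_scalars ℝ
      have h2 : ContDiffAt ℝ 2 (u z) (F z z) :=
        ((hu z hz).contDiffAt ((hU z hz).mem_nhds (hvU z hz))).of_le (WithTop.coe_le_coe.2 le_top)
      exact h2.comp z h1)
    (fun z hz => by
      filter_upwards [(hF z hz).1.continuousAt.eventually ((hU z hz).mem_nhds (hvU z hz)),
        (hFX z hz).2, (hF z hz).2, hf.eventually_mem hz] with w h1 h2 h3 h4
      rw [hρF w _ h3 h4]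
      exact (hmain z hz _ h1 h2).2)
    (fun z hz => by
      rw [pullDens_eq η (hF z hz)]
      exact hdd z hz (F z) z (hFX z hz) (hvU z hz))
    (fun z hz => by
      have h1 : (f z).rep ∈ cone X := ⟨(f z).rep_nonzero, by rw [(f z).mk_rep]; exact (hf z hz).2⟩
      exact (le_abs_self _).trans (hC1 _ h1)) ?_ h0 hr
  · have h2 : c2 ≤ ρ 0 := hlow (f 0).rep (f 0).rep_nonzero
      (by rw [(f 0).mk_rep]; exact (hf 0 (mem_ball_self one_pos)).2) (by rwa [(f 0).mk_rep])
    exact ⟨hres.1, (sub_le_sub_right (Real.log_le_log hc2 h2) _).trans hres.2⟩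
  · have h2 : c2 ≤ ρ 0 := hlow (f 0).rep (f 0).rep_nonzero
      (by rw [(f 0).mk_rep]; exact (hf 0 (mem_ball_self one_pos)).2) (by rwa [(f 0).mk_rep])
    exact (hc2.trans_le h2).ne'

/-! ### Normalised currents and their limits -/

/-- The degree need not be monotone in the radius, since the Chern form of the metric need not be
positive; monotonicity up to a constant is enough. -/
theorem tendsto_discDegree_of_le {X : Set (PN N)} (hX : IsZariskiClosed X) {k : ℕ} (hk : 0 < k)
    {m : Cn N → ℝ} (hm : IsMetricO1 X m) {ηH : Form11 N} (hηH : IsAmpleChernForm X k m ηH)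
    {g : ℕ → ℂ → PN N} (hg : ∀ n, IsHolDisc X (g n)) {s r : ℝ} (hs : 0 < s) (hsr : s ≤ r)
    (hr : r < 1) (hdeg : Tendsto (fun n => discDegree ηH (g n) s) atTop atTop) :
    Tendsto (fun n => discDegree ηH (g n) r) atTop atTop := by
  obtain ⟨C, hC0, hC⟩ := exists_degree_estimates hX hk hm hηH
  have hk' : (0 : ℝ) < k := by exact_mod_cast hk
  refine tendsto_atTop_mono (fun n => ?_) (tendsto_atTop_add_const_right atTop (-(C / k)) hdeg)
  have h1 := (hC (g n) (hg n) r (hs.trans_le hsr) hr).2 s hs hsr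
  have h2 : C = k * (C / k) := by field_simp
  have h3 : (k : ℝ) * (discDegree ηH (g n) s + -(C / k)) ≤ k * discDegree ηH (g n) r := by
    rw [mul_add, mul_neg, ← h2]; linarith
  exact le_of_mul_le_mul_left h3 hk'

theorem eventually_norm_normalized_le {X : Set (PN N)} (hX : IsZariskiClosed X) {k : ℕ}
    (hk : 0 < k) {m : Cn N → ℝ} (hm : IsMetricO1 X m) {ηH : Form11 N}
    (hηH : IsAmpleChernForm X k m ηH) {g : ℕ → ℂ → PN N} (hg : ∀ n, IsHolDisc X (g n)) {r : ℝ}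
    (h0 : 0 < r) (hr : r < 1) (hdeg : Tendsto (fun n => discDegree ηH (g n) r) atTop atTop) :
    ∃ K : ℝ, ∀ᶠ n in atTop, ∀ (η : Form11 N) (M : ℝ), (∀ v : Cn N, ‖v‖ = 1 → ‖η.1 v‖ ≤ M) →
      ‖discCurrent (g n) r η / (discDegree ηH (g n) r : ℂ)‖ ≤ K * M := by
  obtain ⟨C, hC0, hC⟩ := exists_degree_estimates hX hk hm hηH
  refine ⟨(N + 1) ^ 2 * Real.pi * (k + 1), ?_⟩
  filter_upwards [hdeg.eventually_ge_atTop (max C 1)] with n hn η M hM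
  have hM0 : 0 ≤ M := by
    obtain ⟨v, h, hv, -⟩ := exists_unit_rep (g n 0)
    exact (norm_nonneg _).trans (hM v hv)
  have h1 : C ≤ discDegree ηH (g n) r := (le_max_left _ _).trans hn
  have h2 : 1 ≤ discDegree ηH (g n) r := (le_max_right _ _).trans hn
  have hpi := Real.pi_pos
  rw [norm_div, Complex.norm_real, Real.norm_of_nonneg (by linarith), div_le_iff₀ (by linarith)]
  refine ((hC (g n) (hg n) r h0 hr).1 η M hM).trans ?_
  calc _ ≤ ((N + 1) ^ 2 * Real.pi * M) * (k * discDegree ηH (g n) r + discDegree ηH (g n) r) := by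
        gcongr
    _ = _ := by ring

/-- Existence of weakly convergent subsequences of normalised currents. -/
theorem exists_isWeakLimit {X : Set (PN N)} (hX : IsZariskiClosed X) {k : ℕ}
    (hk : 0 < k) {m : Cn N → ℝ} (hm : IsMetricO1 X m) {ηH : Form11 N}
    (hηH : IsAmpleChernForm X k m ηH) {g : ℕ → ℂ → PN N} (hg : ∀ n, IsHolDisc X (g n)) {r : ℝ}
    (h0 : 0 < r) (hr : r < 1) (hdeg : Tendsto (fun n => discDegree ηH (g n) r) atTop atTop) :
    ∃ (χ : ℕ → ℕ) (T : A11 X →ₗ[ℂ] ℂ), StrictMono χ ∧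
      IsWeakLimit X ηH (fun n => g (χ n)) r T := by
  obtain ⟨K, hK⟩ := eventually_norm_normalized_le hX hk hm hηH hg h0 hr hdeg
  set L : ℕ → Form11 N →ₗ[ℂ] ℂ := fun n =>
    ((discDegree ηH (g n) r : ℂ)⁻¹) • discCurrentLinear (hg n) h0 hr
  have hL : ∀ n η, L n η = discCurrent (g n) r η / (discDegree ηH (g n) r : ℂ) := fun n η => by
    simp only [L, LinearMap.smul_apply, smul_eq_mul]
    rw [div_eq_inv_mul]; rfl
  obtain ⟨χ, T, hχ, hT⟩ := exists_weak_limit (L := L) (K := K) (by simpa only [hL] using hK)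
  -- Each disc lies in X, so its current kills forms that restrict to zero, and the limit descends
  -- to the quotient.
  have hT0 : vanishingOn X ≤ LinearMap.ker T := fun η hη => by
    rw [LinearMap.mem_ker]
    refine tendsto_nhds_unique (hT η) ?_
    simp only [hL, discCurrent_eq_zero_of_mem_vanishingOn (hg _) h0 hr hη, zero_div]
    exact tendsto_const_nhds
  refine ⟨χ, (vanishingOn X).liftQ T hT0, hχ, fun η => ?_⟩
  have := hT η
  simp only [hL] at this
  exact this

theorem IsWeakLimit.isCurrent {X : Set (PN N)} (hX : IsZariskiClosed X) {k : ℕ}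
    (hk : 0 < k) {m : Cn N → ℝ} (hm : IsMetricO1 X m) {ηH : Form11 N}
    (hηH : IsAmpleChernForm X k m ηH) {g : ℕ → ℂ → PN N} (hg : ∀ n, IsHolDisc X (g n)) {r : ℝ}
    (h0 : 0 < r) (hr : r < 1) (hdeg : Tendsto (fun n => discDegree ηH (g n) r) atTop atTop)
    {T : A11 X →ₗ[ℂ] ℂ} (hT : IsWeakLimit X ηH g r T) : IsCurrent T := by
  obtain ⟨K, hK⟩ := eventually_norm_normalized_le hX hk hm hηH hg h0 hr hdeg
  refine ⟨0, K, fun η M hM => ?_⟩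
  refine le_of_tendsto (hT η).norm (hK.mono fun n hn => hn η M fun v hv => ?_)
  simpa using hM 0 le_rfl v hv

/-- A fixed lower bound, possibly negative, tends to 0 after division by the degrees. Positivity
uses it with bound 0, intersection numbers with the bound from the Jensen formula. -/
theorem IsWeakLimit.nonneg_of_lower_bound {X : Set (PN N)} {ηH : Form11 N} {g : ℕ → ℂ → PN N}
    {r : ℝ} (hdeg : Tendsto (fun n => discDegree ηH (g n) r) atTop atTop) {T : A11 X →ₗ[ℂ] ℂ}
    (hT : IsWeakLimit X ηH g r T) {η : Form11 N} {C : ℝ}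
    (h : ∀ n, (discCurrent (g n) r η).im = 0 ∧ C ≤ (discCurrent (g n) r η).re) :
    (T (res X η)).im = 0 ∧ 0 ≤ (T (res X η)).re := by
  constructor
  · refine tendsto_nhds_unique ((Complex.continuous_im.tendsto _).comp (hT η)) ?_
    refine tendsto_const_nhds.congr fun n => ?_
    simp [Function.comp, (h n).1]
  · have h1 : Tendsto (fun n => C / discDegree ηH (g n) r) atTop (𝓝 0) :=
      tendsto_const_nhds.div_atTop hdeg
    refine le_of_tendsto_of_tendsto h1 ((Complex.continuous_re.tendsto _).comp (hT η)) ?_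
    filter_upwards [hdeg.eventually_gt_atTop 0] with n hn
    simp only [Function.comp, Complex.div_ofReal_re]
    exact div_le_div_of_nonneg_right (h n).2 hn.le

theorem IsWeakLimit.isPositive {X : Set (PN N)} {ηH : Form11 N} {g : ℕ → ℂ → PN N}
    (hg : ∀ n, IsHolDisc X (g n)) {r : ℝ} (h0 : 0 < r) (hr : r < 1)
    (hdeg : Tendsto (fun n => discDegree ηH (g n) r) atTop atTop) {T : A11 X →ₗ[ℂ] ℂ}
    (hT : IsWeakLimit X ηH g r T) : IsPositive T := by
  refine fun η hη => hT.nonneg_of_lower_bound hdeg fun n => radialInt_nonneg h0.le fun z hz => ?_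
  have hz' := closedBall_subset_ball hr hz
  obtain ⟨F, hF⟩ := (hg n z hz').1
  rw [pullDens_eq η hF]
  exact hη F z (hF.isGermIn ((hg n).eventually_mem hz'))

theorem IsWeakLimit.isHarmonic {X : Set (PN N)} (hX : IsZariskiClosed X) {ηH : Form11 N}
    {g : ℕ → ℂ → PN N} (hg : ∀ n, IsHolDisc X (g n)) {r : ℝ} (h0 : 0 < r) (hr : r < 1)
    (hdeg : Tendsto (fun n => discDegree ηH (g n) r) atTop atTop) {T : A11 X →ₗ[ℂ] ℂ}
    (hT : IsWeakLimit X ηH g r T) : IsHarmonic T := by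
  intro φ η hφ hη
  obtain ⟨C, hC⟩ := exists_bound_of_homog hX (SmoothOnCone.continuousOn hφ) (fun v hv c hc => by
    rw [coneFun, coneFun, dif_neg (smul_ne_zero hc hv.1), dif_neg hv.1, mk_smul_eq hv.1])
  -- By the Jensen formula the value is a mean of φ over a circle minus a value of φ, and φ is
  -- bounded on X.
  have hbd : ∀ n, ‖discCurrent (g n) r η‖ ≤ C + C := by
    intro n
    obtain ⟨s, hrs, hs⟩ := exists_between hr
    obtain ⟨F, hF⟩ := exists_lift (fun z hz => (hg n z hz).1) hs
    have hcone : ∀ z ∈ closedBall (0 : ℂ) s, F z ∈ cone X := fun z hz =>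
      ((hF z hz).isGermIn ((hg n).eventually_mem (closedBall_subset_ball hs hz))).mem_cone
    rw [discCurrent_of_isDdc hφ hη (hg n) hs hF h0 hrs]
    refine (norm_sub_le _ _).trans (add_le_add ?_ (hC _ (hcone 0 (mem_closedBall_self
      (h0.trans hrs).le))))
    have hpi := Real.pi_pos
    rw [Real.circleAverage, norm_smul, Real.norm_of_nonneg (by positivity),
      inv_mul_le_iff₀ (by positivity), mul_comm _ C]
    have := intervalIntegral.norm_integral_le_of_norm_le_const (a := 0) (b := 2 * Real.pi)
      (f := fun θ => coneFun φ (F (circleMap 0 r θ))) (C := C) fun θ _ => hC _ (hcone _ ?_)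
    · rwa [sub_zero, abs_of_pos (by positivity)] at this
    · exact closedBall_subset_closedBall hrs.le (sphere_subset_closedBall
        (circleMap_mem_sphere 0 h0.le θ))
  refine tendsto_nhds_unique (hT η) ?_
  refine squeeze_zero_norm' (a := fun n => (C + C) / discDegree ηH (g n) r) ?_
    (tendsto_const_nhds.div_atTop hdeg)
  filter_upwards [hdeg.eventually_gt_atTop 0] with n hn
  rw [norm_div, Complex.norm_real, Real.norm_of_nonneg hn.le]
  exact div_le_div_of_nonneg_right (hbd n) hn.le

theorem IsWeakLimit.intersection_nonneg {X : Set (PN N)} (hX : IsProjectiveVariety X)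
    {ηH : Form11 N} {g : ℕ → ℂ → PN N} (hg : ∀ n, IsHolDisc X (g n)) {r : ℝ} (h0 : 0 < r)
    (hr : r < 1) (hdeg : Tendsto (fun n => discDegree ηH (g n) r) atTop atTop)
    {T : A11 X →ₗ[ℂ] ℂ} (hT : IsWeakLimit X ηH g r T) {Z : Set (PN N)} {ε : ℝ} (hε : 0 < ε)
    (hZ : ∀ n, ∀ q ∈ Z, ε ≤ pdist (g n 0) q) {F : QCartierDivisor X} (hF : F.support ⊆ Z) {c : ℂ}
    (hc : IsIntersectionNumber T F c) : c.im = 0 ∧ 0 ≤ c.re := by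
  obtain ⟨η, hη, rfl⟩ := hc
  obtain ⟨C, hC⟩ := F.num.exists_lower_bound hX hη hε
  obtain ⟨h1, h2⟩ := hT.nonneg_of_lower_bound hdeg (η := η) (C := C)
    fun n => hC (g n) (hg n) (fun q hq => hZ n q (hF hq)) r h0 hr
  rw [show (F.mult : ℂ) = ((F.mult : ℝ) : ℂ) by simp, Complex.div_ofReal_im, Complex.div_ofReal_re,
    h1, zero_div]
  exact ⟨rfl, div_nonneg h2 (Nat.cast_nonneg _)⟩

/-! ### Continuous convergence along an ultrafilter -/

/-- The maps `h n` converge continuously at `c` to the value `v`, along `U`. -/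
def CTendsto {E : Type*} [TopologicalSpace E] (h : ℕ → ℂ → E) (U : Ultrafilter ℕ) (c : ℂ)
    (v : E) : Prop :=
  ∀ z : ℕ → ℂ, Tendsto z U (𝓝 c) → Tendsto (fun n => h n (z n)) U (𝓝 v)

/-- For each `n` a solution of `P n` is chosen whose distance to `c` is within 1/(n+1) of the
infimum; this one choice works for all `ε`. -/
theorem exists_seq_tendsto {U : Ultrafilter ℕ} (hU : (U : Filter ℕ) ≤ atTop) {E : Type*}
    [PseudoMetricSpace E] {P : ℕ → E → Prop} {c : E}
    (h : ∀ ε > 0, ∀ᶠ n in (U : Filter ℕ), ∃ z, dist z c < ε ∧ P n z) :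
    ∃ z : ℕ → E, Tendsto z U (𝓝 c) ∧ ∀ᶠ n in (U : Filter ℕ), P n (z n) := by
  set d : ℕ → ℝ := fun n => sInf ((fun z => dist z c) '' {z | P n z})
  have key : ∀ n, ∃ z, (∃ z', P n z') → P n z ∧ dist z c < d n + 1 / ((n : ℝ) + 1) := by
    intro n
    by_cases hn : ∃ z', P n z'
    · have hne : ((fun z => dist z c) '' {z | P n z}).Nonempty := hn.imp' _ fun z hz => ⟨z, hz, rfl⟩
      obtain ⟨_, ⟨z, hz, rfl⟩, hlt⟩ := exists_lt_of_csInf_lt hne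
        (lt_add_of_pos_right (d n) (by positivity : (0 : ℝ) < 1 / ((n : ℝ) + 1)))
      exact ⟨z, fun _ => ⟨hz, hlt⟩⟩
    · exact ⟨c, fun h => absurd h hn⟩
  choose z hz using key
  refine ⟨z, ?_, ?_⟩
  · refine Metric.tendsto_nhds.2 fun ε hε => ?_
    have h1 : ∀ᶠ n : ℕ in (U : Filter ℕ), 1 / ((n : ℝ) + 1) < ε / 2 :=
      hU ((tendsto_one_div_add_atTop_nhds_zero_nat (𝕜 := ℝ)).eventually_lt_const (by positivity))
    filter_upwards [h (ε / 2) (by positivity), h1] with n h2 h4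
    obtain ⟨z', h2, h3⟩ := h2
    have h5 : d n ≤ dist z' c :=
      csInf_le ⟨0, by rintro _ ⟨x, -, rfl⟩; exact dist_nonneg⟩ ⟨z', h3, rfl⟩
    have := (hz n ⟨z', h3⟩).2
    linarith
  · filter_upwards [h 1 one_pos] with n ⟨z', _, h3⟩ using (hz n ⟨z', h3⟩).1

theorem exists_mem_sphere_norm_le {E : Type*} [NormedAddCommGroup E] [NormedSpace ℂ E]
    {g : ℂ → E} {c : ℂ} {r ρ : ℝ} (hr : 0 < r)
    (hρ : r < ρ) (hg : DifferentiableOn ℂ g (ball c ρ)) :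
    ∃ ζ ∈ sphere c r, ∀ z ∈ closedBall c r, ‖g z‖ ≤ ‖g ζ‖ := by
  have hd : DiffContOnCl ℂ g (ball c r) := by
    refine DifferentiableOn.diffContOnCl ?_
    rw [closure_ball _ hr.ne']
    exact hg.mono (closedBall_subset_ball hρ)
  obtain ⟨ζ, hζ, hmax⟩ := Complex.exists_mem_frontier_isMaxOn_norm isBounded_ball
    ⟨c, mem_ball_self hr⟩ hd
  rw [frontier_ball _ hr.ne'] at hζ
  rw [closure_ball _ hr.ne'] at hmax
  exact ⟨ζ, hζ, fun z hz => hmax hz⟩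

theorem exists_seq_mem_sphere_norm_le {E : Type*} [NormedAddCommGroup E] [NormedSpace ℂ E]
    {U : Ultrafilter ℕ} {g : ℕ → ℂ → E} {c : ℂ} {r ρ : ℝ}
    (hr : 0 < r) (hρ : r < ρ) (hg : ∀ᶠ n in (U : Filter ℕ), DifferentiableOn ℂ (g n) (ball c ρ)) :
    ∃ (ζ : ℕ → ℂ), ∃ ζ' ∈ sphere c r, Tendsto ζ U (𝓝 ζ') ∧
      ∀ᶠ n in (U : Filter ℕ), ∀ z ∈ closedBall c r, ‖g n z‖ ≤ ‖g n (ζ n)‖ := by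
  have key : ∀ n, ∃ ζ, DifferentiableOn ℂ (g n) (ball c ρ) →
      ζ ∈ sphere c r ∧ ∀ z ∈ closedBall c r, ‖g n z‖ ≤ ‖g n ζ‖ := by
    intro n
    by_cases h : DifferentiableOn ℂ (g n) (ball c ρ)
    · obtain ⟨ζ, h1, h2⟩ := exists_mem_sphere_norm_le hr hρ h
      exact ⟨ζ, fun _ => ⟨h1, h2⟩⟩
    · exact ⟨c, fun h' => absurd h' h⟩
  choose ζ hζ using key
  obtain ⟨ζ', h1, h2⟩ := exists_tendsto_of_eventually_mem (isCompact_sphere c r) U (v := ζ)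
    (hg.mono fun n hn => (hζ n hn).1)
  exact ⟨ζ, ζ', h1, h2, hg.mono fun n hn => (hζ n hn).2⟩

/-! ### Zeros of convergent sequences of holomorphic functions -/

/-- Hurwitz's theorem. -/
theorem exists_zero_of_cTendsto {U : Ultrafilter ℕ} {h : ℕ → ℂ → ℂ} {c : ℂ} {ρ : ℝ} (hρ : 0 < ρ)
    (hd : ∀ᶠ n in (U : Filter ℕ), DifferentiableOn ℂ (h n) (ball c ρ)) {k : ℂ → ℂ}
    (hc : ∀ w ∈ ball c ρ, CTendsto h U w (k w)) (h0 : k c = 0) (hk : ∀ᶠ w in 𝓝[≠] c, k w ≠ 0)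
    {ε : ℝ} (hε : 0 < ε) : ∀ᶠ n in (U : Filter ℕ), ∃ z, dist z c < ε ∧ h n z = 0 := by
  by_contra hcon
  rw [← Ultrafilter.eventually_not] at hcon
  obtain ⟨δ, hδ, hk⟩ := Metric.eventually_nhds_iff.1 (eventually_nhdsWithin_iff.1 hk)
  set σ := min (min ρ ε) δ
  have hσ : 0 < σ := by positivity
  have hσρ : σ ≤ ρ := (min_le_left _ _).trans (min_le_left _ _)
  have hσε : σ ≤ ε := (min_le_left _ _).trans (min_le_right _ _)
  -- Without zeros the inverse is holomorphic, and the maximum principle bounds its value at `c` by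
  -- one on a circle. There |h n| would be at most |h n c|, which tends to 0, so `k` would vanish on
  -- the circle.
  have hinv : ∀ᶠ n in (U : Filter ℕ), DifferentiableOn ℂ (fun z => (h n z)⁻¹) (ball c σ) := by
    filter_upwards [hd, hcon] with n h1 h2
    refine (h1.mono (ball_subset_ball hσρ)).inv fun z hz => ?_
    exact fun h3 => h2 ⟨z, (mem_ball.1 hz).trans_le hσε, h3⟩
  obtain ⟨ζ, ζ', hζ', hζ, hle⟩ := exists_seq_mem_sphere_norm_le (half_pos hσ) (half_lt_self hσ) hinv
  have hζb : dist ζ' c < σ := by rw [mem_sphere.1 hζ']; exact half_lt_self hσ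
  have h1 : Tendsto (fun n => ‖h n (ζ n)‖) U (𝓝 ‖k ζ'‖) :=
    (hc ζ' (mem_ball.2 (hζb.trans_le hσρ)) ζ hζ).norm
  have h2 : Tendsto (fun n => ‖h n c‖) U (𝓝 ‖k c‖) :=
    (hc c (mem_ball_self hρ) _ tendsto_const_nhds).norm
  rw [h0, norm_zero] at h2
  have h3 : ‖k ζ'‖ ≤ 0 := by
    refine le_of_tendsto_of_tendsto h1 h2 ?_
    filter_upwards [hle, hcon] with n h3 h4
    have h5 := h3 c (mem_closedBall_self (half_pos hσ).le)
    rw [norm_inv, norm_inv] at h5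
    have h6 : 0 < ‖h n c‖ := norm_pos_iff.2 fun h7 => h4 ⟨c, by simpa using hε, h7⟩
    by_contra! h7
    have h8 := inv_strictAnti₀ h6 h7
    linarith
  refine hk (hζb.trans_le (min_le_right _ _)) ?_ (norm_le_zero_iff.1 h3)
  rintro rfl
  simp at hζ'
  linarith

/-- Hurwitz's theorem supplies one zero near `c`; dividing by it lowers the order of the limit, and
induction splits off all `m` zeros. What remains converges to a unit. -/
theorem exists_factorization {U : Ultrafilter ℕ} (hU : (U : Filter ℕ) ≤ atTop) (m : ℕ) :
    ∀ {h : ℕ → ℂ → ℂ} {k : ℂ → ℂ} {c : ℂ} {ρ : ℝ}, 0 < ρ →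
    (∀ᶠ n in (U : Filter ℕ), DifferentiableOn ℂ (h n) (ball c ρ)) →
    DifferentiableOn ℂ k (ball c ρ) → k c ≠ 0 →
    (∀ w ∈ ball c ρ, CTendsto h U w ((w - c) ^ m * k w)) →
    ∃ (a : Fin m → ℕ → ℂ) (u : ℕ → ℂ → ℂ), (∀ i, Tendsto (a i) U (𝓝 c)) ∧ CTendsto u U c (k c) ∧
      ∀ᶠ n in (U : Filter ℕ), ∀ z, h n z = (∏ i, (z - a i n)) * u n z := by
  induction m with
  | zero =>
    intro h k c ρ hρ _ _ _ hc
    exact ⟨fun i => i.elim0, h, fun i => i.elim0, by simpa using hc c (mem_ball_self hρ), by simp⟩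
  | succ m ih =>
    intro h k c ρ hρ hd hk hk0 hc
    have hkc : ContinuousAt k c := hk.continuousOn.continuousAt (ball_mem_nhds c hρ)
    obtain ⟨a, ha, hz⟩ := exists_seq_tendsto hU fun ε hε =>
      exists_zero_of_cTendsto hρ hd hc (by simp) (by
        filter_upwards [nhdsWithin_le_nhds (hkc.eventually_ne hk0), self_mem_nhdsWithin] with w h1 h2
        exact mul_ne_zero (pow_ne_zero _ (sub_ne_zero.2 h2)) h1) hε
    set h' : ℕ → ℂ → ℂ := fun n => dslope (h n) (a n)
    have hne : ∀ w ∈ ball c ρ, w ≠ c → CTendsto h' U w ((w - c) ^ m * k w) := by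
      intro w hw hwc z hzw
      have h1 : Tendsto (fun n => (z n - a n)⁻¹ * h n (z n)) U
          (𝓝 ((w - c)⁻¹ * ((w - c) ^ (m + 1) * k w))) :=
        ((hzw.sub ha).inv₀ (sub_ne_zero.2 hwc)).mul (hc w hw z hzw)
      have e : (w - c)⁻¹ * ((w - c) ^ (m + 1) * k w) = (w - c) ^ m * k w := by
        have := sub_ne_zero.2 hwc
        field_simp
        ring
      rw [e] at h1
      refine h1.congr' ?_
      filter_upwards [(hzw.sub ha).eventually_ne (sub_ne_zero.2 hwc), hz] with n h2 h3
      simp only [h']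
      rw [dslope_of_ne _ (sub_ne_zero.1 h2), slope_def_field, h3]
      field_simp
      ring
    have hd' : ∀ᶠ n in (U : Filter ℕ), DifferentiableOn ℂ (h' n) (ball c ρ) := by
      filter_upwards [hd, ha (ball_mem_nhds c hρ)] with n h1 h2
      exact (Complex.differentiableOn_dslope (isOpen_ball.mem_nhds h2)).2 h1
    have hdm : DifferentiableOn ℂ (fun w => (w - c) ^ m * k w) (ball c ρ) :=
      DifferentiableOn.mul (by fun_prop) hk
    -- At `c` the quotient is indeterminate. The maximum principle, applied to the difference from
    -- the expected limit, transfers convergence from a circle around `c` to its interior.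
    have hall : ∀ w ∈ ball c ρ, CTendsto h' U w ((w - c) ^ m * k w) := by
      intro w hw
      rcases eq_or_ne w c with rfl | hwc
      swap
      · exact hne w hw hwc
      intro z hzw
      have hcont : ContinuousOn (fun x => (x - w) ^ m * k x) (ball w ρ) := hdm.continuousOn
      obtain ⟨ζ, ζ', hζ', hζ, hle⟩ := exists_seq_mem_sphere_norm_le (half_pos hρ)
        (half_lt_self hρ) (hd'.mono fun n hn => hn.sub hdm)
      have hζb : ζ' ∈ ball w ρ := by
        rw [mem_ball, mem_sphere.1 hζ']; exact half_lt_self hρ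
      have h1 := (hne ζ' hζb (by rintro rfl; simp at hζ'; linarith) ζ hζ).sub
        ((hcont.continuousAt (isOpen_ball.mem_nhds hζb)).tendsto.comp hζ)
      rw [sub_self] at h1
      have h2 : Tendsto (fun n => h' n (z n) - (z n - w) ^ m * k (z n)) U (𝓝 0) := by
        refine squeeze_zero_norm' ?_ (by simpa using h1.norm)
        filter_upwards [hle, hzw (closedBall_mem_nhds w (half_pos hρ))] with n h3 h4
        exact h3 _ h4
      have h3 := h2.add ((hcont.continuousAt (isOpen_ball.mem_nhds hw)).tendsto.comp hzw)
      simpa using h3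
    obtain ⟨a', u, ha', hu, e⟩ := ih hρ hd' hk hk0 hall
    refine ⟨Fin.cons a a', u, ?_, hu, ?_⟩
    · intro i
      refine Fin.cases ha ha' i
    · filter_upwards [e, hz] with n h1 h2 z
      rw [Fin.prod_univ_succ]
      simp only [Fin.cons_zero, Fin.cons_succ, mul_assoc]
      rw [← h1 z]
      have := sub_smul_dslope (h n) (a n) z
      rw [h2, sub_zero, smul_eq_mul] at this
      exact this.symm

/-! ### The map to projective space defined by a holomorphic map with isolated zeros -/

open Classical in
/-- The point of projective space at `z` defined by a holomorphic map `A`, after division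
by the power of the coordinate that `A` contains. -/
noncomputable def red (A : ℂ → Cn N) (z : ℂ) : PN N :=
  if h : ∃ (n : ℕ) (G : ℂ → Cn N), AnalyticAt ℂ G z ∧ G z ≠ 0 ∧
    ∀ᶠ w in 𝓝 z, A w = (w - z) ^ n • G w
  then Projectivization.mk ℂ (h.choose_spec.choose z) h.choose_spec.choose_spec.2.1
  else Projectivization.mk ℂ (EuclideanSpace.single 0 1) (by simp)

/-- Any such factorisation exhibits the point as the limit of the lines spanned by `A w` as `w`
tends to `z` with `w ≠ z`, and this limit is unique. -/
theorem red_eq {A G : ℂ → Cn N} {z : ℂ} {n : ℕ} (hG : AnalyticAt ℂ G z) (h0 : G z ≠ 0)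
    (hA : ∀ᶠ w in 𝓝 z, A w = (w - z) ^ n • G w) : red A z = Projectivization.mk ℂ (G z) h0 := by
  have h : ∃ (n : ℕ) (G : ℂ → Cn N), AnalyticAt ℂ G z ∧ G z ≠ 0 ∧
    ∀ᶠ w in 𝓝 z, A w = (w - z) ^ n • G w := ⟨n, G, hG, h0, hA⟩
  rw [red, dif_pos h]
  obtain ⟨h1, h2, h3⟩ := h.choose_spec.choose_spec
  set G' := h.choose_spec.choose
  have key : ∀ (m : ℕ) (B : ℂ → Cn N) (hB : AnalyticAt ℂ B z) (hB0 : B z ≠ 0),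
      (∀ᶠ w in 𝓝 z, A w = (w - z) ^ m • B w) →
      PTendsto (fun w => if h : A w ≠ 0 then Projectivization.mk ℂ (A w) h else
        Projectivization.mk ℂ (B z) hB0) (𝓝[≠] z) (Projectivization.mk ℂ (B z) hB0) := by
    intro m B hB hB0 hAB
    refine pTendsto_mk hB0 ?_ (hB.continuousAt.tendsto.mono_left nhdsWithin_le_nhds)
    filter_upwards [nhdsWithin_le_nhds hAB, nhdsWithin_le_nhds (hB.continuousAt.eventually_ne hB0),
      self_mem_nhdsWithin] with w e hw hwz
    have hp : (w - z) ^ m ≠ 0 := pow_ne_zero _ (sub_ne_zero.2 hwz)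
    have hs : (w - z) ^ m • B w ≠ 0 := smul_ne_zero hp hw
    refine ⟨hw, ?_⟩
    have hA0 : A w ≠ 0 := by rw [e]; exact hs
    rw [dif_pos hA0]
    exact (Projectivization.mk_eq_mk_iff' ℂ _ _ _ _).2 ⟨_, e.symm⟩
  refine ((key _ G' h1 h2 h3).congr ?_).unique (key _ G hG h0 hA)
  filter_upwards [nhdsWithin_le_nhds hA, nhdsWithin_le_nhds (hG.continuousAt.eventually_ne h0),
      self_mem_nhdsWithin] with w e hw hwz
  have hp : (w - z) ^ n ≠ 0 := pow_ne_zero _ (sub_ne_zero.2 hwz)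
  have hA0 : A w ≠ 0 := by rw [e]; exact smul_ne_zero hp hw
  rw [dif_pos hA0, dif_pos hA0]

theorem red_eq_mk {A : ℂ → Cn N} {z : ℂ} (hA : AnalyticAt ℂ A z) (h0 : A z ≠ 0) :
    red A z = Projectivization.mk ℂ (A z) h0 :=
  red_eq (n := 0) hA h0 (by simp)

theorem isLift_red {A G : ℂ → Cn N} {z : ℂ} {n : ℕ} (hG : AnalyticAt ℂ G z) (h0 : G z ≠ 0)
    (hA : ∀ᶠ w in 𝓝 z, A w = (w - z) ^ n • G w) : IsLift (red A) z G := by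
  refine ⟨hG, ?_⟩
  filter_upwards [hA.eventually_nhds, hG.eventually_analyticAt,
    hG.continuousAt.eventually_ne h0] with w h1 h2 h3
  refine ⟨h3, ?_⟩
  rcases eq_or_ne w z with rfl | hwz
  · exact red_eq hG h0 hA
  · have hp : (w - z) ^ n ≠ 0 := pow_ne_zero _ (sub_ne_zero.2 hwz)
    have hs : (w - z) ^ n • G w ≠ 0 := smul_ne_zero hp h3
    have e : red A w = Projectivization.mk ℂ ((w - z) ^ n • G w) hs := by
      refine red_eq (n := 0) (G := fun x => (x - z) ^ n • G x) ?_ hs (by simpa using h1)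
      have hp' : AnalyticAt ℂ (fun x => (x - z) ^ n) w := by fun_prop
      exact hp'.smul h2
    rw [e, mk_smul_eq h3 hs]

theorem exists_red_factor {A : ℂ → Cn N} {z : ℂ} (hA : AnalyticAt ℂ A z)
    (h : ¬ ∀ᶠ w in 𝓝 z, A w = 0) : ∃ (n : ℕ) (G : ℂ → Cn N), AnalyticAt ℂ G z ∧ G z ≠ 0 ∧
    ∀ᶠ w in 𝓝 z, A w = (w - z) ^ n • G w :=
  hA.exists_eventuallyEq_pow_smul_nonzero_iff.2 h

theorem IsLift.mem_of_frequently {X : Set (PN N)} (hX : IsZariskiClosed X) {f : ℂ → PN N} {z : ℂ}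
    {F : ℂ → Cn N} (h : IsLift f z F) (hf : ∃ᶠ w in 𝓝 z, f w ∈ X) : f z ∈ X := by
  refine hX.mem_of_pTendsto (l := 𝓝 z) (p := f) ?_ hf
  rw [h.eq_mk]
  exact pTendsto_mk h.ne_zero h.2 h.1.continuousAt

/-! ### Bubbles -/

theorem IsBubbleTree.mem {X : Set (PN N)} {x : PN N} {R : Set (PN N)} (h : IsBubbleTree X x R) :
    x ∈ R := by
  cases h with
  | node g hg B R hR => exact Or.inl ⟨_, rfl⟩

/-- A product of `m` linear factors vanishes at `c` to the order given by the number of roots equal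
to `c`; order at least `m` leaves no other root. -/
theorem eq_of_prod_eq_pow_mul {m : ℕ} {b : Fin m → ℂ} {c κ : ℂ} (hκ : κ ≠ 0) {g : ℂ → ℂ}
    (hg : ContinuousAt g c) (h : ∀ᶠ w in 𝓝 c, κ * ∏ i, (w - b i) = (w - c) ^ m * g w) (i : Fin m) :
    b i = c := by
  classical
  by_contra hi
  set S := Finset.univ.filter fun i => b i = c
  set S' := Finset.univ.filter fun i => ¬ b i = c
  have hcard : S.card < m := by
    have h1 : S ⊂ Finset.univ := by
      refine Finset.filter_ssubset.2 ⟨i, Finset.mem_univ i, hi⟩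
    simpa using Finset.card_lt_card h1
  have hprod : ∀ w, ∏ i, (w - b i) = (w - c) ^ S.card * ∏ i ∈ S', (w - b i) := by
    intro w
    rw [← Finset.prod_filter_mul_prod_filter_not Finset.univ (fun i => b i = c)]
    congr 1
    refine Finset.prod_eq_pow_card fun j hj => ?_
    rw [(Finset.mem_filter.1 hj).2]
  have e : ∀ᶠ w in 𝓝[≠] c, κ * ∏ i ∈ S', (w - b i) = (w - c) ^ (m - S.card) * g w := by
    filter_upwards [nhdsWithin_le_nhds h, self_mem_nhdsWithin] with w h1 h2
    have hp : (w - c) ^ S.card ≠ 0 := pow_ne_zero _ (sub_ne_zero.2 h2)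
    apply mul_left_cancel₀ hp
    rw [hprod] at h1
    have h3 : (w - c) ^ m = (w - c) ^ S.card * (w - c) ^ (m - S.card) := by
      rw [← pow_add, Nat.add_sub_cancel' hcard.le]
    rw [h3] at h1
    linear_combination h1
  have hc1 : ContinuousAt (fun w => κ * ∏ i ∈ S', (w - b i)) c := by fun_prop
  have hc2 : ContinuousAt (fun w => (w - c) ^ (m - S.card) * g w) c :=
    ContinuousAt.mul (by fun_prop) hg
  have h1 := tendsto_nhds_unique_of_eventuallyEq (hc1.tendsto.mono_left nhdsWithin_le_nhds)
    (hc2.tendsto.mono_left nhdsWithin_le_nhds) e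
  rw [sub_self, zero_pow (by omega), zero_mul] at h1
  refine mul_ne_zero hκ (Finset.prod_ne_zero_iff.2 fun j hj => ?_) h1
  exact sub_ne_zero.2 (Ne.symm (Finset.mem_filter.1 hj).2)

theorem tendsto_nhds_or_tendsto_norm_atTop (U : Ultrafilter ℕ) (w : ℕ → ℂ) :
    (∃ w', Tendsto w U (𝓝 w')) ∨ Tendsto (fun n => ‖w n‖) U atTop := by
  by_cases h : ∃ M, ∀ᶠ n in (U : Filter ℕ), ‖w n‖ ≤ M
  · obtain ⟨M, hM⟩ := h
    obtain ⟨w', -, h⟩ := exists_tendsto_of_eventually_mem (isCompact_closedBall (0 : ℂ) M) U (v := w)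
      (hM.mono fun n hn => by simpa using hn)
    exact Or.inl ⟨w', h⟩
  · right
    refine tendsto_atTop.2 fun M => ?_
    push Not at h
    exact (h M).mono fun n hn => hn.le

theorem tendsto_coord {ι : Type*} {l : Filter ι} {v : ι → Cn N} {w : Cn N} (h : Tendsto v l (𝓝 w))
    (j : Fin (N + 1)) : Tendsto (fun n => v n j) l (𝓝 (w j)) :=
  ((EuclideanSpace.proj j : Cn N →L[ℂ] ℂ).continuous.tendsto w).comp h

theorem tendsto_of_coord {ι : Type*} {l : Filter ι} {v : ι → Cn N} {w : Cn N}
    (h : ∀ j, Tendsto (fun n => v n j) l (𝓝 (w j))) : Tendsto v l (𝓝 w) :=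
  ((PiLp.continuousLinearEquiv 2 ℂ (fun _ : Fin (N + 1) => ℂ)).symm.continuous.tendsto
    (fun j => w j)).comp (tendsto_pi_nhds.2 h)

set_option maxHeartbeats 800000 in
/-- Rescaling of a sequence of holomorphic maps at a zero of the limit, such that the limit of
the rescaled sequence has zeros of smaller order. -/
theorem exists_rescaling {U : Ultrafilter ℕ} (hU : (U : Filter ℕ) ≤ atTop) {m : ℕ} (hm : 0 < m)
    {F : ℕ → ℂ → Cn N} {G : ℂ → Cn N} {c : ℂ} {ρ : ℝ} (hρ : 0 < ρ)
    (hF : ∀ᶠ n in (U : Filter ℕ), DifferentiableOn ℂ (F n) (ball c ρ) ∧ ∀ z ∈ ball c ρ, F n z ≠ 0)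
    (hG : DifferentiableOn ℂ G (ball c ρ)) (hG0 : G c ≠ 0)
    (hc : ∀ w ∈ ball c ρ, CTendsto F U w ((w - c) ^ m • G w)) :
    ∃ (a s : ℕ → ℂ) (P Q : ℂ → Cn N), Tendsto a U (𝓝 c) ∧ Tendsto s U (𝓝 0) ∧
      (∀ᶠ n in (U : Filter ℕ), s n ≠ 0) ∧ Differentiable ℂ P ∧ Differentiable ℂ Q ∧
      Q 0 = G c ∧ (∀ t ≠ 0, P t⁻¹ = (t⁻¹) ^ m • Q t) ∧
      (∀ w, CTendsto (fun n x => (s n ^ m)⁻¹ • F n (a n + s n * x)) U w (P w)) ∧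
      (∀ z : ℕ → ℂ, Tendsto z U (𝓝 c) → Tendsto (fun n => ‖(z n - a n) / s n‖) U atTop →
        Tendsto (fun n => ((z n - a n) ^ m)⁻¹ • F n (z n)) U (𝓝 (G c))) ∧
      {w | P w = 0}.Finite ∧
      ∀ (β : ℂ) (g : ℂ → Cn N), ContinuousAt g β → ¬ ∀ᶠ w in 𝓝 β, P w = (w - β) ^ m • g w := by
  obtain ⟨j0, hj0⟩ := exists_coord_ne_zero hG0
  -- A coordinate of `G` may vanish at `c`, and then the zeros of that coordinate of `F n` are not
  -- controlled. Adding the coordinate `j0` where needed makes each modified coordinate have exactly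
  -- order `m` in the limit.
  set ε : Fin (N + 1) → ℂ := fun j => if G c j = 0 then 1 else 0
  have hε0 : ε j0 = 0 := if_neg hj0
  set κ : Fin (N + 1) → ℂ := fun j => G c j + ε j * G c j0
  have hκ : ∀ j, κ j ≠ 0 := by
    intro j
    by_cases h : G c j = 0
    · simp [κ, ε, h, hj0]
    · simp [κ, ε, h]
  have hdc : ∀ {A : ℂ → Cn N} {S : Set ℂ}, DifferentiableOn ℂ A S →
      ∀ j, DifferentiableOn ℂ (fun z => A z j + ε j * A z j0) S := by
    intro A S hA j
    have h1 : ∀ j, DifferentiableOn ℂ (fun z => A z j) S := fun j =>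
      (EuclideanSpace.proj j : Cn N →L[ℂ] ℂ).differentiable.comp_differentiableOn hA
    exact (h1 j).add ((h1 j0).const_mul _)
  have fac : ∀ j, ∃ (a : Fin m → ℕ → ℂ) (u : ℕ → ℂ → ℂ), (∀ i, Tendsto (a i) U (𝓝 c)) ∧
      CTendsto u U c (κ j) ∧ ∀ᶠ n in (U : Filter ℕ), ∀ z,
        F n z j + ε j * F n z j0 = (∏ i, (z - a i n)) * u n z := by
    intro j
    refine exists_factorization hU m (h := fun n z => F n z j + ε j * F n z j0)
      (k := fun z => G z j + ε j * G z j0) hρ (hF.mono fun n hn => hdc hn.1 j) (hdc hG j) (hκ j) ?_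
    intro w hw z hz
    have h1 := hc w hw z hz
    have h2 := (tendsto_coord h1 j).add ((tendsto_coord h1 j0).const_mul (ε j))
    have e : ((w - c) ^ m • G w) j + ε j * ((w - c) ^ m • G w) j0
      = (w - c) ^ m * (G w j + ε j * G w j0) := by
      simp only [PiLp.smul_apply, smul_eq_mul]; ring
    rwa [e] at h2
  choose a u ha hu e using fac
  have e' : ∀ᶠ n in (U : Filter ℕ), ∀ j z,
      F n z j + ε j * F n z j0 = (∏ i, (z - a j i n)) * u j n z := eventually_all.2 e
  set i0 : Fin m := ⟨0, hm⟩
  -- `V x` undoes the modification of coordinates. It is the limit of the rescaled maps when the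
  -- distances to the zeros, in units of the scale, tend to `x`.
  set V : (Fin (N + 1) → Fin m → ℂ) → Cn N := fun x =>
    WithLp.toLp 2 fun j => κ j * (∏ i, x j i) - ε j * (κ j0 * ∏ i, x j0 i)
  have hVj : ∀ x j, V x j = κ j * (∏ i, x j i) - ε j * (κ j0 * ∏ i, x j0 i) := fun x j => rfl
  have hVj' : ∀ x j, κ j * (∏ i, x j i) = V x j + ε j * V x j0 := by
    intro x j; rw [hVj, hVj, hε0]; ring
  have hVs : ∀ (t : ℂ) x, V (fun j i => t * x j i) = t ^ m • V x := by
    intro t x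
    ext j
    rw [PiLp.smul_apply, hVj, hVj]
    simp only [Finset.prod_mul_distrib, Finset.prod_const, Finset.card_univ, Fintype.card_fin,
      smul_eq_mul]
    ring
  have main : ∀ (z s : ℕ → ℂ) (x : Fin (N + 1) → Fin m → ℂ), Tendsto z U (𝓝 c) →
      (∀ᶠ n in (U : Filter ℕ), s n ≠ 0) →
      (∀ j i, Tendsto (fun n => (z n - a j i n) / s n) U (𝓝 (x j i))) →
      Tendsto (fun n => (s n ^ m)⁻¹ • F n (z n)) U (𝓝 (V x)) := by
    intro z s x hz hs hx
    have h1 : ∀ j, Tendsto (fun n => u j n (z n) * ∏ i, (z n - a j i n) / s n) U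
        (𝓝 (κ j * ∏ i, x j i)) := fun j =>
      (hu j z hz).mul (tendsto_finsetProd _ fun i _ => hx j i)
    refine tendsto_of_coord fun j => ?_
    refine Tendsto.congr' ?_ ((h1 j).sub ((h1 j0).const_mul (ε j)))
    filter_upwards [e', hs] with n h2 h3
    have h4 := h2 j (z n)
    have h5 := h2 j0 (z n)
    rw [hε0, zero_mul, add_zero] at h5
    simp only [Finset.prod_div_distrib, Finset.prod_const, Finset.card_univ, Fintype.card_fin,
      PiLp.smul_apply, smul_eq_mul]
    rw [eq_sub_of_add_eq h4, h5]
    ring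
  -- One zero serves as origin and the largest distance to the others as scale. After rescaling all
  -- zeros have limits `b`, with one at 0 and the family of norm 1.
  set a0 : ℕ → ℂ := a j0 i0
  set d : ℕ → Fin (N + 1) → Fin m → ℂ := fun n j i => a j i n - a0 n
  have hd : Tendsto d U (𝓝 0) := tendsto_pi_nhds.2 fun j => tendsto_pi_nhds.2 fun i => by
    simpa using (ha j i).sub (ha j0 i0)
  set s : ℕ → ℂ := fun n => (‖d n‖ : ℂ)
  have hs : Tendsto s U (𝓝 0) := by
    have := (Complex.continuous_ofReal.tendsto _).comp hd.norm
    rw [norm_zero, Complex.ofReal_zero] at this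
    exact this
  -- If all zeros coincided, every coordinate of `F n` would vanish at that point, so the scale is
  -- positive.
  have hd0 : ∀ᶠ n in (U : Filter ℕ), d n ≠ 0 := by
    filter_upwards [e', hF, ha j0 i0 (ball_mem_nhds c hρ)] with n h1 h2 h3 h4
    have h5 : ∀ j, F n (a0 n) j + ε j * F n (a0 n) j0 = 0 := by
      intro j
      rw [h1 j, Finset.prod_eq_zero (Finset.mem_univ i0), zero_mul]
      have := congrFun (congrFun h4 j) i0
      simp only [d, Pi.zero_apply] at this
      linear_combination -this
    refine h2.2 _ h3 ?_
    have h6 := h5 j0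
    rw [hε0, zero_mul, add_zero] at h6
    ext j
    have := h5 j
    rw [h6, mul_zero, add_zero] at this
    simpa using this
  have hs0 : ∀ᶠ n in (U : Filter ℕ), s n ≠ 0 := hd0.mono fun n hn => by simpa [s] using hn
  obtain ⟨b, hb1, hb⟩ := exists_tendsto_of_eventually_mem
    (isCompact_sphere (0 : Fin (N + 1) → Fin m → ℂ) 1) U (v := fun n => (s n)⁻¹ • d n) (by
      filter_upwards [hd0] with n hn
      rw [mem_sphere_zero_iff_norm, norm_smul, norm_inv]
      simp only [s, Complex.norm_real, norm_norm]
      exact inv_mul_cancel₀ (norm_ne_zero_iff.2 hn))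
  have hbj : ∀ j i, Tendsto (fun n => (a j i n - a0 n) / s n) U (𝓝 (b j i)) := by
    intro j i
    have := (tendsto_pi_nhds.1 (tendsto_pi_nhds.1 hb j) i)
    refine this.congr fun n => ?_
    simp only [d, Pi.smul_apply, smul_eq_mul]
    ring
  have hb0 : b j0 i0 = 0 := by
    refine tendsto_nhds_unique (hbj j0 i0) ?_
    simp [a0]
  refine ⟨a0, s, fun w => V fun j i => w - b j i, fun t => V fun j i => 1 - t * b j i, ha j0 i0, hs,
    hs0, ?_, ?_, ?_, ?_, ?_, ?_, ?_, ?_⟩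
  · refine (differentiable_piLp 2).2 fun j => ?_
    simp only [hVj]
    fun_prop
  · refine (differentiable_piLp 2).2 fun j => ?_
    simp only [hVj]
    fun_prop
  · ext j
    rw [hVj]
    simp only [zero_mul, sub_zero, Finset.prod_const_one, mul_one, κ, hε0]
    ring
  · intro t ht
    rw [← hVs]
    ext j
    field_simp
  · intro w x hx
    refine main (fun n => a0 n + s n * x n) s (fun j i => w - b j i) ?_ hs0 fun j i => ?_
    · simpa using (ha j0 i0).add (hs.mul hx)
    · refine (hx.sub (hbj j i)).congr' ?_
      filter_upwards [hs0] with n hn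
      field_simp
      simp only [a0]
      ring
  · intro z hz hzs
    have h0 : ∀ᶠ n in (U : Filter ℕ), z n - a0 n ≠ 0 := by
      filter_upwards [hzs.eventually_gt_atTop 0] with n hn h
      simp [h] at hn
    have hV1 : V (fun _ _ => 1) = G c := by
      ext j
      rw [hVj]
      simp only [Finset.prod_const_one, mul_one, κ, hε0]
      ring
    rw [← hV1]
    refine main z (fun n => z n - a0 n) (fun _ _ => 1) hz h0 fun j i => ?_
    have h1 : Tendsto (fun n => ((z n - a0 n) / s n)⁻¹) U (𝓝 0) :=
      tendsto_inv₀_cobounded.comp (tendsto_norm_atTop_iff_cobounded.1 hzs)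
    have h2 := ((hbj j i).mul h1).const_sub 1
    rw [mul_zero, sub_zero] at h2
    refine h2.congr' ?_
    filter_upwards [hs0, h0] with n h3 h4
    field_simp
    ring
  · refine (Set.finite_range (b j0)).subset fun w hw => ?_
    have h1 := hVj' (fun j i => w - b j i) j0
    have h2 : V (fun j i => w - b j i) = 0 := hw
    rw [h2] at h1
    simp only [PiLp.zero_apply, mul_zero, add_zero, mul_eq_zero, hκ j0, false_or,
      Finset.prod_eq_zero_iff, Finset.mem_univ, true_and] at h1
    obtain ⟨i, hi⟩ := h1
    exact ⟨i, (sub_eq_zero.1 hi).symm⟩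
  · intro β g hg hP
    -- A factor of order `m` forces all rescaled zeros to coincide, hence to be 0, against the
    -- normalisation of `b`. This is the strict decrease on which the bubble induction rests.
    have hall : ∀ j i, b j i = β := by
      intro j
      refine eq_of_prod_eq_pow_mul (hκ j) (g := fun w => g w j + ε j * g w j0) ?_ ?_
      · exact (tendsto_coord hg j).add ((tendsto_coord hg j0).const_mul _)
      · filter_upwards [hP] with w hw
        rw [hVj' (fun j i => w - b j i), hw]
        simp only [PiLp.smul_apply, smul_eq_mul]
        ring
    have hβ : β = 0 := by rw [← hall j0 i0, hb0]
    have : b = 0 := by ext j i; rw [hall, hβ]; rfl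
    rw [this] at hb1
    simp at hb1

/-- `R` is the set of limits along `U` of the values `f n (z n)` at sequences `z n` that
converge to `c`. -/
def IsLimitSet (f : ℕ → ℂ → PN N) (U : Ultrafilter ℕ) (c : ℂ) (R : Set (PN N)) : Prop :=
  (∀ z : ℕ → ℂ, Tendsto z U (𝓝 c) → ∃ q ∈ R, PTendsto (fun n => f n (z n)) U q) ∧
    ∀ q ∈ R, ∃ z : ℕ → ℂ, Tendsto z U (𝓝 c) ∧ PTendsto (fun n => f n (z n)) U q

/-- Induction on the order `m` of the zero of the limit. The rescaled limit P gives the root curve,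
attached at infinity to the value of `G` at `c`; at each zero of P the rescaled sequence satisfies
the same hypotheses with smaller order, which gives the subtrees. -/
theorem exists_bubbleTree {X : Set (PN N)} (hX : IsZariskiClosed X) {U : Ultrafilter ℕ}
    (hU : (U : Filter ℕ) ≤ atTop) (m : ℕ) :
    ∀ {f : ℕ → ℂ → PN N} {F : ℕ → ℂ → Cn N} {G : ℂ → Cn N} {c : ℂ} {ρ : ℝ}, 0 < ρ → 0 < m →
    (∀ᶠ n in (U : Filter ℕ), DifferentiableOn ℂ (F n) (ball c ρ) ∧ ∀ z ∈ ball c ρ,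
      ∃ h : F n z ≠ 0, f n z = Projectivization.mk ℂ (F n z) h ∧ f n z ∈ X) →
    DifferentiableOn ℂ G (ball c ρ) → ∀ hG0 : G c ≠ 0,
    (∀ w ∈ ball c ρ, CTendsto F U w ((w - c) ^ m • G w)) →
    ∃ R, IsBubbleTree X (Projectivization.mk ℂ (G c) hG0) R ∧ IsLimitSet f U c R := by
  induction m using Nat.strong_induction_on with
  | _ m ih =>
  intro f F G c ρ hρ hm hF hG hG0 hc
  obtain ⟨a, s, P, Q, ha, hs, hs0, hP, hQ, hQ0, hPQ, hconv, hinf, hfin, hmult⟩ :=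
    exists_rescaling hU hm hρ (hF.mono fun n hn => ⟨hn.1, fun z hz => (hn.2 z hz).1⟩) hG hG0 hc
  have hPa : ∀ w, AnalyticAt ℂ P w := fun w => hP.analyticAt w
  have hQa : ∀ w, AnalyticAt ℂ Q w := fun w => hQ.analyticAt w
  have hred : ∀ b, ∃ (k : ℕ) (H : ℂ → Cn N), AnalyticAt ℂ H b ∧ H b ≠ 0 ∧
      ∀ᶠ w in 𝓝 b, P w = (w - b) ^ k • H w := fun b =>
    exists_red_factor (hPa b) fun h => hmult b (fun _ => 0) continuousAt_const
      (h.mono fun w hw => by rw [hw, smul_zero])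
  choose k H hH hH0 hPH using hred
  set B : Finset ℂ := hfin.toFinset
  have hB : ∀ b, b ∈ B ↔ P b = 0 := fun b => by simp [B]
  have hkm : ∀ b, k b < m := by
    intro b
    by_contra! h
    refine hmult b (fun w => (w - b) ^ (k b - m) • H b w) ?_ ?_
    · have h1 : ContinuousAt (fun w => (w - b) ^ (k b - m)) b := by fun_prop
      exact h1.smul (hH b).continuousAt
    · filter_upwards [hPH b] with w hw
      rw [hw, smul_smul, ← pow_add, Nat.add_sub_cancel' h]
  have hk0 : ∀ b ∈ B, 0 < k b := by
    intro b hb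
    by_contra! h
    have h1 := (hPH b).self_of_nhds
    rw [(hB b).1 hb, Nat.le_zero.1 h, pow_zero, one_smul] at h1
    exact hH0 b h1.symm
  have hexp : ∀ {x : ℕ → ℂ} {w : ℂ}, Tendsto x U (𝓝 w) →
      Tendsto (fun n => a n + s n * x n) U (𝓝 c) := by
    intro x w hx
    simpa using ha.add (hs.mul hx)
  have hFz : ∀ {z : ℕ → ℂ}, Tendsto z U (𝓝 c) → ∀ᶠ n in (U : Filter ℕ),
      ∃ h : F n (z n) ≠ 0, f n (z n) = Projectivization.mk ℂ (F n (z n)) h ∧ f n (z n) ∈ X := by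
    intro z hz
    filter_upwards [hF, hz (ball_mem_nhds c hρ)] with n h1 h2 using h1.2 _ h2
  have hmk : ∀ {z t : ℕ → ℂ} {v : Cn N} (hv : v ≠ 0), Tendsto z U (𝓝 c) →
      (∀ᶠ n in (U : Filter ℕ), t n ≠ 0) → Tendsto (fun n => t n • F n (z n)) U (𝓝 v) →
      PTendsto (fun n => f n (z n)) U (Projectivization.mk ℂ v hv) := by
    intro z t v hv hz ht h
    refine pTendsto_mk hv ?_ h
    filter_upwards [hFz hz, ht] with n ⟨h1, h2, _⟩ h3
    exact ⟨smul_ne_zero h3 h1, by rw [h2, mk_smul_eq]⟩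
  have hsm : ∀ᶠ n in (U : Filter ℕ), (s n ^ m)⁻¹ ≠ 0 :=
    hs0.mono fun n hn => inv_ne_zero (pow_ne_zero _ hn)
  have hreg : ∀ {x : ℕ → ℂ} {w : ℂ}, w ∉ B → Tendsto x U (𝓝 w) →
      PTendsto (fun n => f n (a n + s n * x n)) U (red P w) := by
    intro x w hw hx
    have hw0 : P w ≠ 0 := fun h => hw ((hB w).2 h)
    rw [red_eq_mk (hPa w) hw0]
    exact hmk hw0 (hexp hx) hsm (hconv w x hx)
  have hatinf : ∀ {z : ℕ → ℂ}, Tendsto z U (𝓝 c) →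
      Tendsto (fun n => ‖(z n - a n) / s n‖) U atTop →
      PTendsto (fun n => f n (z n)) U (Projectivization.mk ℂ (G c) hG0) := by
    intro z hz hz'
    refine hmk hG0 hz ?_ (hinf z hz hz')
    filter_upwards [hz'.eventually_gt_atTop 0] with n hn
    refine inv_ne_zero (pow_ne_zero _ fun h => ?_)
    simp [h] at hn
  have hxs : ∀ {z : ℕ → ℂ}, ∀ᶠ n in (U : Filter ℕ), a n + s n * ((z n - a n) / s n) = z n := by
    intro z
    filter_upwards [hs0] with n hn
    field_simp
    ring
  -- the rational curve
  set g : OnePoint ℂ → PN N := fun p => Option.elim p (Projectivization.mk ℂ (G c) hG0) (red P)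
  have hgw : ∀ w : ℂ, g (w : OnePoint ℂ) = red P w := fun w => rfl
  have hginf : g OnePoint.infty = Projectivization.mk ℂ (G c) hG0 := rfl
  have hlift : ∀ w, IsLift (red P) w (H w) := fun w => isLift_red (hH w) (hH0 w) (hPH w)
  have hregX : ∀ w ∉ B, red P w ∈ X := by
    intro w hw
    refine hX.mem_of_pTendsto (hreg hw tendsto_const_nhds) (Eventually.frequently ?_)
    exact (hFz (hexp tendsto_const_nhds)).mono fun n hn => hn.2.2
  have hgX : ∀ w, red P w ∈ X := by
    intro w
    refine (hlift w).mem_of_frequently hX ?_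
    have h1 : ∀ᶠ x in 𝓝[≠] w, x ∉ B := by
      have h2 : ((B.erase w : Finset ℂ) : Set ℂ)ᶜ ∈ 𝓝 w :=
        (Finset.isClosed _).isOpen_compl.mem_nhds (by simp)
      filter_upwards [nhdsWithin_le_nhds h2, self_mem_nhdsWithin] with x h3 h4 h5
      exact h3 (Finset.mem_coe.2 (Finset.mem_erase.2 ⟨h4, h5⟩))
    exact (h1.mono fun x hx => hregX x hx).frequently.filter_mono nhdsWithin_le_nhds
  have hg : IsRationalCurve X g := by
    refine ⟨fun z => ⟨H z, hlift z⟩, ⟨Q, hQa 0, ?_⟩, fun p => ?_⟩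
    · have hQ0' : Q 0 ≠ 0 := by rw [hQ0]; exact hG0
      filter_upwards [(hQa 0).continuousAt.eventually_ne hQ0'] with t ht
      refine ⟨ht, ?_⟩
      by_cases h0 : t = 0
      · subst h0
        simp only [atInfty, if_true, hginf, hQ0]
      · have h1 : P t⁻¹ ≠ 0 := by
          rw [hPQ t h0]; exact smul_ne_zero (pow_ne_zero _ (inv_ne_zero h0)) ht
        simp only [atInfty, if_neg h0, hgw]
        rw [red_eq_mk (hPa _) h1]
        exact (Projectivization.mk_eq_mk_iff' ℂ _ _ _ _).2 ⟨_, (hPQ t h0).symm⟩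
    · induction p using OnePoint.rec with
      | infty =>
        rw [hginf]
        refine hX.mk_mem hG0 (l := 𝓝[≠] (0 : ℂ)) (v := Q) ?_ ?_
        · rw [← hQ0]
          exact (hQa 0).continuousAt.tendsto.mono_left nhdsWithin_le_nhds
        · refine Eventually.frequently ?_
          have hQ0' : Q 0 ≠ 0 := by rw [hQ0]; exact hG0
          filter_upwards [nhdsWithin_le_nhds ((hQa 0).continuousAt.eventually_ne hQ0'),
            self_mem_nhdsWithin] with t ht h0
          refine ⟨ht, ?_⟩
          have h1 : P t⁻¹ ≠ 0 := by
            rw [hPQ t h0]; exact smul_ne_zero (pow_ne_zero _ (inv_ne_zero h0)) ht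
          have h2 := hgX t⁻¹
          rw [red_eq_mk (hPa _) h1] at h2
          convert h2 using 1
          exact ((Projectivization.mk_eq_mk_iff' ℂ _ _ _ _).2 ⟨_, (hPQ t h0).symm⟩).symm
      | coe w => exact hgX w
  -- the subtrees
  have hsub : ∀ b, ∃ R, b ∈ B → IsBubbleTree X (g (b : OnePoint ℂ)) R ∧
      IsLimitSet (fun n x => f n (a n + s n * x)) U b R := by
    intro b
    by_cases hb : b ∈ B
    swap
    · exact ⟨∅, fun h => absurd h hb⟩
    obtain ⟨δ, hδ, hball⟩ := Metric.eventually_nhds_iff_ball.1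
      ((hPH b).and ((hH b).eventually_analyticAt))
    obtain ⟨R, hR1, hR2⟩ := ih (k b) (hkm b) (f := fun n x => f n (a n + s n * x))
      (F := fun n x => (s n ^ m)⁻¹ • F n (a n + s n * x)) (G := H b) (c := b) (ρ := δ) hδ (hk0 b hb)
      (by
        have h1 : ∀ᶠ n in (U : Filter ℕ), ∀ x ∈ ball b δ, a n + s n * x ∈ ball c ρ := by
          have h2 : Tendsto (fun n => dist (a n) c + ‖s n‖ * (‖b‖ + δ)) U (𝓝 0) := by
            simpa using (tendsto_iff_dist_tendsto_zero.1 ha).add (hs.norm.mul_const (‖b‖ + δ))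
          filter_upwards [h2.eventually_lt_const hρ] with n hn x hx
          have hxb : ‖x‖ ≤ ‖b‖ + δ := by
            have := norm_le_norm_add_norm_sub' x b
            have h3 := mem_ball_iff_norm.1 hx
            linarith
          rw [mem_ball, dist_eq_norm]
          rw [dist_eq_norm] at hn
          have e : a n + s n * x - c = (a n - c) + s n * x := by ring
          rw [e]
          refine (norm_add_le _ _).trans_lt (lt_of_le_of_lt ?_ hn)
          rw [norm_mul]
          gcongr
        filter_upwards [h1, hF, hsm] with n h2 h3 h4
        refine ⟨?_, fun x hx => ?_⟩
        · have h5 : DifferentiableOn ℂ (fun x => F n (a n + s n * x)) (ball b δ) :=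
            h3.1.comp (by fun_prop) h2
          exact h5.const_smul ((s n ^ m)⁻¹)
        · obtain ⟨h5, h6, h7⟩ := h3.2 _ (h2 x hx)
          exact ⟨smul_ne_zero h4 h5, by rw [h6, mk_smul_eq], h7⟩)
      (fun w hw => (hball w hw).2.differentiableAt.differentiableWithinAt) (hH0 b)
      (fun w hw => by
        rw [← (hball w hw).1]
        exact hconv w)
    refine ⟨R, fun _ => ⟨?_, hR2⟩⟩
    rwa [hgw, red_eq (hH b) (hH0 b) (hPH b)]
  choose R hR using hsub
  refine ⟨_, hginf ▸ IsBubbleTree.node g hg B R fun b hb => (hR b hb).1, ?_, ?_⟩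
  · intro z hz
    -- In the rescaled coordinate the sequence tends to a zero of `P` (limit in a subtree), to
    -- another finite point (limit on the curve), or to infinity (limit at the attaching point).
    rcases tendsto_nhds_or_tendsto_norm_atTop U fun n => (z n - a n) / s n with ⟨w, hw⟩ | hw
    · have hcongr : (fun n => f n (a n + s n * ((z n - a n) / s n))) =ᶠ[U] fun n => f n (z n) :=
        (hxs (z := z)).mono fun n hn => congrArg (f n) hn
      by_cases hwB : w ∈ B
      · obtain ⟨q, hq, h⟩ := (hR w hwB).2.1 _ hw
        exact ⟨q, Or.inr (mem_biUnion (Finset.mem_coe.2 hwB) hq), h.congr hcongr⟩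
      · exact ⟨red P w, Or.inl ⟨w, rfl⟩, (hreg hwB hw).congr hcongr⟩
    · exact ⟨_, Or.inl ⟨OnePoint.infty, rfl⟩, hatinf hz hw⟩
  · have hb : ∀ b ∈ B, ∀ q ∈ R b, ∃ z : ℕ → ℂ, Tendsto z U (𝓝 c) ∧
        PTendsto (fun n => f n (z n)) U q := by
      intro b hb q hq
      obtain ⟨x, hx, hxq⟩ := (hR b hb).2.2 q hq
      exact ⟨_, hexp hx, hxq⟩
    rintro q (⟨p, rfl⟩ | hq)
    · induction p using OnePoint.rec with
      | infty =>
        -- The attaching point is reached on an intermediate scale: t = |s|^(-1/2) tends to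
        -- infinity, while the displacement s t still tends to 0.
        obtain ⟨t, ht, ht'⟩ : ∃ t : ℕ → ℂ, Tendsto (fun n => s n * t n) U (𝓝 0) ∧
            Tendsto (fun n => ‖t n‖) U atTop := by
          have hsq : Tendsto (fun n => Real.sqrt ‖s n‖) U (𝓝 0) := by
            have h1 := (Real.continuous_sqrt.tendsto _).comp hs.norm
            rw [norm_zero, Real.sqrt_zero] at h1
            exact h1
          refine ⟨fun n => ((Real.sqrt ‖s n‖)⁻¹ : ℝ), ?_, ?_⟩
          · refine squeeze_zero_norm' (Eventually.of_forall fun n => ?_) hsq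
            rw [norm_mul, Complex.norm_real, norm_inv, Real.norm_of_nonneg (Real.sqrt_nonneg _)]
            rw [← div_eq_mul_inv, Real.div_sqrt]
          · have h1 : Tendsto (fun n => Real.sqrt ‖s n‖) U (𝓝[>] 0) := by
              refine tendsto_nhdsWithin_iff.2 ⟨hsq, hs0.mono fun n hn => ?_⟩
              exact Real.sqrt_pos.2 (norm_pos_iff.2 hn)
            refine (tendsto_inv_nhdsGT_zero.comp h1).congr fun n => ?_
            rw [Complex.norm_real, Real.norm_of_nonneg (inv_nonneg.2 (Real.sqrt_nonneg _))]
            rfl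
        refine ⟨fun n => a n + s n * t n, by simpa using ha.add ht, hatinf (by simpa using ha.add ht) ?_⟩
        refine ht'.congr' ?_
        filter_upwards [hs0] with n hn
        congr 1
        field_simp
        ring
      | coe w =>
        by_cases hwB : w ∈ B
        · exact hb w hwB _ (hR w hwB).1.mem
        · exact ⟨_, hexp (tendsto_const_nhds (x := w)), hreg hwB tendsto_const_nhds⟩
    · obtain ⟨b, hbB, hq⟩ := mem_iUnion₂.1 hq
      exact hb b hbB q hq

/-! ### Discs with bubbles as limits -/

/-- The part of the graph of `e n` over compact sets converges along `U` to the limit sets `R z`. -/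
theorem eventually_nearOver {e : ℕ → ℂ → PN N} {U : Ultrafilter ℕ} {R : ℂ → Set (PN N)}
    (hR : ∀ z ∈ ball (0 : ℂ) 1, IsLimitSet e U z (R z)) {Γ : Set (ℂ × PN N)}
    (hΓ : ∀ p : ℂ × PN N, p ∈ Γ ↔ p.1 ∈ ball (0 : ℂ) 1 ∧ p.2 ∈ R p.1) {r ε : ℝ} (hr : r < 1)
    (hε : 0 < ε) :
    ∀ᶠ n in (U : Filter ℕ), NearOver r ε (discGraph (e n)) Γ ∧ NearOver r ε Γ (discGraph (e n)) := by
  have hlim : ∀ {z : ℕ → ℂ}, (∀ᶠ n in (U : Filter ℕ), ‖z n‖ ≤ r) →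
      ∃ z' ∈ ball (0 : ℂ) 1, Tendsto z U (𝓝 z') := by
    intro z hz
    obtain ⟨z', h1, h2⟩ := exists_tendsto_of_eventually_mem (isCompact_closedBall (0 : ℂ) r) U
      (v := z) (hz.mono fun n hn => by simpa using hn)
    exact ⟨z', closedBall_subset_ball hr h1, h2⟩
  refine Eventually.and ?_ ?_
  · by_contra hcon
    rw [← Ultrafilter.eventually_not] at hcon
    have hcon' : ∀ᶠ n in (U : Filter ℕ), ∃ z, ‖z‖ ≤ r ∧
        ∀ q ∈ Γ, ¬ (‖z - q.1‖ < ε ∧ pdist (e n z) q.2 < ε) := by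
      filter_upwards [hcon] with n hn
      simp only [NearOver, not_forall, not_exists, not_and] at hn
      obtain ⟨p, hp, hpr, h⟩ := hn
      exact ⟨p.1, hpr, fun q hq h' => h q hq h'.1 (by rw [hp.2]; exact h'.2)⟩
    choose! z hz using fun n (h : ∃ z, ‖z‖ ≤ r ∧
        ∀ q ∈ Γ, ¬ (‖z - q.1‖ < ε ∧ pdist (e n z) q.2 < ε)) => h
    obtain ⟨z', hz', hzz⟩ := hlim (hcon'.mono fun n hn => (hz n hn).1)
    obtain ⟨q, hq, hlq⟩ := (hR z' hz').1 z hzz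
    obtain ⟨n, h1, h2, h3⟩ := (hcon'.and ((Metric.tendsto_nhds.1 hzz ε hε).and (hlq.lt hε))).exists
    refine (hz n h1).2 (z', q) ((hΓ _).2 ⟨hz', hq⟩) ⟨?_, h3⟩
    rwa [dist_eq_norm] at h2
  · by_contra hcon
    rw [← Ultrafilter.eventually_not] at hcon
    have hcon' : ∀ᶠ n in (U : Filter ℕ), ∃ p ∈ Γ, ‖p.1‖ ≤ r ∧
        ∀ w ∈ ball (0 : ℂ) 1, ¬ (‖p.1 - w‖ < ε ∧ pdist p.2 (e n w) < ε) := by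
      filter_upwards [hcon] with n hn
      simp only [NearOver, not_forall, not_exists, not_and] at hn
      obtain ⟨p, hp, hpr, h⟩ := hn
      exact ⟨p, hp, hpr, fun w hw h' => h (w, e n w) ⟨hw, rfl⟩ h'.1 h'.2⟩
    obtain ⟨n₀, p₀, -⟩ := hcon'.exists
    have : Nonempty (ℂ × PN N) := ⟨p₀⟩
    choose! p hp using fun n (h : ∃ p ∈ Γ, ‖p.1‖ ≤ r ∧
        ∀ w ∈ ball (0 : ℂ) 1, ¬ (‖p.1 - w‖ < ε ∧ pdist p.2 (e n w) < ε)) => h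
    obtain ⟨z', hz', hzz⟩ := hlim (hcon'.mono fun n hn => (hp n hn).2.1)
    obtain ⟨q, hq⟩ := exists_pTendsto U fun n => (p n).2
    -- Each point of Γ is only a limit of values of `e n`, without uniformity. So one point `p i`
    -- near the common limit is fixed and approximated by graph points; these are then also close to
    -- `p n` for suitable `n`.
    obtain ⟨i, hi1, hi2, hi3⟩ := (hcon'.and ((Metric.tendsto_nhds.1 hzz (ε / 4) (by positivity)).and
      (hq.lt (by positivity : 0 < ε / 4)))).exists
    obtain ⟨hib, hiR⟩ := (hΓ _).1 (hp i hi1).1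
    obtain ⟨w, hw, hwq⟩ := (hR _ hib).2 _ hiR
    obtain ⟨n, h1, h2, h3, h4, h5, h6⟩ := (hcon'.and ((Metric.tendsto_nhds.1 hzz (ε / 4)
      (by positivity)).and ((hq.lt (by positivity : 0 < ε / 4)).and
      ((Metric.tendsto_nhds.1 hw (ε / 4) (by positivity)).and
      ((hwq.lt (by positivity : 0 < ε / 4)).and (hw (isOpen_ball.mem_nhds hib))))))).exists
    refine (hp n h1).2.2 (w n) h6 ⟨?_, ?_⟩
    · rw [← dist_eq_norm]
      have e1 := dist_triangle (p n).1 z' (w n)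
      have e2 := dist_triangle z' (p i).1 (w n)
      rw [dist_comm z' (p i).1] at e2
      rw [dist_comm (p i).1 (w n)] at e2
      linarith
    · have e1 := pdist_triangle (p n).2 q (e n (w n))
      have e2 := pdist_triangle q (p i).2 (e n (w n))
      rw [pdist_comm q (p i).2] at e2
      rw [pdist_comm (p i).2 (e n (w n))] at e2
      linarith

theorem NearOver.mono {r r' ε ε' : ℝ} {Γ Γ' : Set (ℂ × PN N)} (h : NearOver r ε Γ Γ')
    (hr : r' ≤ r) (hε : ε ≤ ε') : NearOver r' ε' Γ Γ' := by
  intro p hp hpr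
  obtain ⟨q, hq, h1, h2⟩ := h p hp (hpr.trans hr)
  exact ⟨q, hq, h1.trans_le hε, h2.trans_le hε⟩

/-- The only passage from ultrafilter to subsequence: the k-th term is chosen good on radius 1 -
1/(k+1) with error 1/(k+1). -/
theorem exists_graphTendsto {e : ℕ → ℂ → PN N} {l : Filter ℕ} [l.NeBot] (hl : l ≤ atTop)
    {Γ : Set (ℂ × PN N)} (h : ∀ r < (1 : ℝ), ∀ ε > (0 : ℝ), ∀ᶠ n in l,
      NearOver r ε (discGraph (e n)) Γ ∧ NearOver r ε Γ (discGraph (e n))) :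
    ∃ φ : ℕ → ℕ, StrictMono φ ∧ GraphTendsto (fun n => discGraph (e (φ n))) Γ := by
  obtain ⟨φ, hφ, hP⟩ := extraction_forall_of_frequently (P := fun k n =>
    NearOver (1 - 1 / ((k : ℝ) + 1)) (1 / ((k : ℝ) + 1)) (discGraph (e n)) Γ ∧
      NearOver (1 - 1 / ((k : ℝ) + 1)) (1 / ((k : ℝ) + 1)) Γ (discGraph (e n))) (fun k =>
      ((h _ (by rw [sub_lt_self_iff]; positivity) _ (by positivity)).frequently).filter_mono hl)
  refine ⟨φ, hφ, fun r hr ε hε => ?_⟩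
  have h0 := tendsto_one_div_add_atTop_nhds_zero_nat (𝕜 := ℝ)
  filter_upwards [h0.eventually_lt_const hε, h0.eventually_lt_const (sub_pos.2 hr)] with n h1 h2
  exact ⟨(hP n).1.mono (by linarith) h1.le, (hP n).2.mono (by linarith) h1.le⟩

/-- The maps `e n` converge continuously at `w` to `q` along `U`. -/
def PLimit (e : ℕ → ℂ → PN N) (U : Ultrafilter ℕ) (w : ℂ) (q : PN N) : Prop :=
  ∀ z : ℕ → ℂ, Tendsto z U (𝓝 w) → PTendsto (fun n => e n (z n)) U q

/-- Near `z` the maps `e n` have lifts that converge along `U` to a map which is not zero. -/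
def HasLocalLimit (X : Set (PN N)) (e : ℕ → ℂ → PN N) (U : Ultrafilter ℕ) (z : ℂ) : Prop :=
  ∃ ρ > 0, ∃ (A : ℕ → ℂ → Cn N) (A' : ℂ → Cn N),
    (∀ᶠ n in (U : Filter ℕ), DifferentiableOn ℂ (A n) (ball z ρ) ∧ ∀ w ∈ ball z ρ,
      ∃ h : A n w ≠ 0, e n w = Projectivization.mk ℂ (A n w) h ∧ e n w ∈ X) ∧
    (∀ w ∈ ball z ρ, CTendsto A U w (A' w)) ∧ AnalyticAt ℂ A' z ∧ ¬ ∀ᶠ w in 𝓝 z, A' w = 0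

/-- The order of vanishing of the limiting lift at `z` decides: order 0 gives continuous
convergence, positive order a bubble tree. In both cases nearby points are regular, which makes the
nodes discrete. -/
theorem HasLocalLimit.exists_limitSet {X : Set (PN N)} (hX : IsZariskiClosed X)
    {e : ℕ → ℂ → PN N} {U : Ultrafilter ℕ} (hU : (U : Filter ℕ) ≤ atTop) {z : ℂ}
    (h : HasLocalLimit X e U z) : ∃ (G : ℂ → Cn N) (hG : G z ≠ 0) (R : Set (PN N)),
      AnalyticAt ℂ G z ∧ Projectivization.mk ℂ (G z) hG ∈ R ∧ IsLimitSet e U z R ∧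
      (R = {Projectivization.mk ℂ (G z) hG} ∨ IsBubbleTree X (Projectivization.mk ℂ (G z) hG) R) ∧
      ∀ᶠ w in 𝓝[≠] z, ∃ h : G w ≠ 0, PLimit e U w (Projectivization.mk ℂ (G w) h) := by
  obtain ⟨ρ, hρ, A, A', hA, hAc, hA', hne⟩ := h
  obtain ⟨k, G, hG, hG0, hAG⟩ := exists_red_factor hA' hne
  have hlim : ∀ w ∈ ball z ρ, ∀ h : A' w ≠ 0, PLimit e U w (Projectivization.mk ℂ (A' w) h) := by
    intro w hw h x hx
    refine pTendsto_mk h ?_ (hAc w hw x hx)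
    filter_upwards [hA, hx (isOpen_ball.mem_nhds hw)] with n h1 h2
    obtain ⟨h3, h4, -⟩ := h1.2 _ h2
    exact ⟨h3, h4⟩
  have hpunc : ∀ᶠ w in 𝓝[≠] z, ∃ h : G w ≠ 0, PLimit e U w (Projectivization.mk ℂ (G w) h) := by
    filter_upwards [nhdsWithin_le_nhds hAG, nhdsWithin_le_nhds (ball_mem_nhds z hρ),
      nhdsWithin_le_nhds (hG.continuousAt.eventually_ne hG0), self_mem_nhdsWithin]
      with w h1 h2 h3 h4
    refine ⟨h3, ?_⟩
    have h5 : A' w ≠ 0 := by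
      rw [h1]; exact smul_ne_zero (pow_ne_zero _ (sub_ne_zero.2 h4)) h3
    have h6 : Projectivization.mk ℂ (G w) h3 = Projectivization.mk ℂ (A' w) h5 :=
      ((Projectivization.mk_eq_mk_iff' ℂ _ _ _ _).2 ⟨_, h1.symm⟩).symm
    rw [h6]
    exact hlim w h2 h5
  rcases Nat.eq_zero_or_pos k with rfl | hk
  · refine ⟨G, hG0, _, hG, mem_singleton _, ⟨fun x hx => ⟨_, mem_singleton _, ?_⟩, ?_⟩, Or.inl rfl,
      hpunc⟩
    all_goals
      have h1 : A' z = G z := by simpa using hAG.self_of_nhds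
      have h2 : PLimit e U z (Projectivization.mk ℂ (G z) hG0) := by
        have := hlim z (mem_ball_self hρ) (by rw [h1]; exact hG0)
        simpa only [h1] using this
    · exact h2 x hx
    · rintro q rfl
      exact ⟨_, tendsto_const_nhds, h2 (fun _ => z) tendsto_const_nhds⟩
  · obtain ⟨δ, hδ, hball⟩ := Metric.eventually_nhds_iff_ball.1 (hAG.and hG.eventually_analyticAt)
    have hs1 : ball z (min ρ δ) ⊆ ball z ρ := ball_subset_ball (min_le_left _ _)
    have hs2 : ball z (min ρ δ) ⊆ ball z δ := ball_subset_ball (min_le_right _ _)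
    obtain ⟨R, hR1, hR2⟩ := exists_bubbleTree hX hU k (f := e) (F := A) (G := G) (c := z)
      (ρ := min ρ δ) (lt_min hρ hδ) hk
      (hA.mono fun n hn => ⟨hn.1.mono hs1, fun w hw => hn.2 w (hs1 hw)⟩)
      (fun w hw => (hball w (hs2 hw)).2.differentiableAt.differentiableWithinAt) hG0
      (fun w hw => by rw [← (hball w (hs2 hw)).1]; exact hAc w (hs1 hw))
    exact ⟨G, hG0, R, hG, hR1.mem, hR2, Or.inr hR1, hpunc⟩

/-- A sequence of discs whose lifts converge locally along an ultrafilter has a subsequence that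
converges to a disc with bubbles. -/
theorem hasConvergentSubseq_of_hasLocalLimit {X : Set (PN N)} (hX : IsZariskiClosed X)
    {e : ℕ → ℂ → PN N} (he : ∀ n, IsHolDisc X (e n)) {U : Ultrafilter ℕ}
    (hU : (U : Filter ℕ) ≤ atTop) (h : ∀ z ∈ ball (0 : ℂ) 1, HasLocalLimit X e U z) :
    HasConvergentSubseq X e := by
  have key := fun z (hz : z ∈ ball (0 : ℂ) 1) => (h z hz).exists_limitSet hX hU
  have hex : ∀ z, ∃ (G : ℂ → Cn N) (x : PN N) (R : Set (PN N)), z ∈ ball (0 : ℂ) 1 →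
      (∃ hG : G z ≠ 0, x = Projectivization.mk ℂ (G z) hG) ∧ AnalyticAt ℂ G z ∧
      x ∈ R ∧ IsLimitSet e U z R ∧ (R = {x} ∨ IsBubbleTree X x R) ∧
      ∀ᶠ w in 𝓝[≠] z, ∃ h : G w ≠ 0, PLimit e U w (Projectivization.mk ℂ (G w) h) := by
    intro z
    by_cases hz : z ∈ ball (0 : ℂ) 1
    · obtain ⟨G, hG, R, h1, h2, h3, h4, h5⟩ := key z hz
      exact ⟨G, _, R, fun _ => ⟨⟨hG, rfl⟩, h1, h2, h3, h4, h5⟩⟩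
    · exact ⟨fun _ => 0, e 0 0, ∅, fun h => absurd h hz⟩
  choose G x R hG using hex
  -- Local limit data at different points are chosen independently; uniqueness of limits makes them
  -- agree on punctured neighbourhoods, so `x` is one holomorphic map.
  have huniq : ∀ {z}, z ∈ ball (0 : ℂ) 1 → ∀ {q}, PLimit e U z q → x z = q ∧ R z = {x z} := by
    intro z hz q hq
    obtain ⟨-, -, h1, h2, -, -⟩ := hG z hz
    have h3 : ∀ q' ∈ R z, q' = q := by
      intro q' hq'
      obtain ⟨w, hw, hwq⟩ := h2.2 q' hq'
      exact hwq.unique (hq w hw)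
    refine ⟨h3 _ h1, ?_⟩
    ext q'
    refine ⟨fun hq' => ?_, ?_⟩
    · rw [mem_singleton_iff, h3 _ hq', h3 _ h1]
    · rintro rfl; exact h1
  have hlift : ∀ z ∈ ball (0 : ℂ) 1, IsLift x z (G z) := by
    intro z hz
    obtain ⟨⟨h0, h1⟩, h2, -, -, -, h3⟩ := hG z hz
    refine ⟨h2, ?_⟩
    filter_upwards [eventually_nhdsWithin_iff.1 h3, isOpen_ball.mem_nhds hz] with w h4 h5
    by_cases hw : w = z
    · subst hw; exact ⟨h0, h1⟩
    · obtain ⟨h6, h7⟩ := h4 hw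
      exact ⟨h6, (huniq h5 h7).1⟩
  have hxX : ∀ z ∈ ball (0 : ℂ) 1, x z ∈ X := by
    intro z hz
    obtain ⟨-, -, h1, h2, -⟩ := hG z hz
    obtain ⟨w, hw, hwq⟩ := h2.2 _ h1
    refine hX.mem_of_pTendsto hwq (Eventually.frequently ?_)
    filter_upwards [hw (isOpen_ball.mem_nhds hz)] with n hn using (he n _ hn).2
  let b : BubbledDisc X :=
    { main := x
      hol := fun z hz => ⟨⟨G z, hlift z hz⟩, hxX z hz⟩
      nodes := {z | z ∈ ball (0 : ℂ) 1 ∧ R z ≠ {x z}}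
      nodes_sub := fun z hz => hz.1
      nodes_finite := by
        intro r hr
        by_contra hinf
        obtain ⟨z, hz, hacc⟩ := Set.Infinite.exists_accPt_of_subset_isCompact
          (hs := hinf) (isCompact_closedBall (0 : ℂ) r) inter_subset_right
        have h1 := accPt_iff_frequently_nhdsNE.1 hacc
        obtain ⟨-, -, -, -, -, h2⟩ := hG z (closedBall_subset_ball hr hz)
        obtain ⟨w, h3, h4, h5⟩ := (h1.and_eventually h2).exists
        exact h3.1.2 (huniq h3.1.1 h5).2
      bubble := R
      bubble_tree := fun z hz => (hG z hz.1).2.2.2.2.1.resolve_left hz.2 }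
  obtain ⟨φ, hφ, hφ'⟩ := exists_graphTendsto (e := e) hU (Γ := b.graph) fun r hr ε hε =>
    eventually_nearOver (fun z hz => (hG z hz).2.2.2.1) (fun p => by
      constructor
      · rintro (⟨h1, h2⟩ | ⟨h1, h2⟩)
        · exact ⟨h1, by rw [h2]; exact (hG _ h1).2.2.1⟩
        · exact ⟨h1.1, h2⟩
      · rintro ⟨h1, h2⟩
        by_cases h3 : R p.1 = {x p.1}
        · rw [h3] at h2
          exact Or.inl ⟨h1, h2⟩
        · exact Or.inr ⟨⟨h1, h3⟩, h2⟩) hr hε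
  exact ⟨φ, hφ, b, hφ'⟩

/-! ### Normalised lifts -/

/-- Continuous functions on a circle are approximated by real parts of entire functions. -/
theorem exists_entire_re_near {φ : ℂ → ℝ} {r : ℝ} (hr : 0 < r) (hφ : ContinuousOn φ (sphere 0 r))
    {ε : ℝ} (hε : 0 < ε) :
    ∃ h : ℂ → ℂ, Differentiable ℂ h ∧ ∀ z ∈ sphere (0 : ℂ) r, |(h z).re - φ z| < ε := by
  have : Fact (0 < 2 * Real.pi) := ⟨Real.two_pi_pos⟩
  have hr' : (r : ℂ) ≠ 0 := by exact_mod_cast hr.ne'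
  set κ : AddCircle (2 * Real.pi) → ℂ := fun x => r * fourier 1 x
  have hκr : ∀ x, κ x ∈ sphere (0 : ℂ) r := by
    intro x
    simp [κ, fourier_apply, abs_of_pos hr, Circle.norm_coe]
  have hκ : Continuous κ := by fun_prop
  have hpow : ∀ (n : ℕ) x, fourier (n : ℤ) x = (κ x / r) ^ n := by
    intro n x
    rw [mul_div_cancel_left₀ _ hr']
    induction n with
    | zero => simp
    | succ n ih => rw [Nat.cast_succ, fourier_add, ih, pow_succ]
  let ψ : C(AddCircle (2 * Real.pi), ℂ) :=
    ⟨fun x => (φ (κ x) : ℂ), Complex.continuous_ofReal.comp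
      (hφ.comp_continuous hκ hκr)⟩
  have hmem : ψ ∈ closure (Submodule.span ℂ (range (@fourier (2 * Real.pi))) :
      Set C(AddCircle (2 * Real.pi), ℂ)) := by
    rw [← Submodule.topologicalClosure_coe, span_fourier_closure_eq_top]
    trivial
  obtain ⟨p, hp, hpψ⟩ := Metric.mem_closure_iff.1 hmem ε hε
  have hent : ∃ h : ℂ → ℂ, Differentiable ℂ h ∧ ∀ x, (h (κ x)).re = (p x).re := by
    have hp' : p ∈ Submodule.span ℂ (range (@fourier (2 * Real.pi))) := hp
    clear hpψ hp
    -- A negative frequency is the conjugate of a positive one, so conjugating the whole term gives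
    -- a polynomial with the same real part. All multiples `c` are kept so that the induction passes
    -- through complex scalars.
    have key : ∀ c : ℂ, ∃ h : ℂ → ℂ, Differentiable ℂ h ∧ ∀ x, (h (κ x)).re = ((c • p) x).re := by
      induction hp' using Submodule.span_induction with
      | mem p hp =>
        obtain ⟨n, rfl⟩ := hp
        intro c
        obtain ⟨k, rfl | rfl⟩ := n.eq_nat_or_neg
        · refine ⟨fun z => c * (z / r) ^ k, by fun_prop, fun x => ?_⟩
          rw [ContinuousMap.smul_apply, hpow, smul_eq_mul]
        · refine ⟨fun z => starRingEnd ℂ c * (z / r) ^ k, by fun_prop, fun x => ?_⟩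
          rw [ContinuousMap.smul_apply, fourier_neg, hpow, smul_eq_mul, ← Complex.conj_re]
          simp only [map_mul, Complex.conj_conj]
      | zero => exact fun c => ⟨fun _ => 0, by fun_prop, by simp⟩
      | add p q _ _ hp hq =>
        intro c
        obtain ⟨h1, d1, e1⟩ := hp c
        obtain ⟨h2, d2, e2⟩ := hq c
        refine ⟨fun z => h1 z + h2 z, d1.add d2, fun x => ?_⟩
        rw [smul_add, ContinuousMap.add_apply, Complex.add_re, Complex.add_re, e1, e2]
      | smul a p _ hp =>
        intro c
        obtain ⟨h, d, e⟩ := hp (c * a)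
        exact ⟨h, d, fun x => by rw [e, smul_smul]⟩
    simpa using key 1
  obtain ⟨h, hd, he⟩ := hent
  refine ⟨h, hd, fun z hz => ?_⟩
  obtain ⟨x, rfl⟩ : ∃ x, κ x = z := by
    refine ⟨(Complex.arg z : ℝ), ?_⟩
    have hz' : ‖z‖ = r := by simpa using hz
    have h1 : κ (Complex.arg z : ℝ) = r * Complex.exp (Complex.arg z * Complex.I) := by
      simp only [κ]
      rw [fourier_coe_apply]
      congr 2
      have : (Real.pi : ℂ) ≠ 0 := by exact_mod_cast Real.pi_ne_zero
      push_cast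
      field_simp
    rw [h1, ← hz', Complex.norm_mul_exp_arg_mul_I]
  have h1 := (ContinuousMap.dist_apply_le_dist x).trans_lt hpψ
  rw [dist_comm, dist_eq_norm] at h1
  have h2 := (Complex.abs_re_le_norm _).trans_lt h1
  rw [Complex.sub_re, ← he x] at h2
  exact h2

/-- A lift may be multiplied by exp h, with Re h within 1 of -log‖F‖ on the circle. The maximum
principle then bounds the new lift by e, and Jensen's formula bounds its norm at 0 below: the mean
of its logarithm is at least -1 and exceeds the value at 0 by at most kM + C. -/
theorem exists_normalized_lift {X : Set (PN N)} (hX : IsZariskiClosed X) {k : ℕ} (hk : 0 < k)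
    {m : Cn N → ℝ} (hm : IsMetricO1 X m) {ηH : Form11 N} (hηH : IsAmpleChernForm X k m ηH)
    {r : ℝ} (h0 : 0 < r) (hr : r < 1) (M : ℝ) :
    ∃ δ > 0, ∃ C, ∀ f : ℂ → PN N, IsHolDisc X f → discDegree ηH f r ≤ M → ∃ F : ℂ → Cn N,
      (∀ z ∈ ball (0 : ℂ) r, IsLift f z F) ∧ (∀ z ∈ ball (0 : ℂ) r, ‖F z‖ ≤ C) ∧ δ ≤ ‖F 0‖ := by
  obtain ⟨C, hC0, hC⟩ := exists_energy_bound hX hk hm hηH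
  refine ⟨Real.exp (-1 - k * M - C), Real.exp_pos _, Real.exp 1, fun f hf hM => ?_⟩
  obtain ⟨s, hrs, hs⟩ := exists_between hr
  obtain ⟨F, hF⟩ := exists_lift (fun z hz => (hf z hz).1) hs
  have hsub : closedBall (0 : ℂ) r ⊆ closedBall 0 s := closedBall_subset_closedBall hrs.le
  have hFc : ∀ z ∈ closedBall (0 : ℂ) s, ContinuousAt F z := fun z hz => (hF z hz).1.continuousAt
  obtain ⟨h, hd, hh⟩ := exists_entire_re_near (φ := fun z => - Real.log ‖F z‖) h0 (by
    intro z hz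
    have hz' := hsub (sphere_subset_closedBall hz)
    exact (((hFc z hz').norm.log (norm_ne_zero_iff.2 (hF z hz').ne_zero)).neg).continuousWithinAt)
    one_pos
  set F' : ℂ → Cn N := fun z => Complex.exp (h z) • F z
  have hF' : ∀ z ∈ closedBall (0 : ℂ) s, IsLift f z F' := fun z hz =>
    (hF z hz).smul (hd.analyticAt z).cexp (Complex.exp_ne_zero _)
  have hlog : ∀ z ∈ closedBall (0 : ℂ) s, Real.log ‖F' z‖ = (h z).re + Real.log ‖F z‖ := by
    intro z hz
    rw [norm_smul, Complex.norm_exp, Real.log_mul (Real.exp_ne_zero _)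
      (norm_ne_zero_iff.2 (hF z hz).ne_zero), Real.log_exp]
  have hbd : ∀ z ∈ sphere (0 : ℂ) r, |Real.log ‖F' z‖| ≤ 1 := by
    intro z hz
    rw [hlog z (hsub (sphere_subset_closedBall hz))]
    have := (hh z hz).le
    rwa [sub_neg_eq_add] at this
  refine ⟨F', fun z hz => hF' z (hsub (ball_subset_closedBall hz)), ?_, ?_⟩
  · obtain ⟨ζ, hζ, hmax⟩ := exists_mem_sphere_norm_le (g := F') h0 hrs (fun z hz =>
      (hF' z (ball_subset_closedBall hz)).1.differentiableAt.differentiableWithinAt)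
    intro z hz
    refine (hmax z (ball_subset_closedBall hz)).trans ?_
    have h1 := (abs_le.1 (hbd ζ hζ)).2
    have h2 := norm_pos_iff.2 (hF' ζ (hsub (sphere_subset_closedBall hζ))).ne_zero
    exact (Real.log_le_iff_le_exp h2).1 h1
  · have h1 := abs_le.1 (hC f F' s r hf hs hF' h0 hrs)
    have hr' : |r| = r := abs_of_pos h0
    have hint : CircleIntegrable (fun z => Real.log ‖F' z‖) 0 r := by
      refine ContinuousOn.circleIntegrable h0.le fun z hz => ?_
      have := hF' z (hsub (sphere_subset_closedBall hz))
      exact (this.1.continuousAt.norm.log (norm_ne_zero_iff.2 this.ne_zero)).continuousWithinAt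
    have h2 : -1 ≤ Real.circleAverage (fun z => Real.log ‖F' z‖) 0 r := by
      rw [← Real.circleAverage_const (-1 : ℝ) 0 r]
      refine Real.circleAverage_mono (circleIntegrable_const _ _ _) hint fun z hz => ?_
      rw [hr'] at hz
      exact (abs_le.1 (hbd z hz)).1
    have h3 : (k : ℝ) * discDegree ηH f r ≤ k * M := by gcongr
    have h4 := norm_pos_iff.2 (hF' 0 (mem_closedBall_self (h0.trans hrs).le)).ne_zero
    rw [← Real.le_log_iff_exp_le h4]
    linarith [h1.2]

/-- Montel's theorem along an ultrafilter. -/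
theorem exists_cTendsto {U : Ultrafilter ℕ} {F : ℕ → ℂ → Cn N} {r C : ℝ}
    (hd : ∀ᶠ n in (U : Filter ℕ), DifferentiableOn ℂ (F n) (ball 0 r))
    (hC : ∀ᶠ n in (U : Filter ℕ), ∀ z ∈ ball (0 : ℂ) r, ‖F n z‖ ≤ C) :
    ∃ G : ℂ → Cn N, DifferentiableOn ℂ G (ball 0 r) ∧ ∀ w ∈ ball (0 : ℂ) r, CTendsto F U w (G w) := by
  have hlim : ∀ w, ∃ v, w ∈ ball (0 : ℂ) r → Tendsto (fun n => F n w) U (𝓝 v) := by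
    intro w
    by_cases hw : w ∈ ball (0 : ℂ) r
    · obtain ⟨v, -, hv⟩ := exists_tendsto_of_eventually_mem (isCompact_closedBall (0 : Cn N) C) U
        (v := fun n => F n w) (hC.mono fun n hn => by simpa using hn w hw)
      exact ⟨v, fun _ => hv⟩
    · exact ⟨0, fun h => absurd h hw⟩
  choose G hG using hlim
  have hlip : ∀ w ∈ ball (0 : ℂ) r, ∃ ρ > 0, ball w ρ ⊆ ball 0 r ∧ ∃ K, ∀ᶠ n in (U : Filter ℕ),
      ∀ y ∈ ball w ρ, dist (F n y) (F n w) ≤ K * dist y w := by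
    intro w hw
    obtain ⟨ρ, hρ, hsub⟩ := Metric.isOpen_ball.mem_nhds hw |> Metric.mem_nhds_iff.1
    refine ⟨ρ, hρ, hsub, (C + C) / ρ, ?_⟩
    filter_upwards [hd, hC] with n h1 h2 y hy
    -- The Schwarz lemma makes the family equi-Lipschitz at `w`, so pointwise limits along the
    -- ultrafilter are locally uniform.
    refine Complex.dist_le_div_mul_dist_of_mapsTo_ball (h1.mono hsub) (fun x hx => ?_) hy
    rw [mem_closedBall, dist_eq_norm]
    exact (norm_sub_le _ _).trans (add_le_add (h2 x (hsub hx)) (h2 w hw))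
  have hlipG : ∀ w ∈ ball (0 : ℂ) r, ∃ ρ > 0, ball w ρ ⊆ ball 0 r ∧ ∃ K,
      (∀ᶠ n in (U : Filter ℕ), ∀ y ∈ ball w ρ, dist (F n y) (F n w) ≤ K * dist y w) ∧
      ∀ y ∈ ball w ρ, dist (G y) (G w) ≤ K * dist y w := by
    intro w hw
    obtain ⟨ρ, hρ, hsub, K, hK⟩ := hlip w hw
    refine ⟨ρ, hρ, hsub, K, hK, fun y hy => ?_⟩
    refine le_of_tendsto ((hG y (hsub hy)).dist (hG w hw)) ?_
    filter_upwards [hK] with n hn using hn y hy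
  refine ⟨G, ?_, ?_⟩
  · have hloc : TendstoLocallyUniformlyOn F G U (ball 0 r) := by
      refine Metric.tendstoLocallyUniformlyOn_iff.2 fun ε hε w hw => ?_
      obtain ⟨ρ, hρ, hsub, K, hK, hKG⟩ := hlipG w hw
      have h0 : Tendsto (fun y => K * dist y w) (𝓝 w) (𝓝 0) := by
        have : ContinuousAt (fun y => K * dist y w) w := by fun_prop
        simpa [ContinuousAt] using this
      have h1 : ∀ᶠ y in 𝓝 w, y ∈ ball w ρ ∧ K * dist y w < ε / 3 :=
        Filter.Eventually.and (ball_mem_nhds w hρ)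
          (h0.eventually_lt_const (by positivity))
      refine ⟨{y | y ∈ ball w ρ ∧ K * dist y w < ε / 3}, nhdsWithin_le_nhds h1, ?_⟩
      filter_upwards [hK, Metric.tendsto_nhds.1 (hG w hw) (ε / 3) (by positivity)] with n h2 h3 y hy
      have e1 := dist_triangle (G y) (G w) (F n y)
      have e2 := dist_triangle (G w) (F n w) (F n y)
      rw [dist_comm (G w) (F n w), dist_comm (F n w) (F n y)] at e2
      have e3 := h2 y hy.1
      have e4 := hKG y hy.1
      have := hy.2
      linarith
    exact hloc.differentiableOn hd isOpen_ball
  · intro w hw z hz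
    obtain ⟨ρ, hρ, hsub, K, hK⟩ := hlip w hw
    have h1 : Tendsto (fun n => K * dist (z n) w) U (𝓝 0) := by
      simpa using (tendsto_iff_dist_tendsto_zero.1 hz).const_mul K
    have h2 := h1.add (tendsto_iff_dist_tendsto_zero.1 (hG w hw))
    rw [add_zero] at h2
    refine tendsto_iff_dist_tendsto_zero.2 (squeeze_zero' (Eventually.of_forall fun _ =>
      dist_nonneg) ?_ h2)
    filter_upwards [hK, hz (ball_mem_nhds w hρ)] with n h3 h4
    exact (dist_triangle _ (F n w) _).trans (add_le_add_left (h3 _ h4) _)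

/-! ### Automorphisms of the disc -/

/-- The automorphism of the unit disc that sends `0` to `a`. -/
noncomputable def mobius (a w : ℂ) : ℂ := (w + a) / (1 + starRingEnd ℂ a * w)

theorem one_add_conj_mul_ne_zero {a w : ℂ} (ha : ‖a‖ < 1) (hw : ‖w‖ < 1) :
    1 + starRingEnd ℂ a * w ≠ 0 := by
  intro h
  have h1 : ‖starRingEnd ℂ a * w‖ = 1 := by
    rw [eq_neg_of_add_eq_zero_right h, norm_neg, norm_one]
  rw [norm_mul, RCLike.norm_conj] at h1
  nlinarith [norm_nonneg a, norm_nonneg w]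

theorem norm_mobius_lt {a w : ℂ} (ha : ‖a‖ < 1) (hw : ‖w‖ < 1) : ‖mobius a w‖ < 1 := by
  have h0 := norm_pos_iff.2 (one_add_conj_mul_ne_zero ha hw)
  rw [mobius, norm_div, div_lt_one h0]
  refine lt_of_pow_lt_pow_left₀ 2 h0.le ?_
  have h1 : Complex.normSq a < 1 := by
    rw [Complex.normSq_eq_norm_sq]; exact pow_lt_one₀ (norm_nonneg _) ha two_ne_zero
  have h2 : Complex.normSq w < 1 := by
    rw [Complex.normSq_eq_norm_sq]; exact pow_lt_one₀ (norm_nonneg _) hw two_ne_zero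
  rw [← Complex.normSq_eq_norm_sq, ← Complex.normSq_eq_norm_sq]
  simp only [Complex.normSq_apply] at h1 h2 ⊢
  simp only [Complex.add_re, Complex.add_im, Complex.mul_re, Complex.mul_im, Complex.conj_re,
    Complex.conj_im, Complex.one_re, Complex.one_im]
  nlinarith [mul_pos (sub_pos.2 h1) (sub_pos.2 h2)]

theorem mobius_neg_mobius {a w : ℂ} (ha : ‖a‖ < 1) (hw : ‖w‖ < 1) :
    mobius (-a) (mobius a w) = w := by
  have h0 := one_add_conj_mul_ne_zero ha hw
  have h1 : 1 + starRingEnd ℂ (-a) * mobius a w ≠ 0 :=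
    one_add_conj_mul_ne_zero (by rwa [norm_neg]) (norm_mobius_lt ha hw)
  have e : mobius a w * (1 + starRingEnd ℂ a * w) = w + a := div_mul_cancel₀ _ h0
  rw [mobius, div_eq_iff h1, map_neg]
  apply mul_right_cancel₀ h0
  linear_combination (1 + starRingEnd ℂ a * w) * e

theorem isDiscAut_mobius {a : ℂ} (ha : ‖a‖ < 1) : IsDiscAut (mobius a) (mobius (-a)) := by
  have hd : ∀ {a : ℂ}, ‖a‖ < 1 → DifferentiableOn ℂ (mobius a) (ball 0 1) := by
    intro a ha
    refine DifferentiableOn.div (by fun_prop) (by fun_prop) fun w hw => ?_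
    exact one_add_conj_mul_ne_zero ha (by simpa using hw)
  have hm : ∀ {a : ℂ}, ‖a‖ < 1 → MapsTo (mobius a) (ball 0 1) (ball 0 1) := by
    intro a ha w hw
    simpa using norm_mobius_lt ha (by simpa using hw)
  have ha' : ‖-a‖ < 1 := by rwa [norm_neg]
  refine ⟨hd ha, hd ha', hm ha, hm ha', fun z hz => mobius_neg_mobius ha (by simpa using hz),
    fun z hz => ?_⟩
  have := mobius_neg_mobius ha' (w := z) (by simpa using hz)
  rwa [neg_neg] at this

theorem tendstoLocallyUniformlyOn_mobius {a : ℕ → ℂ} {a' : ℂ} (ha : Tendsto a atTop (𝓝 a'))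
    (ha' : ‖a'‖ < 1) :
    TendstoLocallyUniformlyOn (fun n => mobius (a n)) (mobius a') atTop (ball 0 1) := by
  refine tendstoLocallyUniformlyOn_iff_forall_tendsto.2 fun w hw => ?_
  have h0 := one_add_conj_mul_ne_zero ha' (w := w) (by simpa using hw)
  have h1 : Tendsto (fun y : ℕ × ℂ => y.2) (atTop ×ˢ 𝓝[ball 0 1] w) (𝓝 w) :=
    tendsto_snd.mono_right nhdsWithin_le_nhds
  have h2 : Tendsto (fun y : ℕ × ℂ => a y.1) (atTop ×ˢ 𝓝[ball 0 1] w) (𝓝 a') :=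
    ha.comp tendsto_fst
  have key : ∀ {b : ℕ × ℂ → ℂ}, Tendsto b (atTop ×ˢ 𝓝[ball 0 1] w) (𝓝 a') →
      Tendsto (fun y : ℕ × ℂ => mobius (b y) y.2) (atTop ×ˢ 𝓝[ball 0 1] w) (𝓝 (mobius a' w)) := by
    intro b hb
    refine (h1.add hb).div (Tendsto.const_add 1 (Tendsto.mul ?_ h1)) h0
    exact (Complex.continuous_conj.tendsto a').comp hb
  refine Tendsto.mono_right ?_ (nhds_le_uniformity (mobius a' w))
  rw [nhds_prod_eq]
  exact (key tendsto_const_nhds).prodMk (key h2)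

/-! ### Normalised sequences -/

/-- Failure of closeness gives points of a fixed compact disc whose images are at distance at least
`ε` from `Z`. Möbius maps carry 0 to these points, and they converge along a subsequence since the
points stay off the unit circle. -/
theorem exists_isNormalization {f : ℕ → ℂ → PN N} {Z : Set (PN N)} (h : ¬ ArbitrarilyClose f Z) :
    ∃ g, IsNormalization f Z g := by
  simp only [ArbitrarilyClose, not_forall, not_eventually] at h
  obtain ⟨r, hr, ε, hε, hfreq⟩ := h
  obtain ⟨φ, hφ, hP⟩ := extraction_of_frequently_atTop hfreq
  have hP' : ∀ n, ∃ z, ‖z‖ ≤ r ∧ ∀ q ∈ Z, ε ≤ pdist (f (φ n) z) q := by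
    intro n
    have := hP n
    push Not at this
    simpa only [exists_prop] using this
  choose z hz hzZ using hP'
  obtain ⟨a, ha, ψ, hψ, hlim⟩ := (isCompact_closedBall (0 : ℂ) r).tendsto_subseq (x := z)
    fun n => by simpa using hz n
  have ha' : ‖a‖ < 1 := lt_of_le_of_lt (by simpa using ha) hr
  have hz' : ∀ n, ‖z (ψ n)‖ < 1 := fun n => (hz _).trans_lt hr
  refine ⟨fun n w => f (φ (ψ n)) (mobius (z (ψ n)) w), φ ∘ ψ, hφ.comp hψ,
    ⟨fun n => mobius (z (ψ n)), fun n => mobius (-z (ψ n)), mobius a, mobius (-a),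
      fun n => isDiscAut_mobius (hz' n), isDiscAut_mobius ha',
      tendstoLocallyUniformlyOn_mobius hlim ha',
      tendstoLocallyUniformlyOn_mobius hlim.neg (by rwa [norm_neg]), fun n w _ => rfl⟩,
    ε, hε, fun n q hq => ?_⟩
  have : mobius (z (ψ n)) 0 = z (ψ n) := by simp [mobius]
  simpa only [this] using hzZ _ q hq

theorem IsHolDisc.of_comp {Y : Set (PN N)} {f g : ℂ → PN N} (hf : IsHolDisc Y f) {α : ℂ → ℂ}
    (hα : DifferentiableOn ℂ α (ball 0 1)) (hm : MapsTo α (ball 0 1) (ball 0 1))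
    (hg : ∀ z ∈ ball (0 : ℂ) 1, g z = f (α z)) : IsHolDisc Y g := by
  intro z hz
  obtain ⟨⟨F, hF⟩, h2⟩ := hf _ (hm hz)
  refine ⟨⟨fun w => F (α w), ?_⟩, by rwa [hg z hz]⟩
  have h := hF.comp (hα.analyticAt (isOpen_ball.mem_nhds hz))
  refine ⟨h.1, ?_⟩
  filter_upwards [h.2, isOpen_ball.mem_nhds hz] with w ⟨h3, e⟩ hw
  exact ⟨h3, by rw [hg w hw, e]⟩

theorem IsNormalization.isHolDisc {Y Z : Set (PN N)} {f g : ℕ → ℂ → PN N}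
    (h : IsNormalization f Z g) (hf : ∀ n, IsHolDisc Y (f n)) (n : ℕ) : IsHolDisc Y (g n) := by
  obtain ⟨φ, -, ⟨α, β, α', β', hαβ, -, -, -, hg⟩, -⟩ := h
  exact (hf (φ n)).of_comp (hαβ n).hol (hαβ n).maps (hg n)

theorem exists_tendsto_or_eventually_le (u : ℕ → ℝ) :
    (∃ φ : ℕ → ℕ, StrictMono φ ∧ Tendsto (fun n => u (φ n)) atTop atTop) ∨
      ∃ M, ∀ᶠ n in atTop, u n ≤ M := by
  by_cases h : ∃ M, ∀ᶠ n in atTop, u n ≤ M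
  · exact Or.inr h
  · left
    push Not at h
    obtain ⟨φ, hφ, hu⟩ := extraction_forall_of_frequently (P := fun k n => (k : ℝ) < u n)
      fun k => h k
    exact ⟨φ, hφ, tendsto_atTop_mono (fun n => (hu n).le) tendsto_natCast_atTop_atTop⟩

/-- Bounded degrees of the `g n` give normalised lifts near 0, hence a limit G with G(0) ≠ 0.
Composition with the inverse automorphisms carries the lifts back to `f (φ n)` near `z`; the radius
`s` exceeds |β' z| to leave room. -/
theorem IsNormalization.hasLocalLimit {X : Set (PN N)} (hX : IsZariskiClosed X) {k : ℕ}
    (hk : 0 < k) {m : Cn N → ℝ} (hm : IsMetricO1 X m) {ηH : Form11 N}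
    (hηH : IsAmpleChernForm X k m ηH) {f g : ℕ → ℂ → PN N} (hf : ∀ n, IsHolDisc X (f n))
    (hgX : ∀ n, IsHolDisc X (g n)) {φ : ℕ → ℕ} {α β : ℕ → ℂ → ℂ} {α' β' : ℂ → ℂ}
    (hαβ : ∀ n, IsDiscAut (α n) (β n)) (hαβ' : IsDiscAut α' β')
    (hβ : TendstoLocallyUniformlyOn β β' atTop (ball 0 1))
    (hg : ∀ n, ∀ z ∈ ball (0 : ℂ) 1, g n z = f (φ n) (α n z))
    (hdeg : ∀ s, 0 < s → s < 1 → ∃ M, ∀ᶠ n in atTop, discDegree ηH (g n) s ≤ M)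
    {U : Ultrafilter ℕ} (hU : (U : Filter ℕ) ≤ atTop) {z : ℂ} (hz : z ∈ ball (0 : ℂ) 1) :
    HasLocalLimit X (fun n => f (φ n)) U z := by
  have hβz := hαβ'.maps_inv hz
  obtain ⟨s₁, hs₁, hs₁'⟩ := exists_between (mem_ball_zero_iff.1 hβz)
  obtain ⟨s, hs, hs'⟩ := exists_between hs₁'
  have hs0 : 0 < s := (norm_nonneg _).trans_lt (hs₁.trans hs)
  obtain ⟨M, hM⟩ := hdeg s hs0 hs'
  obtain ⟨δ, hδ, C, hlift⟩ := exists_normalized_lift hX hk hm hηH hs0 hs' M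
  have hlift' : ∀ n, ∃ F : ℂ → Cn N, discDegree ηH (g n) s ≤ M →
      (∀ z ∈ ball (0 : ℂ) s, IsLift (g n) z F) ∧ (∀ z ∈ ball (0 : ℂ) s, ‖F z‖ ≤ C) ∧
      δ ≤ ‖F 0‖ := by
    intro n
    by_cases h : discDegree ηH (g n) s ≤ M
    · obtain ⟨F, hF⟩ := hlift (g n) (hgX n) h
      exact ⟨F, fun _ => hF⟩
    · exact ⟨fun _ => 0, fun h' => absurd h' h⟩
  choose F hF using hlift'
  have hMU : ∀ᶠ n in (U : Filter ℕ), discDegree ηH (g n) s ≤ M := hU hM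
  obtain ⟨G, hGd, hGc⟩ := exists_cTendsto (U := U) (F := F) (r := s) (C := C)
    (hMU.mono fun n hn z hz => ((hF n hn).1 z hz).1.differentiableAt.differentiableWithinAt)
    (hMU.mono fun n hn => (hF n hn).2.1)
  have h0s : (0 : ℂ) ∈ ball (0 : ℂ) s := mem_ball_self hs0
  have hG0 : G 0 ≠ 0 := by
    have h1 := (hGc 0 h0s (fun _ => 0) tendsto_const_nhds).norm
    have h2 : δ ≤ ‖G 0‖ := ge_of_tendsto h1 (hMU.mono fun n hn => (hF n hn).2.2)
    exact norm_pos_iff.1 (hδ.trans_le h2)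
  have hβa : AnalyticAt ℂ β' z := hαβ'.hol_inv.analyticAt (isOpen_ball.mem_nhds hz)
  have hGa : ∀ w ∈ ball (0 : ℂ) s, AnalyticAt ℂ G w := fun w hw =>
    hGd.analyticAt (isOpen_ball.mem_nhds hw)
  have hβzs : β' z ∈ ball (0 : ℂ) s := mem_ball_zero_iff.2 (hs₁.trans hs)
  obtain ⟨ρ, hρ, hsub⟩ := Metric.nhds_basis_closedBall.mem_iff.1
    (Filter.inter_mem (isOpen_ball.mem_nhds hz)
      (hβa.continuousAt (isOpen_ball.mem_nhds (mem_ball_zero_iff.2 hs₁))))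
  have hunif := Metric.tendstoUniformlyOn_iff.1
    ((tendstoLocallyUniformlyOn_iff_forall_isCompact isOpen_ball).1 hβ (closedBall z ρ)
      (fun w hw => (hsub hw).1) (isCompact_closedBall z ρ)) (s - s₁) (sub_pos.2 hs)
  have hmaps : ∀ᶠ n in (U : Filter ℕ), ∀ w ∈ ball z ρ, β n w ∈ ball (0 : ℂ) s := by
    filter_upwards [hU hunif] with n hn w hw
    have hw' := ball_subset_closedBall hw
    have h1 := hn w hw'
    have h2 := mem_ball.1 (hsub hw').2
    rw [dist_comm] at h1
    have := dist_triangle (β n w) (β' w) 0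
    rw [mem_ball]
    linarith
  have hβ's : ∀ w ∈ ball z ρ, β' w ∈ ball (0 : ℂ) s := fun w hw =>
    ball_subset_ball hs.le (hsub (ball_subset_closedBall hw)).2
  refine ⟨ρ, hρ, fun n w => F n (β n w), fun w => G (β' w), ?_, ?_, (hGa _ hβzs).fun_comp hβa, ?_⟩
  · filter_upwards [hmaps, hMU] with n h1 h2
    refine ⟨?_, fun w hw => ?_⟩
    · have h3 : DifferentiableOn ℂ (F n) (ball 0 s) := fun z hz =>
        ((hF n h2).1 z hz).1.differentiableAt.differentiableWithinAt
      exact h3.comp ((hαβ n).hol_inv.mono fun w hw => (hsub (ball_subset_closedBall hw)).1) h1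
    · have hw1 := (hsub (ball_subset_closedBall hw)).1
      have h3 := (hF n h2).1 _ (h1 w hw)
      refine ⟨h3.ne_zero, ?_, (hf _ w hw1).2⟩
      rw [← h3.eq_mk, hg n _ ((hαβ n).maps_inv hw1), (hαβ n).right_inv w hw1]
  · intro w hw x hx
    have hw1 := (hsub (ball_subset_closedBall hw)).1
    refine hGc _ (hβ's w hw) (fun n => β n (x n)) ?_
    refine tendsto_comp_of_locally_uniform_limit_within (s := ball (0 : ℂ) 1) (f := β')
      (hαβ'.hol_inv.continuousOn w hw1) (tendsto_nhdsWithin_iff.2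
        ⟨hx, hx (isOpen_ball.mem_nhds hw1)⟩) fun u hu => ?_
    obtain ⟨t, ht, h1⟩ := hβ u hu w hw1
    exact ⟨t, ht, hU h1⟩
  -- Vanishing of G ∘ β' near `z` would make G vanish near β' z, hence everywhere by the identity
  -- theorem, although G(0) ≠ 0.
  · intro hzero
    have h1 : Tendsto α' (𝓝 (β' z)) (𝓝 z) := by
      have := (hαβ'.hol.continuousOn.continuousAt (isOpen_ball.mem_nhds hβz)).tendsto
      rwa [hαβ'.right_inv z hz] at this
    have h2 : G =ᶠ[𝓝 (β' z)] 0 := by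
      filter_upwards [h1 hzero, isOpen_ball.mem_nhds hβz] with y hy hyb
      have hy' : G (β' (α' y)) = 0 := hy
      rwa [hαβ'.left_inv y hyb] at hy'
    have h3 : AnalyticOnNhd ℂ G (ball 0 s) := hGa
    exact hG0 (h3.eqOn_zero_of_preconnected_of_eventuallyEq_zero
      (convex_ball (0 : ℂ) s).isPreconnected hβzs h2 h0s)

theorem HasConvergentSubseq.of_comp {X : Set (PN N)} {f : ℕ → ℂ → PN N} {φ : ℕ → ℕ}
    (hφ : StrictMono φ) (h : HasConvergentSubseq X fun n => f (φ n)) : HasConvergentSubseq X f := by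
  obtain ⟨ψ, hψ, b, hb⟩ := h
  exact ⟨φ ∘ ψ, hφ.comp hψ, b, hb⟩

theorem IsNormalization.exists_tendsto_discDegree {X Z : Set (PN N)} (hX : IsZariskiClosed X)
    {k : ℕ} (hk : 0 < k) {m : Cn N → ℝ} (hm : IsMetricO1 X m) {ηH : Form11 N}
    (hηH : IsAmpleChernForm X k m ηH) {f g : ℕ → ℂ → PN N} (hf : ∀ n, IsHolDisc X (f n))
    (hconv : ¬ HasConvergentSubseq X f) (hg : IsNormalization f Z g) :
    ∃ (φ : ℕ → ℕ) (s : ℝ), StrictMono φ ∧ 0 < s ∧ s < 1 ∧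
      Tendsto (fun n => discDegree ηH (g (φ n)) s) atTop atTop := by
  by_contra hcon
  have hgX := hg.isHolDisc hf
  obtain ⟨φ, hφ, ⟨α, β, α', β', hαβ, hαβ', -, hβ, hgf⟩, -⟩ := hg
  refine hconv (HasConvergentSubseq.of_comp hφ ?_)
  refine hasConvergentSubseq_of_hasLocalLimit hX (fun n => hf _) (U := hyperfilter ℕ)
    Nat.hyperfilter_le_atTop fun z hz => IsNormalization.hasLocalLimit hX hk hm hηH hf hgX hαβ
      hαβ' hβ hgf (fun s h0 h1 => ?_) Nat.hyperfilter_le_atTop hz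
  -- A radius at which the degrees are not eventually bounded would already provide the divergent
  -- subsequence.
  refine (exists_tendsto_or_eventually_le fun n => discDegree ηH (g n) s).resolve_left ?_
  rintro ⟨ψ, hψ, h⟩
  exact hcon ⟨ψ, s, hψ, h0, h1, h⟩

end JensenCurrents

/-! ### The theorem on limit currents of discs -/

theorem mainTheorem4 (N : ℕ) (X : Set (JensenCurrents.PN N))
    (hX : JensenCurrents.IsProjectiveVariety X)
    -- the metrised ample divisor `H`
    (k : ℕ) (hk : 0 < k) (m : JensenCurrents.Cn N → ℝ) (hm : JensenCurrents.IsMetricO1 X m)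
    (ηH : JensenCurrents.Form11 N) (hηH : JensenCurrents.IsAmpleChernForm X k m ηH)
    -- the boundary divisors
    (D : Set (JensenCurrents.PN N)) (hD : JensenCurrents.IsZariskiClosed D) (hDX : D ⊆ X)
    (bd : JensenCurrents.QCartierDivisor X)
    -- the sequence of discs
    (f : ℕ → ℂ → JensenCurrents.PN N) (hf : ∀ n, JensenCurrents.IsHolDisc (X \ D) (f n))
    (hconv : ¬ JensenCurrents.HasConvergentSubseq X f)
    (hclose : ¬ JensenCurrents.ArbitrarilyClose f (bd.support ∪ D)) :
    (∃ g, JensenCurrents.IsNormalization f (bd.support ∪ D) g) ∧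
    ∀ g, JensenCurrents.IsNormalization f (bd.support ∪ D) g →
      (∃ (φ : ℕ → ℕ) (s : ℝ), StrictMono φ ∧ 0 < s ∧ s < 1 ∧
        Tendsto (fun n => JensenCurrents.discDegree ηH (g (φ n)) s) atTop atTop) ∧
      ∀ (φ : ℕ → ℕ) (s : ℝ), StrictMono φ → 0 < s →
        Tendsto (fun n => JensenCurrents.discDegree ηH (g (φ n)) s) atTop atTop →
        ∀ r : ℝ, s ≤ r → r < 1 →
          (∃ (χ : ℕ → ℕ) (T : JensenCurrents.A11 X →ₗ[ℂ] ℂ), StrictMono χ ∧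
            JensenCurrents.IsWeakLimit X ηH (fun n => g (φ (χ n))) r T) ∧
          ∀ T : JensenCurrents.A11 X →ₗ[ℂ] ℂ,
            JensenCurrents.IsWeakLimit X ηH (fun n => g (φ n)) r T →
            JensenCurrents.IsCurrent T ∧ JensenCurrents.IsPositive T ∧
            JensenCurrents.IsHarmonic T ∧
            ∀ F : JensenCurrents.QCartierDivisor X, F.Effective →
              F.support ⊆ bd.support ∪ D →
              ∀ c : ℂ, JensenCurrents.IsIntersectionNumber T F c → c.im = 0 ∧ 0 ≤ c.re := by
  have hf' : ∀ n, JensenCurrents.IsHolDisc X (f n) := fun n z hz =>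
    ⟨(hf n z hz).1, (hf n z hz).2.1⟩
  refine ⟨JensenCurrents.exists_isNormalization hclose, fun g hg =>
    ⟨hg.exists_tendsto_discDegree hX.closed hk hm hηH hf' hconv, ?_⟩⟩
  intro φ s _ hs hdeg r hsr hr
  have hgX : ∀ n, JensenCurrents.IsHolDisc X (g (φ n)) := fun n => hg.isHolDisc hf' _
  have h0 : 0 < r := hs.trans_le hsr
  have hdeg' := JensenCurrents.tendsto_discDegree_of_le hX.closed hk hm hηH hgX hs hsr hr hdeg
  refine ⟨JensenCurrents.exists_isWeakLimit hX.closed hk hm hηH hgX h0 hr hdeg', fun T hT => ?_⟩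
  obtain ⟨-, -, -, ε, hε, hZ⟩ := hg
  exact ⟨hT.isCurrent hX.closed hk hm hηH hgX h0 hr hdeg', hT.isPositive hgX h0 hr hdeg',
    hT.isHarmonic hX.closed hgX h0 hr hdeg', fun F _ hF c hc =>
    hT.intersection_nonneg hX hgX h0 hr hdeg' hε (fun n => hZ _) hF hc⟩
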